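/- Let $M$ be a smooth three-dimensional manifold with a smooth Riemannian metric $\langle\cdot,\cdot\rangle$ all of whose sectional curvatures are $-1$ (a hyperbolic three-manifold), let $S$ be a smooth surface, let $\epsilon>0$, and let $h:(-\epsilon,\epsilon)\times S\to M$ be a $C^2$ embedding such that for every $t\in(-\epsilon,\epsilon)$ the leaf $h_t=h(t,\cdot):S\to M$ is a minimal surface, that is, its mean curvature vanishes. Let $\vec n$ be a continuous unit normal vector field along the leaf $h_0:S\to M$, let $$f=\Big\langle \frac{\partial h}{\partial t}\Big|_{t=0},\vec n\Big\rangle ,$$ so that $f\,\vec n$ is the component of the variation field normal to the leaf, and assume that $f\in C^2(S)$. Then $$\Delta f=(2-\|A\|^2)\,f\qquad\text{on } S,$$ where $\Delta=\operatorname{div}\operatorname{grad}$ is the Laplace operator of the metric on $S$ induced by $h_0$, and $\|A\|^2$ is the squared norm of the second fundamental form of $h_0$. -/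

import Mathlib

open Set Topology
open scoped Manifold ContDiff Matrix

noncomputable section

namespace MinimalFamily

/-- The model space of `n`-dimensional manifolds. -/
abbrev Euc (n : ℕ) : Type := EuclideanSpace ℝ (Fin n)

/-! ### Riemannian geometry in coordinates

A metric on an open subset of `ℝⁿ` is given by its matrix `G` of coefficients, as a function of
the point. -/

section Coordinates

variable {m n : ℕ}

/-- The partial derivative `∂ᵢ φ (x)`. -/
def partialDeriv {V : Type*} [NormedAddCommGroup V] [NormedSpace ℝ V]
    (i : Fin n) (φ : Euc n → V) (x : Euc n) : V :=
  fderiv ℝ φ x (EuclideanSpace.single i 1)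

/-- The bilinear form `⟨X, Y⟩ = ∑ Gᵢⱼ Xⁱ Yʲ` of a matrix. -/
def pairing (G : Matrix (Fin n) (Fin n) ℝ) (X Y : Fin n → ℝ) : ℝ :=
  ∑ i, ∑ j, G i j * X i * Y j

/-- The Christoffel symbols `Γᵏᵢⱼ` of the Levi-Civita connection of `G`. -/
def christoffel (G : Euc n → Matrix (Fin n) (Fin n) ℝ) (k i j : Fin n) (y : Euc n) : ℝ :=
  1 / 2 * ∑ l, (G y)⁻¹ k l *
    (partialDeriv i (fun z => G z j l) y + partialDeriv j (fun z => G z i l) y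
      - partialDeriv l (fun z => G z i j) y)

/-- The coefficients of the Riemann curvature tensor,
`R(∂ᵢ, ∂ⱼ) ∂ₖ = ∇ᵢ ∇ⱼ ∂ₖ - ∇ⱼ ∇ᵢ ∂ₖ = ∑ Rˡᵢⱼₖ ∂ₗ`. -/
def riemannTensor (G : Euc n → Matrix (Fin n) (Fin n) ℝ) (l i j k : Fin n) (y : Euc n) : ℝ :=
  partialDeriv i (christoffel G l j k) y - partialDeriv j (christoffel G l i k) y
    + ∑ a, (christoffel G l i a y * christoffel G a j k y
      - christoffel G l j a y * christoffel G a i k y)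

/-- The vector `R(X, Y) Z` at `y`. -/
def curvatureOp (G : Euc n → Matrix (Fin n) (Fin n) ℝ) (y : Euc n) (X Y Z : Fin n → ℝ) :
    Fin n → ℝ :=
  fun l => ∑ i, ∑ j, ∑ k, riemannTensor G l i j k y * X i * Y j * Z k

/-- The sectional curvature of the plane spanned by `X` and `Y` at `y`, namely
`⟨R(X, Y) Y, X⟩ / (⟨X, X⟩ ⟨Y, Y⟩ - ⟨X, Y⟩²)`. -/
def sectionalCurvature (G : Euc n → Matrix (Fin n) (Fin n) ℝ) (y : Euc n)
    (X Y : Fin n → ℝ) : ℝ :=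
  pairing (G y) (curvatureOp G y X Y Y) X /
    (pairing (G y) X X * pairing (G y) Y Y - pairing (G y) X Y ^ 2)

/-- The matrix of the metric induced by `u` (the first fundamental form),
`γᵢⱼ = ⟨∂ᵢ u, ∂ⱼ u⟩`. -/
def inducedMatrix (G : Euc n → Matrix (Fin n) (Fin n) ℝ) (u : Euc m → Euc n) (x : Euc m) :
    Matrix (Fin m) (Fin m) ℝ :=
  Matrix.of fun i j => pairing (G (u x)) (partialDeriv i u x).ofLp (partialDeriv j u x).ofLp

/-- The ambient covariant derivative `∇_{∂ᵢ} (∂ⱼ u)` of the tangent field `∂ⱼ u` along `u`. -/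
def ambientDeriv (G : Euc n → Matrix (Fin n) (Fin n) ℝ) (u : Euc m → Euc n) (i j : Fin m)
    (x : Euc m) : Fin n → ℝ :=
  fun a => partialDeriv i (partialDeriv j u) x a
    + ∑ b, ∑ c, christoffel G a b c (u x) * partialDeriv i u x b * partialDeriv j u x c

/-- The second fundamental form `A(∂ᵢ, ∂ⱼ)` of `u`, with values in the normal space: the component
of `∇_{∂ᵢ} (∂ⱼ u)` orthogonal to all the `∂ₖ u`. -/
def secondForm (G : Euc n → Matrix (Fin n) (Fin n) ℝ) (u : Euc m → Euc n) (i j : Fin m)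
    (x : Euc m) : Fin n → ℝ :=
  fun a => ambientDeriv G u i j x a
    - ∑ k, ∑ l, (inducedMatrix G u x)⁻¹ k l
      * pairing (G (u x)) (ambientDeriv G u i j x) (partialDeriv l u x).ofLp * partialDeriv k u x a

/-- The mean curvature vector of `u`: the trace of the second fundamental form with respect to the
induced metric. -/
def meanCurvature (G : Euc n → Matrix (Fin n) (Fin n) ℝ) (u : Euc m → Euc n) (x : Euc m) :
    Fin n → ℝ :=
  fun a => ∑ i, ∑ j, (inducedMatrix G u x)⁻¹ i j * secondForm G u i j x a

/-- The squared norm of the second fundamental form of `u`,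
`‖A‖² = ∑ γⁱᵏ γʲˡ ⟨A(∂ᵢ, ∂ⱼ), A(∂ₖ, ∂ₗ)⟩`. -/
def secondFormNormSq (G : Euc n → Matrix (Fin n) (Fin n) ℝ) (u : Euc m → Euc n) (x : Euc m) :
    ℝ :=
  ∑ i, ∑ j, ∑ k, ∑ l, (inducedMatrix G u x)⁻¹ i k * (inducedMatrix G u x)⁻¹ j l
    * pairing (G (u x)) (secondForm G u i j x) (secondForm G u k l x)

/-- The Laplace-Beltrami operator `Δ = div grad` of a metric `γ`,
`Δφ = (det γ)^(-1/2) ∑ ∂ᵢ ((det γ)^(1/2) γⁱʲ ∂ⱼ φ)`. -/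
def laplaceBeltrami (γ : Euc m → Matrix (Fin m) (Fin m) ℝ) (φ : Euc m → ℝ) (x : Euc m) : ℝ :=
  (√(γ x).det)⁻¹ * ∑ i, partialDeriv i
    (fun z => √(γ z).det * ∑ j, (γ z)⁻¹ i j * partialDeriv j φ z) x

end Coordinates

/-! ### Riemannian three-manifolds and surfaces in them, read in charts -/

section Manifolds

variable {M : Type*} [TopologicalSpace M] [ChartedSpace (Euc 3) M]
  [IsManifold 𝓘(ℝ, Euc 3) ∞ M]
variable {S : Type*} [TopologicalSpace S] [ChartedSpace (Euc 2) S]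

variable (M) in
/-- Smooth Riemannian metrics on `M`. -/
abbrev Metric : Type _ :=
  Bundle.ContMDiffRiemannianMetric 𝓘(ℝ, Euc 3) ∞ (Euc 3)
    (fun x : M => TangentSpace 𝓘(ℝ, Euc 3) x)

/-- The coefficients of the metric `g` in the chart around `q`. -/
def metricMatrix (g : Metric M) (q : M) (y : Euc 3) : Matrix (Fin 3) (Fin 3) ℝ :=
  Matrix.of fun i j =>
    g.inner ((extChartAt 𝓘(ℝ, Euc 3) q).symm y)
      (mfderiv 𝓘(ℝ, Euc 3) 𝓘(ℝ, Euc 3) (extChartAt 𝓘(ℝ, Euc 3) q).symm y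
        (EuclideanSpace.single i 1))
      (mfderiv 𝓘(ℝ, Euc 3) 𝓘(ℝ, Euc 3) (extChartAt 𝓘(ℝ, Euc 3) q).symm y
        (EuclideanSpace.single j 1))

/-- The metric `g` is hyperbolic: all sectional curvatures, at all points and computed in any
chart there, are equal to `-1`. -/
def IsHyperbolic (g : Metric M) : Prop :=
  ∀ q : M, ∀ y ∈ (extChartAt 𝓘(ℝ, Euc 3) q).target, ∀ X Y : Fin 3 → ℝ,
    LinearIndependent ℝ ![X, Y] → sectionalCurvature (metricMatrix g q) y X Y = -1

/-- The map `F : S → M` read in the chart of `S` around `c` and the chart of `M` around `q`. -/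
def localRep (F : S → M) (c : S) (q : M) : Euc 2 → Euc 3 :=
  fun x => extChartAt 𝓘(ℝ, Euc 3) q (F ((extChartAt 𝓘(ℝ, Euc 2) c).symm x))

/-- The immersion `F : S → M` is minimal: its mean curvature vector, computed in any charts,
vanishes at all points. -/
def IsMinimal (g : Metric M) (F : S → M) : Prop :=
  ∀ (c : S) (q : M) (p : S), p ∈ (chartAt (Euc 2) c).source → F p ∈ (chartAt (Euc 3) q).source →
    meanCurvature (metricMatrix g q) (localRep F c q) (extChartAt 𝓘(ℝ, Euc 2) c p) = 0

/-- The squared norm `‖A‖²` at `p` of the second fundamental form of the immersion `F : S → M`. -/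
def normSqSecondForm (g : Metric M) (F : S → M) (p : S) : ℝ :=
  secondFormNormSq (metricMatrix g (F p)) (localRep F p (F p)) (extChartAt 𝓘(ℝ, Euc 2) p p)

/-- The Laplacian `Δf` at `p` of a function `f` on `S`, with respect to the metric induced by the
immersion `F : S → M`. -/
def laplacian (g : Metric M) (F : S → M) (f : S → ℝ) (p : S) : ℝ :=
  laplaceBeltrami (inducedMatrix (metricMatrix g (F p)) (localRep F p (F p)))
    (fun x => f ((extChartAt 𝓘(ℝ, Euc 2) p).symm x)) (extChartAt 𝓘(ℝ, Euc 2) p p)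

/-- `ν` is a continuous unit normal vector field along the immersion `F : S → M`. -/
structure IsUnitNormal (g : Metric M) (F : S → M)
    (ν : ∀ p : S, TangentSpace 𝓘(ℝ, Euc 3) (F p)) : Prop where
  continuous : Continuous fun p => (⟨F p, ν p⟩ : TangentBundle 𝓘(ℝ, Euc 3) M)
  norm_eq_one : ∀ p, g.inner (F p) (ν p) (ν p) = 1
  orthogonal : ∀ p (v : TangentSpace 𝓘(ℝ, Euc 2) p),
    g.inner (F p) (ν p) (mfderiv 𝓘(ℝ, Euc 2) 𝓘(ℝ, Euc 3) F p v) = 0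

/-- `h` restricts to a `C²` embedding of `(-ε, ε) × S` into `M` (a `C²` immersion that is a
homeomorphism onto its image), all of whose leaves `h({t} × S)` are minimal. -/
structure IsMinimalFamily (g : Metric M) (ε : ℝ) (h : ℝ × S → M) : Prop where
  pos : 0 < ε
  contMDiffOn : ContMDiffOn (𝓘(ℝ, ℝ).prod 𝓘(ℝ, Euc 2)) 𝓘(ℝ, Euc 3) 2 h (Ioo (-ε) ε ×ˢ univ)
  injective_mfderiv : ∀ z ∈ Ioo (-ε) ε ×ˢ (univ : Set S),
    Function.Injective (mfderiv (𝓘(ℝ, ℝ).prod 𝓘(ℝ, Euc 2)) 𝓘(ℝ, Euc 3) h z)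
  isEmbedding : IsEmbedding ((Ioo (-ε) ε ×ˢ (univ : Set S)).domRestrict h)
  minimal : ∀ t ∈ Ioo (-ε) ε, IsMinimal g fun p => h (t, p)

/-- The variation field `h_*(∂/∂t)` along the leaf `t = 0`. -/
def variationField (h : ℝ × S → M) (p : S) : TangentSpace 𝓘(ℝ, Euc 3) (h (0, p)) :=
  mfderiv 𝓘(ℝ, ℝ) 𝓘(ℝ, Euc 3) (fun t : ℝ => h (t, p)) 0 (1 : ℝ)

end Manifolds

end MinimalFamily

end

noncomputable section

namespace MinimalFamily

/-! ### Divergence identities for continuous fields, in the sense of distributions -/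

section WeakDivergence

open MeasureTheory

variable {m : ℕ}

/-! The equation is the Jacobi equation `Δf + (‖A‖² + Ric(ν, ν)) f = 0` with `Ric(ν, ν) = -2`,
obtained by differentiating the minimal surface equation across the leaves. The difficulty is
regularity. In charts the family is a `C²` map `u(t, x)`, the mean curvature of a leaf already
involves its second derivatives, and so it cannot be differentiated in `t` classically.

The remedy is to keep the minimal surface equation in divergence form. Put `Pⁱ = √(det γ) γⁱʲ ∂ⱼu`,
the `stress`, which is only `C¹`. A leaf is minimal exactly when the covariant divergence of `P`
vanishes, that is `∂ᵢPⁱ = -Γ(∂ᵢu, Pⁱ)` (`fderiv_stress_sum`). Both `P` and the right side are `C¹`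
in `(t, x)`, so the identity can be differentiated in any fixed direction of parameter space, the
divergence being read in the sense of distributions (`hasWeakDiv_fderiv`).

The variation field need not be normal. Subtracting its tangential part turns `∂/∂t` into a
direction `w` (`normalDir`) with `C¹` coefficients along which `u` moves by `f ν`. The normal `ν`,
given as continuous, is `C¹` because the tangent planes are (`contDiffOn_of_unit_normal`). Weak
divergences may be multiplied by `C¹` functions, so the differentiated identities combine into one
for `⟨ν, ∇_w Pⁱ⟩`, in which commuting the covariant derivatives produces the curvature of the
ambient space (`hasContWeakDiv_normal`).

It remains to compute. The field `⟨ν, ∇_w Pⁱ⟩` is `√(det γ) γⁱʲ ∂ⱼf`. On the other side, curvature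
`-1` contributes `2 √(det γ) f` (`sum_curvature`) and the remaining terms contribute `-√(det γ) ‖A‖²
f` (`second_variation_algebra`, which uses minimality again). The terms from the tangential part of
the variation cancel. Finally `f` is `C²`, so the gradient field is `C¹`, its weak divergence is its
classical one (`HasWeakDiv.eqOn`), and the equation holds at every point. -/

/-- `q` is the divergence of the vector field `Z` on `U` in the sense of distributions. -/
def HasWeakDiv (U : Set (Euc m)) (Z : Fin m → Euc m → ℝ) (q : Euc m → ℝ) : Prop :=
  ∀ φ : Euc m → ℝ, ContDiff ℝ 1 φ → HasCompactSupport φ → tsupport φ ⊆ U →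
    ∫ x, (φ x * q x + ∑ i, partialDeriv i φ x * Z i x) = 0

theorem tsupport_partialDeriv_subset (i : Fin m) (φ : Euc m → ℝ) :
    tsupport (partialDeriv i φ) ⊆ tsupport φ := by
  refine closure_minimal (fun x hx => ?_) (isClosed_tsupport φ)
  by_contra h
  refine hx ?_
  have : φ =ᶠ[𝓝 x] fun _ => 0 := notMem_tsupport_iff_eventuallyEq.mp h
  simp [partialDeriv, this.fderiv_eq]

theorem continuous_partialDeriv {φ : Euc m → ℝ} (hφ : ContDiff ℝ 1 φ) (i : Fin m) :
    Continuous (partialDeriv i φ) :=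
  (hφ.continuous_fderiv one_ne_zero).clm_apply continuous_const

theorem continuous_mul_of_tsupport_subset {X : Type*} [TopologicalSpace X] {U : Set X}
    (hU : IsOpen U) {φ q : X → ℝ} (hφ : Continuous φ) (hs : tsupport φ ⊆ U)
    (hq : ContinuousOn q U) : Continuous fun x => φ x * q x := by
  refine continuous_iff_continuousAt.mpr fun x => ?_
  by_cases hx : x ∈ U
  · exact hφ.continuousAt.mul (hq.continuousAt (hU.mem_nhds hx))
  · have h : φ =ᶠ[𝓝 x] fun _ => 0 :=
      notMem_tsupport_iff_eventuallyEq.mp fun h' => hx (hs h')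
    have : (fun x => φ x * q x) =ᶠ[𝓝 x] fun _ => 0 := by
      filter_upwards [h] with y hy
      simp [hy]
    exact continuousAt_const.congr this.symm

theorem contDiff_mul_of_tsupport_subset {U : Set (Euc m)} (hU : IsOpen U) {φ T : Euc m → ℝ}
    (hφ : ContDiff ℝ 1 φ) (hs : tsupport φ ⊆ U) (hT : ContDiffOn ℝ 1 T U) :
    ContDiff ℝ 1 fun x => φ x * T x := by
  refine contDiff_iff_contDiffAt.mpr fun x => ?_
  by_cases hx : x ∈ U
  · exact hφ.contDiffAt.mul (hT.contDiffAt (hU.mem_nhds hx))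
  · have h : φ =ᶠ[𝓝 x] fun _ => 0 :=
      notMem_tsupport_iff_eventuallyEq.mp fun h' => hx (hs h')
    have : (fun x => φ x * T x) =ᶠ[𝓝 x] fun _ => 0 := by
      filter_upwards [h] with y hy
      simp [hy]
    exact contDiffAt_const.congr_of_eventuallyEq this

theorem continuous_weakDiv_integrand {U : Set (Euc m)} (hU : IsOpen U) {Z : Fin m → Euc m → ℝ}
    {q : Euc m → ℝ} (hZ : ∀ i, ContinuousOn (Z i) U) (hq : ContinuousOn q U) {φ : Euc m → ℝ}
    (hφ : ContDiff ℝ 1 φ) (hs : tsupport φ ⊆ U) :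
    Continuous fun x => φ x * q x + ∑ i, partialDeriv i φ x * Z i x :=
  (continuous_mul_of_tsupport_subset hU hφ.continuous hs hq).add
    (continuous_finsetSum _ fun i _ => continuous_mul_of_tsupport_subset hU
      (continuous_partialDeriv hφ i) ((tsupport_partialDeriv_subset i φ).trans hs) (hZ i))

theorem weakDiv_integrand_eq_zero {Z : Fin m → Euc m → ℝ} {q : Euc m → ℝ} {φ : Euc m → ℝ}
    {x : Euc m} (hx : x ∉ tsupport φ) :
    φ x * q x + ∑ i, partialDeriv i φ x * Z i x = 0 := by
  have h1 : ∀ i, partialDeriv i φ x = 0 := fun i =>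
    image_eq_zero_of_notMem_tsupport fun h => hx (tsupport_partialDeriv_subset i φ h)
  simp [h1, image_eq_zero_of_notMem_tsupport hx]

theorem integrable_weakDiv_integrand {U : Set (Euc m)} (hU : IsOpen U) {Z : Fin m → Euc m → ℝ}
    {q : Euc m → ℝ} (hZ : ∀ i, ContinuousOn (Z i) U) (hq : ContinuousOn q U) {φ : Euc m → ℝ}
    (hφ : ContDiff ℝ 1 φ) (hc : HasCompactSupport φ) (hs : tsupport φ ⊆ U) :
    Integrable fun x => φ x * q x + ∑ i, partialDeriv i φ x * Z i x :=
  (continuous_weakDiv_integrand hU hZ hq hφ hs).integrable_of_hasCompactSupport <|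
    HasCompactSupport.intro hc fun _ hx => weakDiv_integrand_eq_zero hx

theorem HasWeakDiv.congr {U : Set (Euc m)} {Z Z' : Fin m → Euc m → ℝ} {q q' : Euc m → ℝ}
    (h : HasWeakDiv U Z q) (hZ : ∀ x ∈ U, ∀ i, Z' i x = Z i x) (hq : ∀ x ∈ U, q' x = q x) :
    HasWeakDiv U Z' q' := by
  intro φ hφ hc hs
  rw [← h φ hφ hc hs]
  congr 1
  ext x
  by_cases hx : x ∈ U
  · simp [hZ x hx, hq x hx]
  · have hx' : x ∉ tsupport φ := fun h' => hx (hs h')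
    rw [weakDiv_integrand_eq_zero hx', weakDiv_integrand_eq_zero hx']

theorem HasWeakDiv.zero (U : Set (Euc m)) : HasWeakDiv U (fun _ _ => 0) (fun _ => 0) := by
  intro φ _ _ _
  simp

theorem HasWeakDiv.add {U : Set (Euc m)} (hU : IsOpen U) {Z Z' : Fin m → Euc m → ℝ}
    {q q' : Euc m → ℝ} (h : HasWeakDiv U Z q) (h' : HasWeakDiv U Z' q')
    (hZ : ∀ i, ContinuousOn (Z i) U) (hq : ContinuousOn q U)
    (hZ' : ∀ i, ContinuousOn (Z' i) U) (hq' : ContinuousOn q' U) :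
    HasWeakDiv U (fun i x => Z i x + Z' i x) (fun x => q x + q' x) := by
  intro φ hφ hc hs
  have e := congrArg₂ (· + ·) (h φ hφ hc hs) (h' φ hφ hc hs)
  simp only [add_zero] at e
  rw [← e, ← integral_add (integrable_weakDiv_integrand hU hZ hq hφ hc hs)
    (integrable_weakDiv_integrand hU hZ' hq' hφ hc hs)]
  congr 1
  ext x
  simp only [mul_add, Finset.sum_add_distrib]
  ring

theorem HasWeakDiv.sum {ι : Type*} {U : Set (Euc m)} (hU : IsOpen U)
    {Z : ι → Fin m → Euc m → ℝ} {q : ι → Euc m → ℝ} (s : Finset ι)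
    (h : ∀ a, HasWeakDiv U (Z a) (q a))
    (hZ : ∀ a i, ContinuousOn (Z a i) U) (hq : ∀ a, ContinuousOn (q a) U) :
    HasWeakDiv U (fun i x => ∑ a ∈ s, Z a i x) (fun x => ∑ a ∈ s, q a x) := by
  classical
  induction s using Finset.induction_on with
  | empty => simpa using HasWeakDiv.zero U
  | insert a s ha ih =>
    simp only [Finset.sum_insert ha]
    exact (h a).add hU ih (hZ a) (hq a)
      (fun i => continuousOn_finsetSum _ fun b _ => hZ b i)
      (continuousOn_finsetSum _ fun b _ => hq b)

/-- The product `φ T` is again an admissible test function. This is why test functions are only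
required to be `C¹`: the multipliers used later (metric, normal, tangential components) are no
better. -/
theorem HasWeakDiv.mul {U : Set (Euc m)} (hU : IsOpen U) {Z : Fin m → Euc m → ℝ}
    {q : Euc m → ℝ} (h : HasWeakDiv U Z q) {T : Euc m → ℝ} (hT : ContDiffOn ℝ 1 T U) :
    HasWeakDiv U (fun i x => T x * Z i x)
      (fun x => T x * q x + ∑ i, partialDeriv i T x * Z i x) := by
  intro φ hφ hc hs
  have hsub : tsupport (fun x => φ x * T x) ⊆ tsupport φ := tsupport_mul_subset_left
  rw [← h (fun x => φ x * T x) (contDiff_mul_of_tsupport_subset hU hφ hs hT)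
    (hc.mul_right) (hsub.trans hs)]
  congr 1
  ext x
  by_cases hx : x ∈ U
  · have hTx : DifferentiableAt ℝ T x :=
      (hT.contDiffAt (hU.mem_nhds hx)).differentiableAt one_ne_zero
    have hφx : DifferentiableAt ℝ φ x := hφ.contDiffAt.differentiableAt one_ne_zero
    have : ∀ i, partialDeriv i (fun x => φ x * T x) x
        = φ x * partialDeriv i T x + T x * partialDeriv i φ x := by
      intro i
      simp [partialDeriv, fderiv_fun_mul hφx hTx]
    simp only [this, add_mul, mul_add, Finset.sum_add_distrib, Finset.mul_sum]
    rw [← add_assoc]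
    congr 1
    · congr 1
      · ring
      · exact Finset.sum_congr rfl fun i _ => by ring
    · exact Finset.sum_congr rfl fun i _ => by ring
  · have hx' : x ∉ tsupport φ := fun h' => hx (hs h')
    exact (weakDiv_integrand_eq_zero (Z := fun i x => T x * Z i x)
      (q := fun x => T x * q x + ∑ i, partialDeriv i T x * Z i x) hx').trans
      (weakDiv_integrand_eq_zero (φ := fun x => φ x * T x) fun h' => hx' (hsub h')).symm

theorem integral_partialDeriv_mul_eq_neg {U : Set (Euc m)} (hU : IsOpen U) {φ Z : Euc m → ℝ}
    (hφ : ContDiff ℝ 1 φ) (hc : HasCompactSupport φ) (hs : tsupport φ ⊆ U)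
    (hZ : ContDiffOn ℝ 1 Z U) (i : Fin m) :
    ∫ x, (φ x * partialDeriv i Z x + partialDeriv i φ x * Z x) = 0 := by
  have hsub : tsupport (fun x => φ x * Z x) ⊆ tsupport φ := tsupport_mul_subset_left
  have hcd : ContDiff ℝ 1 fun x => φ x * Z x := contDiff_mul_of_tsupport_subset hU hφ hs hZ
  have hcs : HasCompactSupport fun x => φ x * Z x := hc.mul_right
  have hi : Integrable (fun x => fderiv ℝ (fun x => φ x * Z x) x (EuclideanSpace.single i 1)) :=
    (continuous_partialDeriv hcd i).integrable_of_hasCompactSupport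
      (HasCompactSupport.intro hcs fun x hx => image_eq_zero_of_notMem_tsupport
        fun h => hx (tsupport_partialDeriv_subset i _ h))
  -- Integration by parts against the constant `1`: the integral of a derivative of the compactly
  -- supported function `φ Z` vanishes.
  have key := integral_mul_fderiv_eq_neg_fderiv_mul_of_integrable (μ := volume)
    (f := fun x => φ x * Z x) (g := fun _ => (1 : ℝ)) (v := EuclideanSpace.single i 1)
    (by simpa using hi)
    (by simp) (by simpa using hcd.continuous.integrable_of_hasCompactSupport hcs)
    (fun x _ => hcd.differentiable one_ne_zero x) (fun x _ => differentiableAt_const _)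
  simp only [fderiv_const_apply, zero_apply, mul_zero,
    integral_zero, mul_one] at key
  rw [eq_comm, neg_eq_zero] at key
  rw [← key]
  congr 1
  ext x
  by_cases hx : x ∈ U
  · have hZx : DifferentiableAt ℝ Z x :=
      (hZ.contDiffAt (hU.mem_nhds hx)).differentiableAt one_ne_zero
    have hφx : DifferentiableAt ℝ φ x := hφ.contDiffAt.differentiableAt one_ne_zero
    simp [partialDeriv, fderiv_fun_mul hφx hZx]
    ring
  · have hx' : x ∉ tsupport φ := fun h' => hx (hs h')
    have h1 : partialDeriv i φ x = 0 :=
      image_eq_zero_of_notMem_tsupport fun h => hx' (tsupport_partialDeriv_subset i φ h)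
    have h2 : partialDeriv i (fun x => φ x * Z x) x = 0 :=
      image_eq_zero_of_notMem_tsupport fun h =>
        hx' (hsub (tsupport_partialDeriv_subset i _ h))
    rw [h1, image_eq_zero_of_notMem_tsupport hx']
    simpa [partialDeriv] using h2.symm

theorem continuousOn_partialDeriv {U : Set (Euc m)} (hU : IsOpen U) {Z : Euc m → ℝ}
    (hZ : ContDiffOn ℝ 1 Z U) (i : Fin m) : ContinuousOn (partialDeriv i Z) U :=
  (hZ.continuousOn_fderiv_of_isOpen hU le_rfl).clm_apply continuousOn_const

theorem hasWeakDiv_of_contDiffOn {U : Set (Euc m)} (hU : IsOpen U) {Z : Fin m → Euc m → ℝ}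
    {q : Euc m → ℝ} (hZ : ∀ i, ContDiffOn ℝ 1 (Z i) U)
    (hq : ∀ x ∈ U, ∑ i, partialDeriv i (Z i) x = q x) : HasWeakDiv U Z q := by
  refine HasWeakDiv.congr (q := fun x => ∑ i, partialDeriv i (Z i) x) (Z := Z) ?_
    (fun _ _ _ => rfl) fun x hx => (hq x hx).symm
  intro φ hφ hc hs
  simp only [Finset.mul_sum, ← Finset.sum_add_distrib]
  rw [integral_finsetSum]
  · exact Finset.sum_eq_zero fun i _ =>
      integral_partialDeriv_mul_eq_neg hU hφ hc hs (hZ i) i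
  · intro i _
    refine Continuous.integrable_of_hasCompactSupport ?_ (HasCompactSupport.intro hc ?_)
    · exact (continuous_mul_of_tsupport_subset hU hφ.continuous hs
        (continuousOn_partialDeriv hU (hZ i) i)).add
        (continuous_mul_of_tsupport_subset hU (continuous_partialDeriv hφ i)
          ((tsupport_partialDeriv_subset i φ).trans hs) (hZ i).continuousOn)
    · intro x hx
      have h1 : partialDeriv i φ x = 0 :=
        image_eq_zero_of_notMem_tsupport fun h => hx (tsupport_partialDeriv_subset i φ h)
      simp [h1, image_eq_zero_of_notMem_tsupport hx]

/-- The fundamental lemma of the calculus of variations gives equality almost everywhere on `U`;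
both sides are continuous and `U` is open, so it holds everywhere. This is the return from
distributions to the classical equation. -/
theorem HasWeakDiv.eqOn {U : Set (Euc m)} (hU : IsOpen U) {Z : Fin m → Euc m → ℝ}
    {q : Euc m → ℝ} (h : HasWeakDiv U Z q) (hZ : ∀ i, ContDiffOn ℝ 1 (Z i) U)
    (hq : ContinuousOn q U) : ∀ x ∈ U, ∑ i, partialDeriv i (Z i) x = q x := by
  have hdiv : ContinuousOn (fun x => ∑ i, partialDeriv i (Z i) x) U :=
    continuousOn_finsetSum _ fun i _ => continuousOn_partialDeriv hU (hZ i) i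
  have hZ0 : ∀ i, ContinuousOn (Z i) U := fun i => (hZ i).continuousOn
  have hae : ∀ᵐ x ∂(volume : Measure (Euc m)),
      x ∈ U → q x - ∑ i, partialDeriv i (Z i) x = 0 := by
    refine hU.ae_eq_zero_of_integral_contDiff_smul_eq_zero
      ((hq.sub hdiv).locallyIntegrableOn hU.measurableSet) ?_
    intro φ hφ hc hs
    have hφ1 : ContDiff ℝ 1 φ := hφ.of_le (by exact_mod_cast le_top)
    have h1 := h φ hφ1 hc hs
    have h2 := hasWeakDiv_of_contDiffOn hU hZ (fun x _ => rfl) φ hφ1 hc hs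
    have e := congrArg₂ (· - ·) h1 h2
    simp only [sub_zero] at e
    rw [← e, ← integral_sub (integrable_weakDiv_integrand hU hZ0 hq hφ1 hc hs)
      (integrable_weakDiv_integrand hU hZ0 hdiv hφ1 hc hs)]
    congr 1
    ext x
    simp only [smul_eq_mul]
    ring
  have := Measure.eqOn_open_of_ae_eq (μ := (volume : Measure (Euc m))) (U := U)
    (f := q) (g := fun x => ∑ i, partialDeriv i (Z i) x)
    ((ae_restrict_iff' hU.measurableSet).mpr (by
      filter_upwards [hae] with x hx hxU using sub_eq_zero.mp (hx hxU))) hU hq hdiv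
  exact fun x hx => (this hx).symm

end WeakDivergence

/-! ### Differentiating a family of divergence identities -/

section WeakDivergence

open MeasureTheory

variable {m : ℕ}

/-- A one-parameter family of divergence identities may be differentiated in the sense of
distributions, in any direction of parameter and space. -/
theorem hasWeakDiv_fderiv {D : Set (ℝ × Euc m)} (hD : IsOpen D) {U : Set (Euc m)}
    (hUD : ∀ x ∈ U, ((0 : ℝ), x) ∈ D) {P : Fin m → ℝ × Euc m → ℝ}
    {Q : ℝ × Euc m → ℝ} (hP : ∀ i, ContDiffOn ℝ 1 (P i) D) (hQ : ContDiffOn ℝ 1 Q D)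
    (hdiv : ∀ z ∈ D, ∑ i, fderiv ℝ (P i) z (0, EuclideanSpace.single i 1) = Q z)
    (v : ℝ × Euc m) :
    HasWeakDiv U (fun i x => fderiv ℝ (P i) (0, x) v) (fun x => fderiv ℝ Q (0, x) v) := by
  intro φ hφ hc hs
  set K := tsupport φ with hK
  have hKc : IsCompact K := hc
  let A : ℝ → Euc m → ℝ × Euc m := fun s x => (0, x) + s • v
  have hA : Continuous fun p : ℝ × Euc m => A p.1 p.2 := by fun_prop
  obtain ⟨δ, hδ, hδD⟩ : ∃ δ > 0, ∀ s : ℝ, |s| ≤ δ → ∀ x ∈ K, A s x ∈ D := by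
    have hK' : IsCompact ((fun x : Euc m => ((0 : ℝ), x)) '' K) :=
      hKc.image (by fun_prop)
    obtain ⟨η, hη, hηD⟩ := hK'.exists_cthickening_subset_open hD (by
      rintro _ ⟨x, hx, rfl⟩
      exact hUD x (hs hx))
    -- The displacement `s • v` then has norm at most `η`; the `+ 1` covers `v = 0`.
    refine ⟨η / (‖v‖ + 1), by positivity, fun s hs' x hx => hηD ?_⟩
    refine Metric.mem_cthickening_of_dist_le _ (0, x) _ _ ⟨x, hx, rfl⟩ ?_
    rw [dist_eq_norm, add_sub_cancel_left, norm_smul, Real.norm_eq_abs]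
    calc |s| * ‖v‖ ≤ η / (‖v‖ + 1) * (‖v‖ + 1) := by gcongr; linarith
      _ = η := by field_simp
  have hfd : ∀ {φ : ℝ × Euc m → ℝ}, ContDiffOn ℝ 1 φ D →
      ContinuousOn (fun z => fderiv ℝ φ z v) D := fun h =>
    (h.continuousOn_fderiv_of_isOpen hD le_rfl).clm_apply continuousOn_const
  let F : ℝ → Euc m → ℝ := fun s x => φ x * Q (A s x) + ∑ i, partialDeriv i φ x * P i (A s x)
  let F' : ℝ → Euc m → ℝ := fun s x =>
    φ x * fderiv ℝ Q (A s x) v + ∑ i, partialDeriv i φ x * fderiv ℝ (P i) (A s x) v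
  have hF0 : ∀ s x, x ∉ K → F s x = 0 := fun s x hx =>
    weakDiv_integrand_eq_zero (Z := fun i x => P i (A s x)) (q := fun x => Q (A s x)) hx
  have hF'0 : ∀ s x, x ∉ K → F' s x = 0 := fun s x hx =>
    weakDiv_integrand_eq_zero (Z := fun i x => fderiv ℝ (P i) (A s x) v)
      (q := fun x => fderiv ℝ Q (A s x) v) hx
  let V : ℝ → Set (Euc m) := fun s => {x | A s x ∈ D}
  have hAs : ∀ s, ContDiff ℝ 1 (A s) := fun s => by fun_prop
  have hV : ∀ s, IsOpen (V s) := fun s => hD.preimage (hAs s).continuous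
  have hKV : ∀ s, |s| ≤ δ → K ⊆ V s := fun s h x hx => hδD s h x hx
  have hmaps : ∀ s, MapsTo (A s) (V s) D := fun s x hx => hx
  have hFi : ∀ s, |s| ≤ δ → Integrable (F s) := fun s h =>
    integrable_weakDiv_integrand (hV s)
      (fun i => (hP i).continuousOn.comp (hAs s).continuous.continuousOn (hmaps s))
      (hQ.continuousOn.comp (hAs s).continuous.continuousOn (hmaps s)) hφ hc (hKV s h)
  have hF'i : Integrable (F' 0) :=
    integrable_weakDiv_integrand (hV 0)
      (fun i => (hfd (hP i)).comp (hAs 0).continuous.continuousOn (hmaps 0))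
      ((hfd hQ).comp (hAs 0).continuous.continuousOn (hmaps 0)) hφ hc
      (hKV 0 (by simpa using hδ.le))
  -- Translating by `s • v` leaves the spatial derivatives unchanged, so the translated fields
  -- satisfy the same divergence identity near `K`.
  have hint : ∀ s, |s| ≤ δ → ∫ x, F s x = 0 := fun s h => by
    refine hasWeakDiv_of_contDiffOn (hV s) (Z := fun i x => P i (A s x))
      (q := fun x => Q (A s x)) (fun i => (hP i).comp (hAs s).contDiffOn (hmaps s)) ?_
      φ hφ hc (hKV s h)
    intro x hx
    rw [← hdiv _ hx]
    refine Finset.sum_congr rfl fun i _ => ?_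
    have h1 : HasFDerivAt (P i) (fderiv ℝ (P i) (A s x)) (A s x) :=
      (((hP i).contDiffAt (hD.mem_nhds hx)).differentiableAt one_ne_zero).hasFDerivAt
    have h2 : HasFDerivAt (A s) (ContinuousLinearMap.inr ℝ ℝ (Euc m)) x :=
      (ContinuousLinearMap.inr ℝ ℝ (Euc m)).hasFDerivAt.add_const _
    have h3 := (h1.comp x h2).fderiv
    change fderiv ℝ (P i ∘ A s) x _ = _
    rw [h3]
    rfl
  obtain ⟨C, hC⟩ : ∃ C, ∀ p ∈ Icc (-δ) δ ×ˢ K, ‖F' p.1 p.2‖ ≤ C := by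
    refine (isCompact_Icc.prod hKc).exists_bound_of_continuousOn ?_
    have hm : MapsTo (fun p : ℝ × Euc m => A p.1 p.2) (Icc (-δ) δ ×ˢ K) D := fun p hp =>
      hδD _ (abs_le.mpr hp.1) _ hp.2
    exact ((hφ.continuous.comp continuous_snd).continuousOn.mul
      ((hfd hQ).comp hA.continuousOn hm)).add (continuousOn_finsetSum _ fun i _ =>
        ((continuous_partialDeriv hφ i).comp continuous_snd).continuousOn.mul
          ((hfd (hP i)).comp hA.continuousOn hm))
  have hball : Metric.ball (0 : ℝ) δ ∈ 𝓝 (0 : ℝ) := Metric.ball_mem_nhds 0 hδ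
  have habs : ∀ s ∈ Metric.ball (0 : ℝ) δ, |s| ≤ δ := fun s h => by
    simpa [Real.dist_eq] using (Metric.mem_ball.mp h).le
  -- Only `P` and `Q` depend on `s`, and they are `C¹`. So the tested identity can be differentiated
  -- under the integral, although no second derivatives of `P` exist.
  have key := (hasDerivAt_integral_of_dominated_loc_of_deriv_le (μ := volume) (F := F)
    (F' := F') (bound := K.indicator fun _ => C) (x₀ := 0) hball
    (Filter.mem_of_superset hball fun s h => (hFi s (habs s h)).aestronglyMeasurable)
    (hFi 0 (by simpa using hδ.le)) hF'i.aestronglyMeasurable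
    (Filter.Eventually.of_forall fun x s h => by
      by_cases hx : x ∈ K
      · rw [indicator_of_mem hx]
        exact hC (s, x) ⟨abs_le.mp (habs s h), hx⟩
      · rw [indicator_of_notMem hx, hF'0 s x hx, norm_zero])
    ((integrable_indicator_iff hKc.isClosed.measurableSet).mpr
      (integrableOn_const hKc.measure_lt_top.ne))
    (Filter.Eventually.of_forall fun x s h => by
      by_cases hx : x ∈ K
      · have hz : A s x ∈ D := hδD s (habs s h) x hx
        have hd : HasDerivAt (fun s => A s x) v s := by
          have h0 := ((hasDerivAt_id s).smul_const v).const_add ((0 : ℝ), x)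
          simp only [one_smul] at h0
          exact h0
        have hcomp : ∀ {ψ : ℝ × Euc m → ℝ}, ContDiffOn ℝ 1 ψ D →
            HasDerivAt (fun s => ψ (A s x)) (fderiv ℝ ψ (A s x) v) s := fun h =>
          (((h.contDiffAt (hD.mem_nhds hz)).differentiableAt
            one_ne_zero).hasFDerivAt).comp_hasDerivAt s hd
        exact ((hcomp hQ).const_mul _).add
          (HasDerivAt.fun_sum fun i _ => (hcomp (hP i)).const_mul _)
      · have e1 : (fun s => F s x) = fun _ => 0 := funext fun s => hF0 s x hx
        rw [e1, hF'0 s x hx]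
        exact hasDerivAt_const _ _)).2
  have hz : (fun s => ∫ x, F s x) =ᶠ[𝓝 0] fun _ => 0 :=
    Filter.mem_of_superset hball fun s h => hint s (habs s h)
  have := key.unique ((hasDerivAt_const (0 : ℝ) (0 : ℝ)).congr_of_eventuallyEq hz)
  simpa [F', A] using this

end WeakDivergence

/-! ### Metric, Christoffel symbols and curvature as multilinear maps -/

section Forms

variable {n : ℕ}

/-- The bilinear form of a metric matrix. -/
def metricForm (A : Matrix (Fin n) (Fin n) ℝ) :
    (Fin n → ℝ) →ₗ[ℝ] (Fin n → ℝ) →ₗ[ℝ] ℝ :=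
  LinearMap.mk₂ ℝ (pairing A)
    (fun X X' Y => by
      simp only [pairing, Pi.add_apply, mul_add, add_mul, Finset.sum_add_distrib])
    (fun c X Y => by
      simp only [pairing, Pi.smul_apply, smul_eq_mul, Finset.mul_sum]
      exact Finset.sum_congr rfl fun i _ => Finset.sum_congr rfl fun j _ => by ring)
    (fun X Y Y' => by
      simp only [pairing, Pi.add_apply, mul_add, Finset.sum_add_distrib])
    (fun c X Y => by
      simp only [pairing, Pi.smul_apply, smul_eq_mul, Finset.mul_sum]
      exact Finset.sum_congr rfl fun i _ => Finset.sum_congr rfl fun j _ => by ring)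

theorem metricForm_apply (A : Matrix (Fin n) (Fin n) ℝ) (X Y : Fin n → ℝ) :
    metricForm A X Y = pairing A X Y := rfl

theorem metricForm_comm {A : Matrix (Fin n) (Fin n) ℝ} (hA : A.IsSymm) (X Y : Fin n → ℝ) :
    metricForm A X Y = metricForm A Y X := by
  simp only [metricForm_apply, pairing]
  rw [Finset.sum_comm]
  refine Finset.sum_congr rfl fun i _ => Finset.sum_congr rfl fun j _ => ?_
  rw [hA.apply]
  ring

theorem metricForm_eq_sum (A : Matrix (Fin n) (Fin n) ℝ) (X Y : Fin n → ℝ) :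
    metricForm A X Y = ∑ i, ∑ j, A i j * X i * Y j := rfl

/-- The bilinear map `(X, Y) ↦ Γ(X, Y)`, with coefficients `C a b c`. -/
def bilinMap (C : Fin n → Fin n → Fin n → ℝ) :
    (Fin n → ℝ) →ₗ[ℝ] (Fin n → ℝ) →ₗ[ℝ] (Fin n → ℝ) :=
  LinearMap.mk₂ ℝ (fun X Y a => ∑ b, ∑ c, C a b c * X b * Y c)
    (fun X X' Y => by
      ext a
      simp only [Pi.add_apply, mul_add, add_mul, Finset.sum_add_distrib])
    (fun c X Y => by
      ext a
      simp only [Pi.smul_apply, smul_eq_mul, Finset.mul_sum]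
      exact Finset.sum_congr rfl fun i _ => Finset.sum_congr rfl fun j _ => by ring)
    (fun X Y Y' => by
      ext a
      simp only [Pi.add_apply, mul_add, Finset.sum_add_distrib])
    (fun c X Y => by
      ext a
      simp only [Pi.smul_apply, smul_eq_mul, Finset.mul_sum]
      exact Finset.sum_congr rfl fun i _ => Finset.sum_congr rfl fun j _ => by ring)

theorem bilinMap_apply (C : Fin n → Fin n → Fin n → ℝ) (X Y : Fin n → ℝ) (a : Fin n) :
    bilinMap C X Y a = ∑ b, ∑ c, C a b c * X b * Y c := rfl

/-- The bilinear map of the Christoffel symbols at `y`. -/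
abbrev christoffelMap (G : Euc n → Matrix (Fin n) (Fin n) ℝ) (y : Euc n) :
    (Fin n → ℝ) →ₗ[ℝ] (Fin n → ℝ) →ₗ[ℝ] (Fin n → ℝ) :=
  bilinMap fun a b c => christoffel G a b c y

/-- The derivative in the direction `X` of the bilinear map of the Christoffel symbols. -/
abbrev christoffelDeriv (G : Euc n → Matrix (Fin n) (Fin n) ℝ) (y : Euc n) (X : Fin n → ℝ) :
    (Fin n → ℝ) →ₗ[ℝ] (Fin n → ℝ) →ₗ[ℝ] (Fin n → ℝ) :=
  bilinMap fun a b c => ∑ i, partialDeriv i (christoffel G a b c) y * X i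

theorem christoffel_comm {G : Euc n → Matrix (Fin n) (Fin n) ℝ} {y : Euc n}
    (hG : ∀ᶠ z in 𝓝 y, (G z).IsSymm) (k i j : Fin n) :
    christoffel G k i j y = christoffel G k j i y := by
  unfold christoffel
  congr 1
  refine Finset.sum_congr rfl fun l _ => ?_
  have : partialDeriv l (fun z => G z i j) y = partialDeriv l (fun z => G z j i) y := by
    have : (fun z => G z i j) =ᶠ[𝓝 y] fun z => G z j i := by
      filter_upwards [hG] with z hz using hz.apply j i
    simp [partialDeriv, this.fderiv_eq]
  rw [this]
  ring

theorem christoffelMap_comm {G : Euc n → Matrix (Fin n) (Fin n) ℝ} {y : Euc n}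
    (hG : ∀ᶠ z in 𝓝 y, (G z).IsSymm) (X Y : Fin n → ℝ) :
    christoffelMap G y X Y = christoffelMap G y Y X := by
  ext a
  simp only [bilinMap_apply]
  rw [Finset.sum_comm]
  refine Finset.sum_congr rfl fun i _ => Finset.sum_congr rfl fun j _ => ?_
  rw [christoffel_comm hG]
  ring

/-- The Levi-Civita connection is compatible with the metric: `∂ₖ Gᵢⱼ = Γₖᵢ,ⱼ + Γₖⱼ,ᵢ`. -/
theorem partialDeriv_metric {G : Euc n → Matrix (Fin n) (Fin n) ℝ} {y : Euc n}
    (hG : ∀ᶠ z in 𝓝 y, (G z).IsSymm) (hdet : IsUnit (G y).det) (k i j : Fin n) :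
    partialDeriv k (fun z => G z i j) y
      = ∑ a, (christoffel G a k i y * G y a j + christoffel G a k j y * G y a i) := by
  have hsy : (G y).IsSymm := hG.self_of_nhds
  -- Lowering the upper index removes the inverse matrix and leaves the Christoffel symbols of the
  -- first kind; two of these add up to a derivative of the metric.
  have hlow : ∀ k i j : Fin n, ∑ a, christoffel G a k i y * G y a j
      = 1 / 2 * (partialDeriv k (fun z => G z i j) y + partialDeriv i (fun z => G z k j) y
        - partialDeriv j (fun z => G z k i) y) := by
    intro k i j
    simp only [christoffel, Finset.mul_sum, Finset.sum_mul]
    rw [Finset.sum_comm]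
    have : ∀ l, ∑ a, 1 / 2 * ((G y)⁻¹ a l * (partialDeriv k (fun z => G z i l) y
        + partialDeriv i (fun z => G z k l) y - partialDeriv l (fun z => G z k i) y)) * G y a j
        = 1 / 2 * (partialDeriv k (fun z => G z i l) y + partialDeriv i (fun z => G z k l) y
          - partialDeriv l (fun z => G z k i) y) * (if j = l then 1 else 0) := by
      intro l
      have h1 : ∑ a, G y j a * (G y)⁻¹ a l = if j = l then 1 else 0 := by
        rw [← Matrix.mul_apply, Matrix.mul_nonsing_inv _ hdet, Matrix.one_apply]
      rw [← h1, Finset.mul_sum]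
      refine Finset.sum_congr rfl fun a _ => ?_
      rw [hsy.apply j a]
      ring
    simp only [this, mul_ite, mul_one, mul_zero, Finset.sum_ite_eq, Finset.mem_univ, if_true]
  have hs : ∀ k i j : Fin n, partialDeriv k (fun z => G z i j) y
      = partialDeriv k (fun z => G z j i) y := fun k i j => by
    have : (fun z => G z i j) =ᶠ[𝓝 y] fun z => G z j i := by
      filter_upwards [hG] with z hz using hz.apply j i
    simp [partialDeriv, this.fderiv_eq]
  rw [Finset.sum_add_distrib, hlow, hlow, hs k j i, hs j k i, hs i k j, hs k i j]
  ring

theorem fderiv_apply_eq_sum {V : Type*} [NormedAddCommGroup V] [NormedSpace ℝ V]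
    (φ : Euc n → V) (y w : Euc n) :
    fderiv ℝ φ y w = ∑ i, w i • partialDeriv i φ y := by
  conv_lhs => rw [← (EuclideanSpace.basisFun (Fin n) ℝ).sum_repr w]
  simp [partialDeriv]

/-- Free of indices, curvature consists of the terms that arise when `Γ` is differentiated along two
directions and antisymmetrized. In this form it is recognized inside the second variation by linear
algebra alone. -/
theorem curvatureOp_eq (G : Euc n → Matrix (Fin n) (Fin n) ℝ) (y : Euc n) (X Y Z : Fin n → ℝ) :
    curvatureOp G y X Y Z = christoffelDeriv G y X Y Z - christoffelDeriv G y Y X Z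
      + christoffelMap G y X (christoffelMap G y Y Z)
      - christoffelMap G y Y (christoffelMap G y X Z) := by
  have h3 : ∀ F : Fin n → Fin n → Fin n → ℝ, ∀ X Y Z : Fin n → ℝ,
      ∑ i, ∑ j, ∑ k, F i j k * X i * Y j * Z k = ∑ j, ∑ k, (∑ i, F i j k * X i) * Y j * Z k := by
    intro F X Y Z
    rw [Finset.sum_comm]
    refine Finset.sum_congr rfl fun j _ => ?_
    rw [Finset.sum_comm]
    simp only [Finset.sum_mul]
  have h4 : ∀ C C' : Fin n → Fin n → Fin n → ℝ, ∀ X Y Z : Fin n → ℝ, ∀ l : Fin n,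
      bilinMap C X (bilinMap C' Y Z) l
        = ∑ i, ∑ j, ∑ k, (∑ a, C l i a * C' a j k) * X i * Y j * Z k := by
    intro C C' X Y Z l
    simp only [bilinMap_apply, Finset.mul_sum, Finset.sum_mul]
    refine Finset.sum_congr rfl fun i _ => ?_
    rw [Finset.sum_comm]
    refine Finset.sum_congr rfl fun j _ => ?_
    rw [Finset.sum_comm]
    refine Finset.sum_congr rfl fun k _ => Finset.sum_congr rfl fun a _ => ?_
    ring
  have h5 : ∀ F : Fin n → Fin n → Fin n → ℝ, ∀ X Y Z : Fin n → ℝ,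
      ∑ i, ∑ j, ∑ k, F j i k * X i * Y j * Z k = ∑ i, ∑ j, ∑ k, F i j k * Y i * X j * Z k := by
    intro F X Y Z
    rw [Finset.sum_comm]
    refine Finset.sum_congr rfl fun i _ => Finset.sum_congr rfl fun j _ =>
      Finset.sum_congr rfl fun k _ => by ring
  ext l
  let f : Fin n → Fin n → Fin n → ℝ := fun i j k => partialDeriv i (christoffel G l j k) y
  let f' : Fin n → Fin n → Fin n → ℝ := fun i j k =>
    ∑ a, christoffel G l i a y * christoffel G a j k y
  have h6 : curvatureOp G y X Y Z l
      = ∑ i, ∑ j, ∑ k, f i j k * X i * Y j * Z k - ∑ i, ∑ j, ∑ k, f j i k * X i * Y j * Z k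
        + ∑ i, ∑ j, ∑ k, f' i j k * X i * Y j * Z k
        - ∑ i, ∑ j, ∑ k, f' j i k * X i * Y j * Z k := by
    simp only [← Finset.sum_add_distrib, ← Finset.sum_sub_distrib, curvatureOp]
    refine Finset.sum_congr rfl fun i _ => Finset.sum_congr rfl fun j _ =>
      Finset.sum_congr rfl fun k _ => ?_
    simp only [riemannTensor, f, f', Finset.sum_sub_distrib]
    ring
  rw [h6, h5 f, h5 f', h3 f, h3 f]
  simp only [Pi.add_apply, Pi.sub_apply, h4]
  rfl

end Forms

/-! ### Covariant differentiation along maps -/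

section Calculus

variable {n : ℕ} {E : Type*} [NormedAddCommGroup E] [NormedSpace ℝ E]

theorem contDiffOn_det {k : WithTop ℕ∞} {s : Set E} {A : E → Matrix (Fin n) (Fin n) ℝ}
    (hA : ∀ i j, ContDiffOn ℝ k (fun y => A y i j) s) :
    ContDiffOn ℝ k (fun y => (A y).det) s := by
  simp only [Matrix.det_apply']
  exact ContDiffOn.sum fun σ _ => contDiffOn_const.mul (contDiffOn_prod fun i _ => hA _ _)

theorem contDiffOn_inv {k : WithTop ℕ∞} {s : Set E} {A : E → Matrix (Fin n) (Fin n) ℝ}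
    (hA : ∀ i j, ContDiffOn ℝ k (fun y => A y i j) s) (hdet : ∀ y ∈ s, (A y).det ≠ 0)
    (i j : Fin n) : ContDiffOn ℝ k (fun y => (A y)⁻¹ i j) s := by
  -- Cramer's rule: each entry of the inverse is a quotient of determinants, hence as smooth as the
  -- matrix.
  simp only [Matrix.inv_def, Ring.inverse_eq_inv', Matrix.smul_apply, smul_eq_mul,
    Matrix.adjugate_apply]
  refine ((contDiffOn_det hA).inv hdet).mul (contDiffOn_det fun a b => ?_)
  by_cases h : a = j
  · subst h
    simpa using contDiffOn_const
  · simpa [Matrix.updateRow_ne h] using hA a b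

theorem contDiffOn_metricForm {k : WithTop ℕ∞} {s : Set E} {A : E → Matrix (Fin n) (Fin n) ℝ}
    {X Y : E → Fin n → ℝ} (hA : ∀ i j, ContDiffOn ℝ k (fun y => A y i j) s)
    (hX : ContDiffOn ℝ k X s) (hY : ContDiffOn ℝ k Y s) :
    ContDiffOn ℝ k (fun y => metricForm (A y) (X y) (Y y)) s := by
  simp only [metricForm_eq_sum]
  rw [contDiffOn_pi] at hX hY
  exact ContDiffOn.sum fun i _ => ContDiffOn.sum fun j _ => ((hA i j).mul (hX i)).mul (hY j)

theorem contDiffOn_bilinMap {k : WithTop ℕ∞} {s : Set E} {C : E → Fin n → Fin n → Fin n → ℝ}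
    {X Y : E → Fin n → ℝ} (hC : ∀ a b c, ContDiffOn ℝ k (fun y => C y a b c) s)
    (hX : ContDiffOn ℝ k X s) (hY : ContDiffOn ℝ k Y s) :
    ContDiffOn ℝ k (fun y => bilinMap (C y) (X y) (Y y)) s := by
  rw [contDiffOn_pi] at hX hY ⊢
  intro a
  simp only [bilinMap_apply]
  exact ContDiffOn.sum fun i _ => ContDiffOn.sum fun j _ => ((hC a i j).mul (hX i)).mul (hY j)

theorem contDiffOn_partialDeriv {Ω : Set (Euc n)} (hΩ : IsOpen Ω) {φ : Euc n → ℝ}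
    (hφ : ContDiffOn ℝ ∞ φ Ω) (i : Fin n) : ContDiffOn ℝ ∞ (partialDeriv i φ) Ω :=
  (hφ.fderiv_of_isOpen hΩ (by simp)).clm_apply contDiffOn_const

theorem contDiffOn_christoffel {Ω : Set (Euc n)} (hΩ : IsOpen Ω)
    {G : Euc n → Matrix (Fin n) (Fin n) ℝ} (hG : ∀ i j, ContDiffOn ℝ ∞ (fun y => G y i j) Ω)
    (hdet : ∀ y ∈ Ω, (G y).det ≠ 0) (k i j : Fin n) :
    ContDiffOn ℝ ∞ (christoffel G k i j) Ω :=
  contDiffOn_const.mul (ContDiffOn.sum fun l _ => (contDiffOn_inv hG hdet k l).mul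
    (((contDiffOn_partialDeriv hΩ (hG j l) i).add (contDiffOn_partialDeriv hΩ (hG i l) j)).sub
      (contDiffOn_partialDeriv hΩ (hG i j) l)))

theorem fderiv_pi_apply {X : E → Fin n → ℝ} {z : E} (hX : DifferentiableAt ℝ X z) (w : E)
    (i : Fin n) : fderiv ℝ (fun z => X z i) z w = fderiv ℝ X z w i := by
  have h := (hasFDerivAt_pi'.mp hX.hasFDerivAt i).fderiv
  rw [h]
  rfl

theorem fderiv_ofLp {φ : E → Euc n} {z : E} (hφ : DifferentiableAt ℝ φ z) (w : E) :
    fderiv ℝ (fun z => (φ z).ofLp) z w = (fderiv ℝ φ z w).ofLp := by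
  have h := ((PiLp.continuousLinearEquiv 2 ℝ
    (fun _ : Fin n => ℝ)).toContinuousLinearMap.hasFDerivAt.comp z hφ.hasFDerivAt).fderiv
  change fderiv ℝ (⇑(PiLp.continuousLinearEquiv 2 ℝ
    (fun _ : Fin n => ℝ)).toContinuousLinearMap ∘ φ) z w = _
  rw [h]
  rfl

theorem contDiffOn_ofLp {k : WithTop ℕ∞} {s : Set E} {φ : E → Euc n} (hφ : ContDiffOn ℝ k φ s) :
    ContDiffOn ℝ k (fun z => (φ z).ofLp) s :=
  (PiLp.continuousLinearEquiv 2 ℝ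
    (fun _ : Fin n => ℝ)).toContinuousLinearMap.contDiff.comp_contDiffOn hφ

theorem hasFDerivAt_apply_pi {X : E → Fin n → ℝ} {z : E} (hX : DifferentiableAt ℝ X z)
    (i : Fin n) : HasFDerivAt (fun z => X z i) (fderiv ℝ (fun z => X z i) z) z :=
  (differentiableAt_pi.mp hX i).hasFDerivAt

theorem fderiv_metricForm {A : E → Matrix (Fin n) (Fin n) ℝ} {X Y : E → Fin n → ℝ} {z : E}
    (hA : ∀ i j, DifferentiableAt ℝ (fun z => A z i j) z) (hX : DifferentiableAt ℝ X z)
    (hY : DifferentiableAt ℝ Y z) (w : E) :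
    fderiv ℝ (fun z => metricForm (A z) (X z) (Y z)) z w
      = metricForm (Matrix.of fun i j => fderiv ℝ (fun z => A z i j) z w) (X z) (Y z)
        + metricForm (A z) (fderiv ℝ X z w) (Y z)
        + metricForm (A z) (X z) (fderiv ℝ Y z w) := by
  simp only [metricForm_eq_sum]
  rw [(HasFDerivAt.fun_sum (u := Finset.univ) fun i _ =>
    HasFDerivAt.fun_sum (u := Finset.univ) fun j _ =>
    (((hA i j).hasFDerivAt.fun_mul (hasFDerivAt_apply_pi hX i)).fun_mul
      (hasFDerivAt_apply_pi hY j))).fderiv]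
  simp only [sum_apply, add_apply, smul_apply, smul_eq_mul,
    fderiv_pi_apply hX, fderiv_pi_apply hY, Matrix.of_apply, ← Finset.sum_add_distrib]
  refine Finset.sum_congr rfl fun i _ => Finset.sum_congr rfl fun j _ => ?_
  ring

theorem fderiv_bilinMap {C : E → Fin n → Fin n → Fin n → ℝ} {X Y : E → Fin n → ℝ} {z : E}
    (hC : ∀ a b c, DifferentiableAt ℝ (fun z => C z a b c) z) (hX : DifferentiableAt ℝ X z)
    (hY : DifferentiableAt ℝ Y z) (w : E) :
    fderiv ℝ (fun z => bilinMap (C z) (X z) (Y z)) z w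
      = bilinMap (fun a b c => fderiv ℝ (fun z => C z a b c) z w) (X z) (Y z)
        + bilinMap (C z) (fderiv ℝ X z w) (Y z)
        + bilinMap (C z) (X z) (fderiv ℝ Y z w) := by
  ext a
  have hd : ∀ a, HasFDerivAt (fun z => bilinMap (C z) (X z) (Y z) a) _ z := fun a =>
    HasFDerivAt.fun_sum (u := Finset.univ) fun i _ =>
    HasFDerivAt.fun_sum (u := Finset.univ) fun j _ =>
    (((hC a i j).hasFDerivAt.fun_mul (hasFDerivAt_apply_pi hX i)).fun_mul
      (hasFDerivAt_apply_pi hY j))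
  rw [← fderiv_pi_apply (differentiableAt_pi.mpr fun a => (hd a).differentiableAt), (hd a).fderiv]
  simp only [sum_apply, add_apply, smul_apply, smul_eq_mul, Pi.add_apply, bilinMap_apply,
    fderiv_pi_apply hX, fderiv_pi_apply hY, ← Finset.sum_add_distrib]
  refine Finset.sum_congr rfl fun i _ => Finset.sum_congr rfl fun j _ => ?_
  ring

theorem fderiv_comp_eq_sum {φ : Euc n → ℝ} {u : E → Euc n} {z : E}
    (hφ : DifferentiableAt ℝ φ (u z)) (hu : DifferentiableAt ℝ u z) (w : E) :
    fderiv ℝ (fun z => φ (u z)) z w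
      = ∑ i, partialDeriv i φ (u z) * (fderiv ℝ u z w).ofLp i := by
  have h := (hφ.hasFDerivAt.comp z hu.hasFDerivAt).fderiv
  change fderiv ℝ (φ ∘ u) z w = _
  rw [h, ContinuousLinearMap.comp_apply, fderiv_apply_eq_sum]
  exact Finset.sum_congr rfl fun i _ => mul_comm _ _

/-- The covariant derivative in the direction `w` of a vector field `X` along `u`. -/
def covDeriv (G : Euc n → Matrix (Fin n) (Fin n) ℝ) (u : E → Euc n) (X : E → Fin n → ℝ)
    (z w : E) : Fin n → ℝ :=
  fderiv ℝ X z w + christoffelMap G (u z) (fderiv ℝ u z w).ofLp (X z)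

/-- Chain rule applied to `partialDeriv_metric`. It supplies the Christoffel terms that turn the
product rule for `⟨X, Y⟩` into a product rule for covariant derivatives. -/
theorem fderiv_metric_comp {G : Euc n → Matrix (Fin n) (Fin n) ℝ} {u : E → Euc n} {z : E}
    (hsymm : ∀ᶠ y in 𝓝 (u z), (G y).IsSymm) (hdet : IsUnit (G (u z)).det)
    (hG : ∀ i j, DifferentiableAt ℝ (fun y => G y i j) (u z)) (hu : DifferentiableAt ℝ u z)
    (w : E) (X Y : Fin n → ℝ) :
    metricForm (Matrix.of fun i j => fderiv ℝ (fun z => G (u z) i j) z w) X Y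
      = metricForm (G (u z)) (christoffelMap G (u z) (fderiv ℝ u z w).ofLp X) Y
        + metricForm (G (u z)) X (christoffelMap G (u z) (fderiv ℝ u z w).ofLp Y) := by
  have hsy : (G (u z)).IsSymm := hsymm.self_of_nhds
  set W := (fderiv ℝ u z w).ofLp with hW
  have h1 : ∀ i j, fderiv ℝ (fun z => G (u z) i j) z w
      = ∑ a, ((∑ k, christoffel G a k i (u z) * W k) * G (u z) a j
          + (∑ k, christoffel G a k j (u z) * W k) * G (u z) a i) := by
    intro i j
    rw [fderiv_comp_eq_sum (hG i j) hu]
    simp only [partialDeriv_metric hsymm hdet, Finset.sum_mul, ← Finset.sum_add_distrib]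
    rw [Finset.sum_comm]
    exact Finset.sum_congr rfl fun a _ => Finset.sum_congr rfl fun k _ => by ring
  have h2 : ∀ X a, christoffelMap G (u z) W X a
      = ∑ i, (∑ k, christoffel G a k i (u z) * W k) * X i := by
    intro X a
    rw [bilinMap_apply, Finset.sum_comm]
    simp only [Finset.sum_mul]
  rw [metricForm_comm hsy X]
  simp only [metricForm_eq_sum, Matrix.of_apply, h1, h2]
  have h3 : ∀ (B : Fin n → Fin n → ℝ) (X Y : Fin n → ℝ),
      ∑ a, ∑ j, G (u z) a j * (∑ i, B a i * X i) * Y j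
        = ∑ i, ∑ j, (∑ a, B a i * G (u z) a j) * X i * Y j := by
    intro B X Y
    simp only [Finset.mul_sum, Finset.sum_mul]
    have e1 : ∀ a, ∑ j, ∑ i, G (u z) a j * (B a i * X i) * Y j
        = ∑ i, ∑ j, G (u z) a j * (B a i * X i) * Y j := fun a => Finset.sum_comm
    simp only [e1]
    rw [Finset.sum_comm]
    refine Finset.sum_congr rfl fun i _ => ?_
    rw [Finset.sum_comm]
    exact Finset.sum_congr rfl fun j _ => Finset.sum_congr rfl fun a _ => by ring
  rw [h3, h3, Finset.sum_comm (s := Finset.univ) (t := Finset.univ)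
    (f := fun i j => (∑ a, (∑ k, christoffel G a k i (u z) * W k) * G (u z) a j) * Y i * X j)]
  simp only [← Finset.sum_add_distrib]
  refine Finset.sum_congr rfl fun i _ => Finset.sum_congr rfl fun j _ => ?_
  rw [Finset.sum_add_distrib]
  ring

theorem fderiv_metricForm_comp {G : Euc n → Matrix (Fin n) (Fin n) ℝ} {u : E → Euc n} {z : E}
    (hsymm : ∀ᶠ y in 𝓝 (u z), (G y).IsSymm) (hdet : IsUnit (G (u z)).det)
    (hG : ∀ i j, DifferentiableAt ℝ (fun y => G y i j) (u z)) (hu : DifferentiableAt ℝ u z)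
    {X Y : E → Fin n → ℝ} (hX : DifferentiableAt ℝ X z) (hY : DifferentiableAt ℝ Y z) (w : E) :
    fderiv ℝ (fun z => metricForm (G (u z)) (X z) (Y z)) z w
      = metricForm (G (u z)) (covDeriv G u X z w) (Y z)
        + metricForm (G (u z)) (X z) (covDeriv G u Y z w) := by
  rw [fderiv_metricForm (A := fun z => G (u z)) (fun i j => (hG i j).comp z hu) hX hY,
    fderiv_metric_comp hsymm hdet hG hu]
  simp only [covDeriv, map_add, LinearMap.add_apply]
  ring

theorem fderiv_christoffelMap_comp {G : Euc n → Matrix (Fin n) (Fin n) ℝ} {u : E → Euc n} {z : E}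
    (hΓ : ∀ a b c, DifferentiableAt ℝ (christoffel G a b c) (u z)) (hu : DifferentiableAt ℝ u z)
    {X Y : E → Fin n → ℝ} (hX : DifferentiableAt ℝ X z) (hY : DifferentiableAt ℝ Y z) (w : E) :
    fderiv ℝ (fun z => christoffelMap G (u z) (X z) (Y z)) z w
      = christoffelDeriv G (u z) (fderiv ℝ u z w).ofLp (X z) (Y z)
        + christoffelMap G (u z) (fderiv ℝ X z w) (Y z)
        + christoffelMap G (u z) (X z) (fderiv ℝ Y z w) := by
  rw [fderiv_bilinMap (C := fun z a b c => christoffel G a b c (u z)) (fun a b c => (hΓ a b c).comp z hu) hX hY]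
  simp only [christoffelDeriv, fderiv_comp_eq_sum (hΓ _ _ _) hu]

end Calculus

/-! ### First fundamental form, area density and stress of a family of surfaces -/

section Family

/-- The `i`-th spatial direction in the parameter space of a family of surfaces. -/
def spaceDir (i : Fin 2) : ℝ × Euc 2 := (0, EuclideanSpace.single i 1)

/-- The tangent field `∂ᵢ u` to the leaves of the family `u`. -/
def leafField (u : ℝ × Euc 2 → Euc 3) (i : Fin 2) (z : ℝ × Euc 2) : Fin 3 → ℝ :=
  (fderiv ℝ u z (spaceDir i)).ofLp

/-- The first fundamental form of the leaves of the family `u`. -/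
def gram (G : Euc 3 → Matrix (Fin 3) (Fin 3) ℝ) (u : ℝ × Euc 2 → Euc 3) (i j : Fin 2)
    (z : ℝ × Euc 2) : ℝ :=
  metricForm (G (u z)) (leafField u i z) (leafField u j z)

/-- The area density of the leaves of the family `u`. -/
def areaDensity (G : Euc 3 → Matrix (Fin 3) (Fin 3) ℝ) (u : ℝ × Euc 2 → Euc 3)
    (z : ℝ × Euc 2) : ℝ :=
  √(gram G u 0 0 z * gram G u 1 1 z - gram G u 0 1 z ^ 2)

/-- The derivative `√(det γ) γⁱʲ ∂ⱼ u` of the area density with respect to `∂ᵢ u`. -/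
def stress (G : Euc 3 → Matrix (Fin 3) (Fin 3) ℝ) (u : ℝ × Euc 2 → Euc 3) :
    Fin 2 → ℝ × Euc 2 → Fin 3 → ℝ :=
  ![fun z => (areaDensity G u z)⁻¹ •
      (gram G u 1 1 z • leafField u 0 z - gram G u 0 1 z • leafField u 1 z),
    fun z => (areaDensity G u z)⁻¹ •
      (gram G u 0 0 z • leafField u 1 z - gram G u 0 1 z • leafField u 0 z)]

/-- A smooth metric `G` on an open set `Ω`. -/
structure IsMetricOn (G : Euc 3 → Matrix (Fin 3) (Fin 3) ℝ) (Ω : Set (Euc 3)) : Prop where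
  isOpen : IsOpen Ω
  contDiffOn : ∀ i j, ContDiffOn ℝ ∞ (fun y => G y i j) Ω
  isSymm : ∀ y ∈ Ω, (G y).IsSymm
  pos : ∀ y ∈ Ω, ∀ X : Fin 3 → ℝ, X ≠ 0 → 0 < metricForm (G y) X X

/-- A `C²` family of immersed surfaces, parametrized by an open set `D`. -/
structure IsImmersedFamily (G : Euc 3 → Matrix (Fin 3) (Fin 3) ℝ) (Ω : Set (Euc 3))
    (u : ℝ × Euc 2 → Euc 3) (D : Set (ℝ × Euc 2)) : Prop extends IsMetricOn G Ω where
  isOpen_domain : IsOpen D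
  contDiffOn_map : ContDiffOn ℝ 2 u D
  mapsTo : MapsTo u D Ω
  immersed : ∀ z ∈ D, ∀ s t : ℝ, s • leafField u 0 z + t • leafField u 1 z = 0 → s = 0 ∧ t = 0

namespace IsMetricOn

variable {G : Euc 3 → Matrix (Fin 3) (Fin 3) ℝ} {Ω : Set (Euc 3)}

/-- A nonzero vector in the kernel of the matrix would have length zero. -/
theorem det_ne_zero (h : IsMetricOn G Ω) {y : Euc 3} (hy : y ∈ Ω) : (G y).det ≠ 0 := by
  intro h0
  obtain ⟨X, hX, hGX⟩ := Matrix.exists_mulVec_eq_zero_iff.mpr h0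
  refine (h.pos y hy X hX).ne' ?_
  rw [metricForm_eq_sum]
  refine Finset.sum_eq_zero fun i _ => ?_
  have := congrFun hGX i
  simp only [Matrix.mulVec, dotProduct, Pi.zero_apply] at this
  calc ∑ j, G y i j * X i * X j = X i * ∑ j, G y i j * X j := by
        rw [Finset.mul_sum]
        exact Finset.sum_congr rfl fun j _ => by ring
    _ = 0 := by rw [this, mul_zero]

theorem comm (h : IsMetricOn G Ω) {y : Euc 3} (hy : y ∈ Ω) (X Y : Fin 3 → ℝ) :
    metricForm (G y) X Y = metricForm (G y) Y X := metricForm_comm (h.isSymm y hy) X Y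

theorem eventually_isSymm (h : IsMetricOn G Ω) {y : Euc 3} (hy : y ∈ Ω) :
    ∀ᶠ z in 𝓝 y, (G z).IsSymm :=
  Filter.mem_of_superset (h.isOpen.mem_nhds hy) h.isSymm

theorem differentiableAt (h : IsMetricOn G Ω) {y : Euc 3} (hy : y ∈ Ω) (i j : Fin 3) :
    DifferentiableAt ℝ (fun y => G y i j) y :=
  ((h.contDiffOn i j).contDiffAt (h.isOpen.mem_nhds hy)).differentiableAt (by simp)

theorem contDiffOn_christoffel (h : IsMetricOn G Ω) (a b c : Fin 3) :
    ContDiffOn ℝ ∞ (christoffel G a b c) Ω :=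
  MinimalFamily.contDiffOn_christoffel h.isOpen h.contDiffOn (fun _ hy => h.det_ne_zero hy) a b c

theorem differentiableAt_christoffel (h : IsMetricOn G Ω) {y : Euc 3} (hy : y ∈ Ω)
    (a b c : Fin 3) : DifferentiableAt ℝ (christoffel G a b c) y :=
  ((h.contDiffOn_christoffel a b c).contDiffAt (h.isOpen.mem_nhds hy)).differentiableAt (by simp)

theorem fderiv_metricForm (h : IsMetricOn G Ω) {E : Type*} [NormedAddCommGroup E]
    [NormedSpace ℝ E] {u : E → Euc 3} {z : E} (hz : u z ∈ Ω) (hu : DifferentiableAt ℝ u z)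
    {X Y : E → Fin 3 → ℝ} (hX : DifferentiableAt ℝ X z) (hY : DifferentiableAt ℝ Y z) (w : E) :
    fderiv ℝ (fun z => metricForm (G (u z)) (X z) (Y z)) z w
      = metricForm (G (u z)) (covDeriv G u X z w) (Y z)
        + metricForm (G (u z)) (X z) (covDeriv G u Y z w) :=
  fderiv_metricForm_comp (h.eventually_isSymm hz) (h.det_ne_zero hz).isUnit
    (h.differentiableAt hz) hu hX hY w

end IsMetricOn

theorem covDeriv_smul {n : ℕ} {E : Type*} [NormedAddCommGroup E] [NormedSpace ℝ E]
    (G : Euc n → Matrix (Fin n) (Fin n) ℝ) (u : E → Euc n) {φ : E → ℝ} {X : E → Fin n → ℝ}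
    {z : E} (hφ : DifferentiableAt ℝ φ z) (hX : DifferentiableAt ℝ X z) (w : E) :
    covDeriv G u (fun z => φ z • X z) z w = fderiv ℝ φ z w • X z + φ z • covDeriv G u X z w := by
  simp only [covDeriv, fderiv_fun_smul hφ hX, add_apply, smul_apply,
    ContinuousLinearMap.smulRight_apply, map_smul, smul_add]
  abel

theorem covDeriv_sub {n : ℕ} {E : Type*} [NormedAddCommGroup E] [NormedSpace ℝ E]
    (G : Euc n → Matrix (Fin n) (Fin n) ℝ) (u : E → Euc n) {X Y : E → Fin n → ℝ}
    {z : E} (hX : DifferentiableAt ℝ X z) (hY : DifferentiableAt ℝ Y z) (w : E) :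
    covDeriv G u (fun z => X z - Y z) z w = covDeriv G u X z w - covDeriv G u Y z w := by
  simp only [covDeriv, fderiv_fun_sub hX hY, sub_apply, map_sub]
  abel

/-- Shaped after the two components of `stress`. The derivative of the factor `W⁻¹` is written as a
multiple of the field itself, so that the stress reappears on the right. -/
theorem covDeriv_inv_smul_sub {n : ℕ} {E : Type*} [NormedAddCommGroup E] [NormedSpace ℝ E]
    (G : Euc n → Matrix (Fin n) (Fin n) ℝ) (u : E → Euc n) {W φ ψ : E → ℝ} {X Y : E → Fin n → ℝ}
    {z : E} (hW : DifferentiableAt ℝ W z) (hW0 : W z ≠ 0) (hφ : DifferentiableAt ℝ φ z)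
    (hψ : DifferentiableAt ℝ ψ z) (hX : DifferentiableAt ℝ X z) (hY : DifferentiableAt ℝ Y z)
    (w : E) :
    covDeriv G u (fun z => (W z)⁻¹ • (φ z • X z - ψ z • Y z)) z w
      = (W z)⁻¹ • (fderiv ℝ φ z w • X z + φ z • covDeriv G u X z w
          - (fderiv ℝ ψ z w • Y z + ψ z • covDeriv G u Y z w))
        - (fderiv ℝ W z w / W z) • ((W z)⁻¹ • (φ z • X z - ψ z • Y z)) := by
  have hinv : fderiv ℝ (fun z => (W z)⁻¹) z w = -(W z ^ 2)⁻¹ * fderiv ℝ W z w := by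
    have h := ((hasDerivAt_inv hW0).comp_hasFDerivAt z hW.hasFDerivAt).fderiv
    change fderiv ℝ (Inv.inv ∘ W) z w = _
    rw [h]
    simp
  rw [covDeriv_smul G u (φ := fun z => (W z)⁻¹) (hW.fun_inv hW0)
    ((hφ.fun_smul hX).fun_sub (hψ.fun_smul hY)), covDeriv_sub G u
    (hφ.fun_smul hX) (hψ.fun_smul hY), covDeriv_smul G u hφ hX, covDeriv_smul G u hψ hY, hinv]
  ext c
  simp only [Pi.add_apply, Pi.sub_apply, Pi.smul_apply, smul_eq_mul]
  field_simp
  ring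

namespace IsImmersedFamily

variable {G : Euc 3 → Matrix (Fin 3) (Fin 3) ℝ} {Ω : Set (Euc 3)}
  {u : ℝ × Euc 2 → Euc 3} {D : Set (ℝ × Euc 2)} {z : ℝ × Euc 2}

theorem differentiableAt_map (h : IsImmersedFamily G Ω u D) (hz : z ∈ D) :
    DifferentiableAt ℝ u z :=
  (h.contDiffOn_map.contDiffAt (h.isOpen_domain.mem_nhds hz)).differentiableAt two_ne_zero

theorem contDiffOn_fderiv (h : IsImmersedFamily G Ω u D) (w : ℝ × Euc 2) :
    ContDiffOn ℝ 1 (fun z => fderiv ℝ u z w) D :=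
  (h.contDiffOn_map.fderiv_of_isOpen h.isOpen_domain (by norm_num)).clm_apply contDiffOn_const

theorem contDiffOn_leafField (h : IsImmersedFamily G Ω u D) (i : Fin 2) :
    ContDiffOn ℝ 1 (leafField u i) D :=
  contDiffOn_ofLp (h.contDiffOn_fderiv _)

theorem differentiableAt_of_contDiffOn (h : IsImmersedFamily G Ω u D) {V : Type*}
    [NormedAddCommGroup V] [NormedSpace ℝ V] {φ : ℝ × Euc 2 → V} (hφ : ContDiffOn ℝ 1 φ D)
    (hz : z ∈ D) : DifferentiableAt ℝ φ z :=
  (hφ.contDiffAt (h.isOpen_domain.mem_nhds hz)).differentiableAt one_ne_zero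

theorem contDiffOn_metric_comp (h : IsImmersedFamily G Ω u D) (i j : Fin 3) :
    ContDiffOn ℝ 1 (fun z => G (u z) i j) D :=
  ((h.contDiffOn i j).of_le (by exact_mod_cast le_top)).comp
    (h.contDiffOn_map.of_le (by norm_num)) h.mapsTo

theorem contDiffOn_christoffel_comp (h : IsImmersedFamily G Ω u D) (a b c : Fin 3) :
    ContDiffOn ℝ 1 (fun z => christoffel G a b c (u z)) D :=
  ((h.contDiffOn_christoffel a b c).of_le (by exact_mod_cast le_top)).comp
    (h.contDiffOn_map.of_le (by norm_num)) h.mapsTo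

theorem contDiffOn_gram (h : IsImmersedFamily G Ω u D) (i j : Fin 2) :
    ContDiffOn ℝ 1 (gram G u i j) D :=
  contDiffOn_metricForm h.contDiffOn_metric_comp (h.contDiffOn_leafField i)
    (h.contDiffOn_leafField j)

theorem gram_comm (h : IsImmersedFamily G Ω u D) (hz : z ∈ D) :
    gram G u 1 0 z = gram G u 0 1 z :=
  h.comm (h.mapsTo hz) _ _

theorem gram_pos (h : IsImmersedFamily G Ω u D) (hz : z ∈ D) :
    0 < gram G u 0 0 z ∧ 0 < gram G u 1 1 z := by
  refine ⟨h.pos _ (h.mapsTo hz) _ fun h0 => ?_, h.pos _ (h.mapsTo hz) _ fun h0 => ?_⟩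
  · simpa using h.immersed z hz 1 0 (by simp [h0])
  · simpa using h.immersed z hz 0 1 (by simp [h0])

theorem gram_det_pos (h : IsImmersedFamily G Ω u D) (hz : z ∈ D) :
    0 < gram G u 0 0 z * gram G u 1 1 z - gram G u 0 1 z ^ 2 := by
  have hK := (h.gram_pos hz).2
  -- With `E, F, K` the first fundamental form, `K ∂₀u - F ∂₁u` is orthogonal to `∂₁u` and has
  -- squared length `K (E K - F²)`.
  have hne : gram G u 1 1 z • leafField u 0 z + (-gram G u 0 1 z) • leafField u 1 z ≠ 0 :=
    fun h0 => hK.ne' (h.immersed z hz _ _ h0).1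
  have hp := h.pos _ (h.mapsTo hz) _ hne
  have hc := h.gram_comm hz
  have e : metricForm (G (u z))
      (gram G u 1 1 z • leafField u 0 z + (-gram G u 0 1 z) • leafField u 1 z)
      (gram G u 1 1 z • leafField u 0 z + (-gram G u 0 1 z) • leafField u 1 z)
      = gram G u 1 1 z * (gram G u 0 0 z * gram G u 1 1 z - gram G u 0 1 z ^ 2) := by
    simp only [map_add, map_smul, LinearMap.add_apply, LinearMap.smul_apply, smul_eq_mul]
    change _ * (_ * gram G u 0 0 z + _ * gram G u 1 0 z)
      + _ * (_ * gram G u 0 1 z + _ * gram G u 1 1 z) = _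
    rw [hc]
    ring
  rw [e] at hp
  exact pos_of_mul_pos_right hp hK.le

theorem areaDensity_pos (h : IsImmersedFamily G Ω u D) (hz : z ∈ D) : 0 < areaDensity G u z :=
  Real.sqrt_pos.mpr (h.gram_det_pos hz)

theorem areaDensity_sq (h : IsImmersedFamily G Ω u D) (hz : z ∈ D) :
    areaDensity G u z ^ 2 = gram G u 0 0 z * gram G u 1 1 z - gram G u 0 1 z ^ 2 :=
  Real.sq_sqrt (h.gram_det_pos hz).le

theorem contDiffOn_areaDensity (h : IsImmersedFamily G Ω u D) :
    ContDiffOn ℝ 1 (areaDensity G u) D :=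
  (((h.contDiffOn_gram 0 0).mul (h.contDiffOn_gram 1 1)).sub
    ((h.contDiffOn_gram 0 1).pow 2)).sqrt fun _ hz => (h.gram_det_pos hz).ne'

theorem contDiffOn_stress (h : IsImmersedFamily G Ω u D) (i : Fin 2) :
    ContDiffOn ℝ 1 (stress G u i) D := by
  have hW : ContDiffOn ℝ 1 (fun z => (areaDensity G u z)⁻¹) D :=
    h.contDiffOn_areaDensity.inv fun _ hz => (h.areaDensity_pos hz).ne'
  fin_cases i
  · exact hW.smul (((h.contDiffOn_gram 1 1).smul (h.contDiffOn_leafField 0)).sub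
      ((h.contDiffOn_gram 0 1).smul (h.contDiffOn_leafField 1)))
  · exact hW.smul (((h.contDiffOn_gram 0 0).smul (h.contDiffOn_leafField 1)).sub
      ((h.contDiffOn_gram 0 1).smul (h.contDiffOn_leafField 0)))

theorem fderiv_gram (h : IsImmersedFamily G Ω u D) (hz : z ∈ D) (i j : Fin 2) (w : ℝ × Euc 2) :
    fderiv ℝ (gram G u i j) z w
      = metricForm (G (u z)) (covDeriv G u (leafField u i) z w) (leafField u j z)
        + metricForm (G (u z)) (leafField u i z) (covDeriv G u (leafField u j) z w) :=
  h.fderiv_metricForm (h.mapsTo hz) (h.differentiableAt_map hz)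
    (h.differentiableAt_of_contDiffOn (h.contDiffOn_leafField i) hz)
    (h.differentiableAt_of_contDiffOn (h.contDiffOn_leafField j) hz) w

/-- Obtained from `W² = E K - F²`, so that no square root has to be differentiated. -/
theorem fderiv_areaDensity (h : IsImmersedFamily G Ω u D) (hz : z ∈ D) (w : ℝ × Euc 2) :
    2 * areaDensity G u z * fderiv ℝ (areaDensity G u) z w
      = fderiv ℝ (gram G u 0 0) z w * gram G u 1 1 z
        + gram G u 0 0 z * fderiv ℝ (gram G u 1 1) z w
        - 2 * gram G u 0 1 z * fderiv ℝ (gram G u 0 1) z w := by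
  have hd : ∀ i j, HasFDerivAt (gram G u i j) (fderiv ℝ (gram G u i j) z) z := fun i j =>
    (h.differentiableAt_of_contDiffOn (h.contDiffOn_gram i j) hz).hasFDerivAt
  have hW := (h.differentiableAt_of_contDiffOn h.contDiffOn_areaDensity hz).hasFDerivAt
  have h1 := (hW.fun_mul hW).fderiv
  have h2 := (((hd 0 0).fun_mul (hd 1 1)).fun_sub ((hd 0 1).fun_mul (hd 0 1))).fderiv
  have e : (fun z => areaDensity G u z * areaDensity G u z) =ᶠ[𝓝 z]
      fun z => gram G u 0 0 z * gram G u 1 1 z - gram G u 0 1 z * gram G u 0 1 z :=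
    Filter.mem_of_superset (h.isOpen_domain.mem_nhds hz) fun y hy => by
      have := h.areaDensity_sq hy
      simpa only [sq, mem_ofPred_eq] using this
  rw [e.fderiv_eq, h2] at h1
  have h3 := congrArg (fun L => L w) h1
  simp only [add_apply, sub_apply, smul_apply, smul_eq_mul] at h3
  linarith

theorem covDeriv_stress_zero (h : IsImmersedFamily G Ω u D) (hz : z ∈ D) (w : ℝ × Euc 2) :
    covDeriv G u (stress G u 0) z w
      = (areaDensity G u z)⁻¹ •
        (fderiv ℝ (gram G u 1 1) z w • leafField u 0 z
          + gram G u 1 1 z • covDeriv G u (leafField u 0) z w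
          - (fderiv ℝ (gram G u 0 1) z w • leafField u 1 z
          + gram G u 0 1 z • covDeriv G u (leafField u 1) z w))
        - (fderiv ℝ (areaDensity G u) z w / areaDensity G u z) • stress G u 0 z :=
  covDeriv_inv_smul_sub G u (h.differentiableAt_of_contDiffOn h.contDiffOn_areaDensity hz)
    (h.areaDensity_pos hz).ne' (h.differentiableAt_of_contDiffOn (h.contDiffOn_gram 1 1) hz)
    (h.differentiableAt_of_contDiffOn (h.contDiffOn_gram 0 1) hz)
    (h.differentiableAt_of_contDiffOn (h.contDiffOn_leafField 0) hz)
    (h.differentiableAt_of_contDiffOn (h.contDiffOn_leafField 1) hz) w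

theorem covDeriv_stress_one (h : IsImmersedFamily G Ω u D) (hz : z ∈ D) (w : ℝ × Euc 2) :
    covDeriv G u (stress G u 1) z w
      = (areaDensity G u z)⁻¹ •
        (fderiv ℝ (gram G u 0 0) z w • leafField u 1 z
          + gram G u 0 0 z • covDeriv G u (leafField u 1) z w
          - (fderiv ℝ (gram G u 0 1) z w • leafField u 0 z
          + gram G u 0 1 z • covDeriv G u (leafField u 0) z w))
        - (fderiv ℝ (areaDensity G u) z w / areaDensity G u z) • stress G u 1 z :=
  covDeriv_inv_smul_sub G u (h.differentiableAt_of_contDiffOn h.contDiffOn_areaDensity hz)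
    (h.areaDensity_pos hz).ne' (h.differentiableAt_of_contDiffOn (h.contDiffOn_gram 0 0) hz)
    (h.differentiableAt_of_contDiffOn (h.contDiffOn_gram 0 1) hz)
    (h.differentiableAt_of_contDiffOn (h.contDiffOn_leafField 1) hz)
    (h.differentiableAt_of_contDiffOn (h.contDiffOn_leafField 0) hz) w

end IsImmersedFamily

end Family

/-! ### The minimal surface equation in divergence form -/

section Family

theorem partialDeriv_slice {V : Type*} [NormedAddCommGroup V] [NormedSpace ℝ V]
    {φ : ℝ × Euc 2 → V} {t : ℝ} {x : Euc 2} (hφ : DifferentiableAt ℝ φ (t, x)) (i : Fin 2) :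
    partialDeriv i (fun x => φ (t, x)) x = fderiv ℝ φ (t, x) (spaceDir i) := by
  have h := (hφ.hasFDerivAt.comp x (hasFDerivAt_prodMk_right t x)).fderiv
  change fderiv ℝ (φ ∘ fun x => (t, x)) x _ = _
  rw [h]
  rfl

/-- The mean curvature vector as a divergence: `E, F, K` is the first fundamental form, `A, B, C`
are components of the second covariant derivatives and `Aa, …, Cb` their inner products with the
tangent vectors with components `a, b`. -/
theorem div_stress_algebra {E F K W a b A B C Aa Ab Ba Bb Ca Cb W₀ W₁ : ℝ} (hW : 0 < W)
    (hW2 : W ^ 2 = E * K - F ^ 2)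
    (h0 : 2 * W * W₀ = 2 * Aa * K + E * (2 * Bb) - 2 * F * (Ab + Ba))
    (h1 : 2 * W * W₁ = 2 * Ba * K + E * (2 * Cb) - 2 * F * (Bb + Ca))
    (hH : K / W ^ 2 * (A - (K / W ^ 2 * Aa * a + -F / W ^ 2 * Ab * a
          + (-F / W ^ 2 * Aa * b + E / W ^ 2 * Ab * b)))
        + -F / W ^ 2 * (B - (K / W ^ 2 * Ba * a + -F / W ^ 2 * Bb * a
          + (-F / W ^ 2 * Ba * b + E / W ^ 2 * Bb * b)))
        + (-F / W ^ 2 * (B - (K / W ^ 2 * Ba * a + -F / W ^ 2 * Bb * a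
          + (-F / W ^ 2 * Ba * b + E / W ^ 2 * Bb * b)))
        + E / W ^ 2 * (C - (K / W ^ 2 * Ca * a + -F / W ^ 2 * Cb * a
          + (-F / W ^ 2 * Ca * b + E / W ^ 2 * Cb * b)))) = 0) :
    W⁻¹ * (2 * Bb * a + K * A - ((Ab + Ba) * b + F * B)) - W₀ / W * (W⁻¹ * (K * a - F * b))
      + (W⁻¹ * (2 * Ba * b + E * C - ((Bb + Ca) * a + F * B))
        - W₁ / W * (W⁻¹ * (E * b - F * a))) = 0 := by
  -- `W₀` and `W₁` are the derivatives of the area density in the two coordinate directions,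
  -- determined by `h0` and `h1`.
  have e0 : W₀ = (Aa * K + E * Bb - F * (Ab + Ba)) / W := by
    field_simp
    linarith
  have e1 : W₁ = (Ba * K + E * Cb - F * (Bb + Ca)) / W := by
    field_simp
    linarith
  -- Next, the vanishing mean curvature is cleared of the denominators of the inverse first
  -- fundamental form. What is left differs from the goal by a multiple of `W² = E K - F²`.
  have hW0 := hW.ne'
  have hH' : W ^ 2 * (K * A - 2 * F * B + E * C)
      - (K * (K * Aa * a - F * Ab * a - F * Aa * b + E * Ab * b)
        - 2 * F * (K * Ba * a - F * Bb * a - F * Ba * b + E * Bb * b)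
        + E * (K * Ca * a - F * Cb * a - F * Ca * b + E * Cb * b)) = 0 := by
    have := congrArg (fun r => r * W ^ 4) hH
    simp only [zero_mul] at this
    rw [← this]
    field_simp
    ring
  rw [e0, e1]
  field_simp
  linear_combination hH' + (2 * Bb * a - (Ab + Ba) * b + 2 * Ba * b - (Bb + Ca) * a) * hW2

namespace IsImmersedFamily

variable {G : Euc 3 → Matrix (Fin 3) (Fin 3) ℝ} {Ω : Set (Euc 3)}
  {u : ℝ × Euc 2 → Euc 3} {D : Set (ℝ × Euc 2)} {t : ℝ} {x : Euc 2}

theorem partialDeriv_leaf (h : IsImmersedFamily G Ω u D) (hz : (t, x) ∈ D) (i : Fin 2) :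
    (partialDeriv i (fun x => u (t, x)) x).ofLp = leafField u i (t, x) := by
  rw [partialDeriv_slice (h.differentiableAt_map hz)]
  rfl

theorem inducedMatrix_leaf (h : IsImmersedFamily G Ω u D) (hz : (t, x) ∈ D) :
    inducedMatrix G (fun x => u (t, x)) x
      = !![gram G u 0 0 (t, x), gram G u 0 1 (t, x); gram G u 0 1 (t, x), gram G u 1 1 (t, x)] := by
  ext i j
  simp only [inducedMatrix, Matrix.of_apply, h.partialDeriv_leaf hz]
  fin_cases i <;> fin_cases j <;> try rfl
  exact h.gram_comm hz

theorem inv_inducedMatrix_leaf (h : IsImmersedFamily G Ω u D) (hz : (t, x) ∈ D) :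
    (inducedMatrix G (fun x => u (t, x)) x)⁻¹
      = !![gram G u 1 1 (t, x) / areaDensity G u (t, x) ^ 2,
          -gram G u 0 1 (t, x) / areaDensity G u (t, x) ^ 2;
          -gram G u 0 1 (t, x) / areaDensity G u (t, x) ^ 2,
          gram G u 0 0 (t, x) / areaDensity G u (t, x) ^ 2] := by
  have hd : gram G u 0 0 (t, x) * gram G u 1 1 (t, x) - gram G u 0 1 (t, x) * gram G u 0 1 (t, x)
      = areaDensity G u (t, x) ^ 2 := by
    rw [h.areaDensity_sq hz]
    ring
  rw [h.inducedMatrix_leaf hz, Matrix.inv_def, Matrix.adjugate_fin_two_of, Matrix.det_fin_two_of,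
    hd, Ring.inverse_eq_inv']
  ext i j
  fin_cases i <;> fin_cases j <;> simp [div_eq_inv_mul]

theorem ambientDeriv_leaf (h : IsImmersedFamily G Ω u D) (hz : (t, x) ∈ D) (i j : Fin 2) :
    ambientDeriv G (fun x => u (t, x)) i j x
      = covDeriv G u (leafField u j) (t, x) (spaceDir i) := by
  have hev : partialDeriv j (fun x => u (t, x)) =ᶠ[𝓝 x]
      fun x => fderiv ℝ u (t, x) (spaceDir j) := by
    have hn : (fun x => (t, x)) ⁻¹' D ∈ 𝓝 x :=
      (Continuous.prodMk_right t).continuousAt (h.isOpen_domain.mem_nhds hz)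
    filter_upwards [hn] with y hy using partialDeriv_slice (h.differentiableAt_map hy) j
  have hd : DifferentiableAt ℝ (fun z => fderiv ℝ u z (spaceDir j)) (t, x) :=
    h.differentiableAt_of_contDiffOn (h.contDiffOn_fderiv _) hz
  have h1 : (partialDeriv i (partialDeriv j (fun x => u (t, x))) x).ofLp
      = fderiv ℝ (leafField u j) (t, x) (spaceDir i) := by
    have e : partialDeriv i (partialDeriv j (fun x => u (t, x))) x
        = partialDeriv i (fun x => fderiv ℝ u (t, x) (spaceDir j)) x := by
      simp only [partialDeriv] at hev ⊢
      rw [hev.fderiv_eq]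
    rw [e, partialDeriv_slice (φ := fun z => fderiv ℝ u z (spaceDir j)) hd]
    exact (fderiv_ofLp hd _).symm
  ext a
  simp only [ambientDeriv, covDeriv, Pi.add_apply, bilinMap_apply]
  rw [h1, h.partialDeriv_leaf hz, h.partialDeriv_leaf hz]
  rfl

/-- Symmetry of the second derivative of the `C²` map `u`, for an arbitrary direction `w` of
parameter and space. -/
theorem fderiv_leafField_comm (h : IsImmersedFamily G Ω u D) (hz : (t, x) ∈ D)
    (i : Fin 2) (w : ℝ × Euc 2) :
    fderiv ℝ (leafField u i) (t, x) w
      = fderiv ℝ (fun z => (fderiv ℝ u z w).ofLp) (t, x) (spaceDir i) := by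
  have hd : ∀ w, DifferentiableAt ℝ (fun z => fderiv ℝ u z w) (t, x) := fun w =>
    h.differentiableAt_of_contDiffOn (h.contDiffOn_fderiv _) hz
  have hd' : DifferentiableAt ℝ (fderiv ℝ u) (t, x) :=
    h.differentiableAt_of_contDiffOn
      (h.contDiffOn_map.fderiv_of_isOpen h.isOpen_domain (by norm_num)) hz
  have hs : IsSymmSndFDerivAt ℝ u (t, x) :=
    (h.contDiffOn_map.contDiffAt (h.isOpen_domain.mem_nhds hz)).isSymmSndFDerivAt (by simp)
  have e : ∀ v w, fderiv ℝ (fun z => fderiv ℝ u z v) (t, x) w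
      = fderiv ℝ (fderiv ℝ u) (t, x) w v := fun v w => by
    rw [(hd'.hasFDerivAt.clm_apply (hasFDerivAt_const v (t, x))).fderiv]
    simp
  rw [fderiv_ofLp (hd w)]
  refine (fderiv_ofLp (hd (spaceDir i)) w).trans ?_
  rw [e, e, hs.eq]

theorem covDeriv_leafField_comm (h : IsImmersedFamily G Ω u D) (hz : (t, x) ∈ D) :
    covDeriv G u (leafField u 0) (t, x) (spaceDir 1)
      = covDeriv G u (leafField u 1) (t, x) (spaceDir 0) := by
  simp only [covDeriv]
  rw [h.fderiv_leafField_comm hz, christoffelMap_comm (h.eventually_isSymm (h.mapsTo hz))]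
  rfl

/-- The covariant divergence of `√(det γ) γⁱʲ ∂ⱼu` is `√(det γ)` times the mean curvature vector:
its tangential part cancels identically, and its normal part is the trace of the second fundamental
form. -/
theorem covDeriv_stress_sum (h : IsImmersedFamily G Ω u D) (hz : (t, x) ∈ D)
    (hH : meanCurvature G (fun x => u (t, x)) x = 0) :
    covDeriv G u (stress G u 0) (t, x) (spaceDir 0)
      + covDeriv G u (stress G u 1) (t, x) (spaceDir 1) = 0 := by
  have hcomm : ∀ i j w, metricForm (G (u (t, x))) (leafField u i (t, x))
      (covDeriv G u (leafField u j) (t, x) w) = metricForm (G (u (t, x)))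
        (covDeriv G u (leafField u j) (t, x) w) (leafField u i (t, x)) := fun i j w =>
    h.comm (h.mapsTo hz) _ _
  have hW0 := h.fderiv_areaDensity hz (spaceDir 0)
  have hW1 := h.fderiv_areaDensity hz (spaceDir 1)
  rw [h.covDeriv_stress_zero hz, h.covDeriv_stress_one hz]
  have hAB := h.covDeriv_leafField_comm hz
  simp only [h.fderiv_gram hz, hcomm] at hW0 hW1 ⊢
  rw [hAB] at hW1 ⊢
  ext c
  have hc := congrFun hH c
  simp only [meanCurvature, secondForm, Fin.sum_univ_two, h.ambientDeriv_leaf hz,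
    h.inv_inducedMatrix_leaf hz, h.partialDeriv_leaf hz, ← metricForm_apply] at hc
  simp only [Matrix.of_apply, Matrix.cons_val', Matrix.cons_val_zero, Matrix.cons_val_one,
    Matrix.cons_val_fin_one, Pi.zero_apply, hAB] at hc
  have key := div_stress_algebra (h.areaDensity_pos hz) (h.areaDensity_sq hz)
    (W₀ := fderiv ℝ (areaDensity G u) (t, x) (spaceDir 0))
    (W₁ := fderiv ℝ (areaDensity G u) (t, x) (spaceDir 1)) ?_ ?_ hc
  · simp only [Pi.add_apply, Pi.sub_apply, Pi.smul_apply, smul_eq_mul, Pi.zero_apply, stress,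
      Matrix.cons_val_zero, Matrix.cons_val_one]
    rw [← key]
    ring
  · rw [hW0]
    ring
  · rw [hW1]
    ring

/-- With the Christoffel terms on the right, this is an ordinary divergence identity for each
component, whose two sides involve only first derivatives of `u` under the divergence. That is the
form which can be differentiated weakly. -/
theorem fderiv_stress_sum (h : IsImmersedFamily G Ω u D) (hz : (t, x) ∈ D)
    (hH : meanCurvature G (fun x => u (t, x)) x = 0) :
    fderiv ℝ (stress G u 0) (t, x) (spaceDir 0) + fderiv ℝ (stress G u 1) (t, x) (spaceDir 1)
      = -(christoffelMap G (u (t, x)) (leafField u 0 (t, x)) (stress G u 0 (t, x))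
        + christoffelMap G (u (t, x)) (leafField u 1 (t, x)) (stress G u 1 (t, x))) := by
  have h1 := h.covDeriv_stress_sum hz hH
  simp only [covDeriv] at h1
  rw [eq_neg_iff_add_eq_zero, ← h1]
  simp only [leafField]
  abel

end IsImmersedFamily

end Family

/-! ### Pairing weak divergence identities with covector fields -/

section WeakDivergence

variable {m n : ℕ}

/-- `HasWeakDiv` for continuous fields. -/
structure HasContWeakDiv (U : Set (Euc m)) (Z : Fin m → Euc m → ℝ) (q : Euc m → ℝ) : Prop where
  continuousOn_field : ∀ i, ContinuousOn (Z i) U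
  continuousOn_div : ContinuousOn q U
  hasWeakDiv : HasWeakDiv U Z q

theorem HasContWeakDiv.add {U : Set (Euc m)} (hU : IsOpen U) {Z Z' : Fin m → Euc m → ℝ}
    {q q' : Euc m → ℝ} (h : HasContWeakDiv U Z q) (h' : HasContWeakDiv U Z' q') :
    HasContWeakDiv U (fun i x => Z i x + Z' i x) (fun x => q x + q' x) :=
  ⟨fun i => (h.1 i).add (h'.1 i), h.2.add h'.2, h.3.add hU h'.3 h.1 h.2 h'.1 h'.2⟩

theorem HasContWeakDiv.congr {U : Set (Euc m)} {Z Z' : Fin m → Euc m → ℝ} {q q' : Euc m → ℝ}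
    (h : HasContWeakDiv U Z q) (hZ : ∀ x ∈ U, ∀ i, Z' i x = Z i x)
    (hq : ∀ x ∈ U, q' x = q x) : HasContWeakDiv U Z' q' :=
  ⟨fun i => (h.1 i).congr fun x hx => hZ x hx i, h.2.congr hq, h.3.congr hZ hq⟩

theorem linearMap_apply_eq_sum (θ : (Fin n → ℝ) →ₗ[ℝ] ℝ) (w : Fin n → ℝ) :
    θ w = ∑ c, θ (Pi.single c 1) * w c := by
  conv_lhs => rw [LinearMap.pi_apply_eq_sum_univ θ w]
  refine Finset.sum_congr rfl fun c _ => ?_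
  rw [smul_eq_mul, mul_comm]
  congr 2
  ext j
  simp [Pi.single_apply, eq_comm]

/-- The pairing of a vector-valued divergence identity with a `C¹` covector field. -/
theorem HasContWeakDiv.pair {U : Set (Euc m)} (hU : IsOpen U) {Z : Fin m → Euc m → Fin n → ℝ}
    {q : Euc m → Fin n → ℝ}
    (h : ∀ c, HasContWeakDiv U (fun i x => Z i x c) (fun x => q x c))
    {θ : Euc m → (Fin n → ℝ) →ₗ[ℝ] ℝ} (hθ : ∀ w, ContDiffOn ℝ 1 (fun x => θ x w) U) :
    HasContWeakDiv U (fun i x => θ x (Z i x))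
      (fun x => θ x (q x) + ∑ i, partialDeriv i (fun y => θ y (Z i x)) x) := by
  have e1 : ∀ x, θ x (q x) = ∑ c, θ x (Pi.single c 1) * q x c := fun x =>
    linearMap_apply_eq_sum _ _
  have e2 : ∀ i x, θ x (Z i x) = ∑ c, θ x (Pi.single c 1) * Z i x c := fun i x =>
    linearMap_apply_eq_sum _ _
  -- The vector `Z i x` is frozen at `x`: only the covector field is differentiated, since `Z` is
  -- merely continuous.
  have e3 : ∀ x ∈ U, ∀ i, partialDeriv i (fun y => θ y (Z i x)) x
      = ∑ c, partialDeriv i (fun y => θ y (Pi.single c 1)) x * Z i x c := by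
    intro x hx i
    have hd : ∀ c, DifferentiableAt ℝ (fun y => θ y (Pi.single c 1)) x := fun c =>
      ((hθ _).contDiffAt (hU.mem_nhds hx)).differentiableAt one_ne_zero
    have : (fun y => θ y (Z i x)) = fun y => ∑ c, θ y (Pi.single c 1) * Z i x c :=
      funext fun y => linearMap_apply_eq_sum _ _
    rw [this]
    simp only [partialDeriv]
    rw [(HasFDerivAt.fun_sum fun c _ => (hd c).hasFDerivAt.mul_const (Z i x c)).fderiv]
    simp [sum_apply, mul_comm]
  have hw : ∀ c, HasWeakDiv U (fun i x => θ x (Pi.single c 1) * Z i x c)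
      (fun x => θ x (Pi.single c 1) * q x c
        + ∑ i, partialDeriv i (fun y => θ y (Pi.single c 1)) x * Z i x c) := fun c =>
    (h c).hasWeakDiv.mul hU (hθ (Pi.single c 1))
  have hcZ : ∀ c i, ContinuousOn (fun x => θ x (Pi.single c 1) * Z i x c) U := fun c i =>
    (hθ _).continuousOn.mul ((h c).1 i)
  have hcq : ∀ c, ContinuousOn (fun x => θ x (Pi.single c 1) * q x c
        + ∑ i, partialDeriv i (fun y => θ y (Pi.single c 1)) x * Z i x c) U := fun c =>
    ((hθ _).continuousOn.mul (h c).2).add (continuousOn_finsetSum _ fun i _ =>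
      (continuousOn_partialDeriv hU (hθ _) i).mul ((h c).1 i))
  have e4 : ∀ x ∈ U, θ x (q x) + ∑ i, partialDeriv i (fun y => θ y (Z i x)) x
      = ∑ c, (θ x (Pi.single c 1) * q x c
        + ∑ i, partialDeriv i (fun y => θ y (Pi.single c 1)) x * Z i x c) := by
    intro x hx
    rw [e1, Finset.sum_add_distrib, Finset.sum_comm]
    simp only [e3 x hx]
  refine ⟨fun i => ?_, ?_, ?_⟩
  · simp only [e2]
    exact continuousOn_finsetSum _ fun c _ => hcZ c i
  · exact (continuousOn_finsetSum _ fun c _ => hcq c).congr e4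
  · exact (HasWeakDiv.sum hU Finset.univ hw hcZ hcq).congr (fun x _ i => e2 i x) e4

end WeakDivergence

/-! ### Normal variations of a minimal leaf -/

section Family

/-- The direction of the parameter of a family of surfaces. -/
def timeDir : ℝ × Euc 2 := (1, 0)

/-- The decomposition of a vector into its normal and tangential parts. -/
theorem IsMetricOn.eq_normal_add_tangential {G : Euc 3 → Matrix (Fin 3) (Fin 3) ℝ}
    {Ω : Set (Euc 3)} (h : IsMetricOn G Ω) {y : Euc 3} (hy : y ∈ Ω) {a b ν : Fin 3 → ℝ}
    (hν : metricForm (G y) ν ν = 1) (hνa : metricForm (G y) ν a = 0)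
    (hνb : metricForm (G y) ν b = 0) {Δ : ℝ} (hΔ : Δ ≠ 0)
    (hΔ' : Δ = metricForm (G y) a a * metricForm (G y) b b - metricForm (G y) a b ^ 2)
    (hab : ∀ s t : ℝ, s • a + t • b = 0 → s = 0 ∧ t = 0) (X : Fin 3 → ℝ) :
    X = metricForm (G y) X ν • ν
      + ((metricForm (G y) b b * metricForm (G y) X a
          - metricForm (G y) a b * metricForm (G y) X b) / Δ) • a
      + ((metricForm (G y) a a * metricForm (G y) X b
          - metricForm (G y) a b * metricForm (G y) X a) / Δ) • b := by
  have hcomm := h.comm hy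
  have hli : LinearIndependent ℝ ![a, b, ν] := by
    rw [Fintype.linearIndependent_iff]
    intro c hc
    simp only [Fin.sum_univ_three, Matrix.cons_val_zero, Matrix.cons_val_one,
      Matrix.cons_val] at hc
    have h2 : c 2 = 0 := by
      have := congrArg (metricForm (G y) ν) hc
      simpa [hν, hνa, hνb] using this
    rw [h2, zero_smul, add_zero] at hc
    obtain ⟨h0, h1⟩ := hab _ _ hc
    intro i
    fin_cases i <;> assumption
  have hspan := hli.span_eq_top_of_card_eq_finrank (by simp)
  -- The vectors `a, b, ν` form a basis, so a vector orthogonal to all three is orthogonal to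
  -- itself. The decomposition is then checked by pairing with each of them.
  have key : ∀ Z : Fin 3 → ℝ, metricForm (G y) Z ν = 0 → metricForm (G y) Z a = 0 →
      metricForm (G y) Z b = 0 → Z = 0 := by
    intro Z h1 h2 h3
    by_contra hZ
    refine (h.pos y hy Z hZ).ne' ?_
    have hle : Submodule.span ℝ (range ![a, b, ν]) ≤ LinearMap.ker (metricForm (G y) Z) := by
      rw [Submodule.span_le]
      rintro _ ⟨i, rfl⟩
      fin_cases i
      · exact h2
      · exact h3
      · exact h1
    rw [hspan] at hle
    exact hle (Submodule.mem_top (x := Z))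
  rw [← sub_eq_zero]
  have hba := hcomm b a
  refine key _ ?_ ?_ ?_
  · simp only [map_sub, map_add, map_smul, LinearMap.sub_apply, LinearMap.add_apply,
      LinearMap.smul_apply, smul_eq_mul, hν, hcomm a ν, hcomm b ν, hνa, hνb]
    ring
  · simp only [map_sub, map_add, map_smul, LinearMap.sub_apply, LinearMap.add_apply,
      LinearMap.smul_apply, smul_eq_mul, hνa, hba]
    field_simp
    rw [hΔ']
    ring
  · simp only [map_sub, map_add, map_smul, LinearMap.sub_apply, LinearMap.add_apply,
      LinearMap.smul_apply, smul_eq_mul, hνb]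
    field_simp
    rw [hΔ']
    ring

/-- A family of minimal surfaces with a `C¹` unit normal field `ν` of the leaf `t = 0`, such that
the normal component `f` of the variation field of that leaf is `C²`. -/
structure IsNormalVariation (G : Euc 3 → Matrix (Fin 3) (Fin 3) ℝ) (Ω : Set (Euc 3))
    (u : ℝ × Euc 2 → Euc 3) (D : Set (ℝ × Euc 2)) (U : Set (Euc 2)) (ν : Euc 2 → Fin 3 → ℝ)
    (f : Euc 2 → ℝ) : Prop extends IsImmersedFamily G Ω u D where
  minimal : ∀ t x, (t, x) ∈ D → meanCurvature G (fun x => u (t, x)) x = 0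
  isOpen_leaf : IsOpen U
  mem_domain : ∀ x ∈ U, ((0 : ℝ), x) ∈ D
  contDiffOn_normal : ContDiffOn ℝ 1 ν U
  unit : ∀ x ∈ U, metricForm (G (u (0, x))) (ν x) (ν x) = 1
  orthogonal : ∀ x ∈ U, ∀ i, metricForm (G (u (0, x))) (ν x) (leafField u i (0, x)) = 0
  contDiffOn_speed : ContDiffOn ℝ 2 f U
  speed_eq : ∀ x ∈ U, f x = metricForm (G (u (0, x))) (fderiv ℝ u (0, x) timeDir).ofLp (ν x)

/-- The tangential components of the variation field. -/
def tangential (G : Euc 3 → Matrix (Fin 3) (Fin 3) ℝ) (u : ℝ × Euc 2 → Euc 3) :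
    Fin 2 → Euc 2 → ℝ :=
  ![fun x => (gram G u 1 1 (0, x)
        * metricForm (G (u (0, x))) (fderiv ℝ u (0, x) timeDir).ofLp (leafField u 0 (0, x))
      - gram G u 0 1 (0, x)
        * metricForm (G (u (0, x))) (fderiv ℝ u (0, x) timeDir).ofLp (leafField u 1 (0, x)))
      / areaDensity G u (0, x) ^ 2,
    fun x => (gram G u 0 0 (0, x)
        * metricForm (G (u (0, x))) (fderiv ℝ u (0, x) timeDir).ofLp (leafField u 1 (0, x))
      - gram G u 0 1 (0, x)
        * metricForm (G (u (0, x))) (fderiv ℝ u (0, x) timeDir).ofLp (leafField u 0 (0, x)))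
      / areaDensity G u (0, x) ^ 2]

/-- The direction in the parameter space in which `u` moves with the normal part of the variation
field. -/
def normalDir (G : Euc 3 → Matrix (Fin 3) (Fin 3) ℝ) (u : ℝ × Euc 2 → Euc 3) (x : Euc 2) :
    ℝ × Euc 2 :=
  timeDir - tangential G u 0 x • spaceDir 0 - tangential G u 1 x • spaceDir 1

namespace IsNormalVariation

variable {G : Euc 3 → Matrix (Fin 3) (Fin 3) ℝ} {Ω : Set (Euc 3)}
  {u : ℝ × Euc 2 → Euc 3} {D : Set (ℝ × Euc 2)} {U : Set (Euc 2)} {ν : Euc 2 → Fin 3 → ℝ}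
  {f : Euc 2 → ℝ} {x : Euc 2}

theorem contDiffOn_comp_leaf (h : IsNormalVariation G Ω u D U ν f) {V : Type*}
    [NormedAddCommGroup V] [NormedSpace ℝ V] {k : WithTop ℕ∞} {φ : ℝ × Euc 2 → V}
    (hφ : ContDiffOn ℝ k φ D) : ContDiffOn ℝ k (fun x => φ (0, x)) U :=
  hφ.comp (by fun_prop : ContDiff ℝ k fun x : Euc 2 => ((0 : ℝ), x)).contDiffOn h.mem_domain

theorem differentiableAt_leaf (h : IsNormalVariation G Ω u D U ν f) {V : Type*}
    [NormedAddCommGroup V] [NormedSpace ℝ V] {φ : Euc 2 → V}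
    (hφ : ContDiffOn ℝ 1 φ U) (hx : x ∈ U) : DifferentiableAt ℝ φ x :=
  (hφ.contDiffAt (h.isOpen_leaf.mem_nhds hx)).differentiableAt one_ne_zero

theorem contDiffOn_tangential (h : IsNormalVariation G Ω u D U ν f) (k : Fin 2) :
    ContDiffOn ℝ 1 (tangential G u k) U := by
  have h1 : ∀ i j, ContDiffOn ℝ 1 (fun x => gram G u i j (0, x)) U := fun i j =>
    h.contDiffOn_comp_leaf (h.contDiffOn_gram i j)
  have h2 : ∀ i, ContDiffOn ℝ 1 (fun x => metricForm (G (u (0, x)))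
      (fderiv ℝ u (0, x) timeDir).ofLp (leafField u i (0, x))) U := fun i =>
    h.contDiffOn_comp_leaf (contDiffOn_metricForm h.contDiffOn_metric_comp
      (contDiffOn_ofLp (h.contDiffOn_fderiv timeDir)) (h.contDiffOn_leafField i))
  have h3 : ContDiffOn ℝ 1 (fun x => areaDensity G u (0, x) ^ 2) U :=
    (h.contDiffOn_comp_leaf h.contDiffOn_areaDensity).pow 2
  have h4 : ∀ x ∈ U, areaDensity G u (0, x) ^ 2 ≠ 0 := fun x hx =>
    (pow_pos (h.areaDensity_pos (h.mem_domain x hx)) 2).ne'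
  fin_cases k
  · exact (((h1 1 1).mul (h2 0)).sub ((h1 0 1).mul (h2 1))).div h3 h4
  · exact (((h1 0 0).mul (h2 1)).sub ((h1 0 1).mul (h2 0))).div h3 h4

theorem decomposition (h : IsNormalVariation G Ω u D U ν f) (hx : x ∈ U) (X : Fin 3 → ℝ) :
    X = metricForm (G (u (0, x))) X (ν x) • ν x
      + ((gram G u 1 1 (0, x) * metricForm (G (u (0, x))) X (leafField u 0 (0, x))
          - gram G u 0 1 (0, x) * metricForm (G (u (0, x))) X (leafField u 1 (0, x)))
          / areaDensity G u (0, x) ^ 2) • leafField u 0 (0, x)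
      + ((gram G u 0 0 (0, x) * metricForm (G (u (0, x))) X (leafField u 1 (0, x))
          - gram G u 0 1 (0, x) * metricForm (G (u (0, x))) X (leafField u 0 (0, x)))
          / areaDensity G u (0, x) ^ 2) • leafField u 1 (0, x) :=
  h.eq_normal_add_tangential (h.mapsTo (h.mem_domain x hx)) (h.unit x hx) (h.orthogonal x hx 0)
    (h.orthogonal x hx 1) (pow_pos (h.areaDensity_pos (h.mem_domain x hx)) 2).ne'
    (h.areaDensity_sq (h.mem_domain x hx)) (h.immersed _ (h.mem_domain x hx)) X

theorem fderiv_normalDir (h : IsNormalVariation G Ω u D U ν f) (hx : x ∈ U) :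
    (fderiv ℝ u (0, x) (normalDir G u x)).ofLp = f x • ν x := by
  have h1 := h.decomposition hx (fderiv ℝ u (0, x) timeDir).ofLp
  rw [← h.speed_eq x hx] at h1
  simp only [normalDir, map_sub, map_smul, WithLp.ofLp_sub, WithLp.ofLp_smul]
  rw [h1]
  change _ + tangential G u 0 x • leafField u 0 (0, x) + tangential G u 1 x • leafField u 1 (0, x)
    - tangential G u 0 x • leafField u 0 (0, x) - tangential G u 1 x • leafField u 1 (0, x) = _
  abel

end IsNormalVariation

end Family

/-! ### Derivatives of the stress identity -/

section Family

/-- The zeroth-order term in the divergence of the stress. -/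
def stressDiv (G : Euc 3 → Matrix (Fin 3) (Fin 3) ℝ) (u : ℝ × Euc 2 → Euc 3) (z : ℝ × Euc 2) :
    Fin 3 → ℝ :=
  -(christoffelMap G (u z) (leafField u 0 z) (stress G u 0 z)
    + christoffelMap G (u z) (leafField u 1 z) (stress G u 1 z))

namespace IsImmersedFamily

variable {G : Euc 3 → Matrix (Fin 3) (Fin 3) ℝ} {Ω : Set (Euc 3)}
  {u : ℝ × Euc 2 → Euc 3} {D : Set (ℝ × Euc 2)} {z : ℝ × Euc 2}

theorem contDiffOn_christoffelMap_leaf (h : IsImmersedFamily G Ω u D) (i : Fin 2) :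
    ContDiffOn ℝ 1 (fun z => christoffelMap G (u z) (leafField u i z) (stress G u i z)) D :=
  contDiffOn_bilinMap h.contDiffOn_christoffel_comp (h.contDiffOn_leafField i)
    (h.contDiffOn_stress i)

theorem contDiffOn_stressDiv (h : IsImmersedFamily G Ω u D) :
    ContDiffOn ℝ 1 (stressDiv G u) D :=
  ((h.contDiffOn_christoffelMap_leaf 0).add (h.contDiffOn_christoffelMap_leaf 1)).neg

theorem fderiv_stressDiv (h : IsImmersedFamily G Ω u D) (hz : z ∈ D) (w : ℝ × Euc 2) :
    fderiv ℝ (stressDiv G u) z w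
      = -∑ i, (christoffelDeriv G (u z) (fderiv ℝ u z w).ofLp (leafField u i z) (stress G u i z)
        + christoffelMap G (u z) (fderiv ℝ (leafField u i) z w) (stress G u i z)
        + christoffelMap G (u z) (leafField u i z) (fderiv ℝ (stress G u i) z w)) := by
  have hd : ∀ i, HasFDerivAt
      (fun z => christoffelMap G (u z) (leafField u i z) (stress G u i z)) _ z := fun i =>
    (h.differentiableAt_of_contDiffOn (h.contDiffOn_christoffelMap_leaf i) hz).hasFDerivAt
  have e : fderiv ℝ (stressDiv G u) z = -(_ + _) := ((hd 0).fun_add (hd 1)).fun_neg.fderiv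
  rw [e, Fin.sum_univ_two]
  simp only [neg_apply, add_apply]
  rw [fderiv_christoffelMap_comp (h.differentiableAt_christoffel (h.mapsTo hz))
      (h.differentiableAt_map hz)
      (h.differentiableAt_of_contDiffOn (h.contDiffOn_leafField 0) hz)
      (h.differentiableAt_of_contDiffOn (h.contDiffOn_stress 0) hz),
    fderiv_christoffelMap_comp (h.differentiableAt_christoffel (h.mapsTo hz))
      (h.differentiableAt_map hz)
      (h.differentiableAt_of_contDiffOn (h.contDiffOn_leafField 1) hz)
      (h.differentiableAt_of_contDiffOn (h.contDiffOn_stress 1) hz)]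

end IsImmersedFamily

namespace IsNormalVariation

variable {G : Euc 3 → Matrix (Fin 3) (Fin 3) ℝ} {Ω : Set (Euc 3)}
  {u : ℝ × Euc 2 → Euc 3} {D : Set (ℝ × Euc 2)} {U : Set (Euc 2)} {ν : Euc 2 → Fin 3 → ℝ}
  {f : Euc 2 → ℝ} {x : Euc 2}

/-- The divergence identity `div P = Q` for the stress. -/
theorem sum_fderiv_stress_apply (h : IsNormalVariation G Ω u D U ν f) {z : ℝ × Euc 2} (hz : z ∈ D)
    (c : Fin 3) :
    ∑ i, fderiv ℝ (fun z => stress G u i z c) z (spaceDir i) = stressDiv G u z c := by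
  obtain ⟨t, x⟩ := z
  have hd : ∀ i, DifferentiableAt ℝ (stress G u i) (t, x) := fun i =>
    h.differentiableAt_of_contDiffOn (h.contDiffOn_stress i) hz
  rw [Fin.sum_univ_two, fderiv_pi_apply (hd 0), fderiv_pi_apply (hd 1), ← Pi.add_apply,
    h.fderiv_stress_sum hz (h.minimal t x hz)]
  rfl

theorem hasContWeakDiv_stress (h : IsNormalVariation G Ω u D U ν f) (c : Fin 3) :
    HasContWeakDiv U (fun i x => stress G u i (0, x) c) (fun x => stressDiv G u (0, x) c) := by
  have hs : ∀ i, ContDiffOn ℝ 1 (fun z => stress G u i z c) D := fun i =>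
    contDiffOn_pi.mp (h.contDiffOn_stress i) c
  refine ⟨fun i => (h.contDiffOn_comp_leaf (hs i)).continuousOn,
    (h.contDiffOn_comp_leaf (contDiffOn_pi.mp h.contDiffOn_stressDiv c)).continuousOn,
    hasWeakDiv_of_contDiffOn h.isOpen_leaf (fun i => h.contDiffOn_comp_leaf (hs i))
      fun x hx => ?_⟩
  rw [← h.sum_fderiv_stress_apply (h.mem_domain x hx) c]
  exact Finset.sum_congr rfl fun i _ => partialDeriv_slice
    (h.differentiableAt_of_contDiffOn (hs i) (h.mem_domain x hx)) i

/-- The direction `w` is constant here. The direction of normal motion varies with `x` and is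
reached afterwards by multiplying three such identities by `C¹` coefficients. -/
theorem hasContWeakDiv_fderiv_stress (h : IsNormalVariation G Ω u D U ν f) (w : ℝ × Euc 2)
    (c : Fin 3) :
    HasContWeakDiv U (fun i x => fderiv ℝ (stress G u i) (0, x) w c)
      (fun x => fderiv ℝ (stressDiv G u) (0, x) w c) := by
  have hcont : ∀ {φ : ℝ × Euc 2 → Fin 3 → ℝ}, ContDiffOn ℝ 1 φ D →
      ContinuousOn (fun x : Euc 2 => fderiv ℝ φ (0, x) w c) U := fun {φ} hφ => by
    have h1 : ContinuousOn (fun z => fderiv ℝ φ z w) D :=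
      (hφ.continuousOn_fderiv_of_isOpen h.isOpen_domain le_rfl).clm_apply continuousOn_const
    exact (continuousOn_pi.mp h1 c).comp (by fun_prop : Continuous fun x : Euc 2 =>
      ((0 : ℝ), x)).continuousOn h.mem_domain
  refine ⟨fun i => hcont (h.contDiffOn_stress i), hcont h.contDiffOn_stressDiv, ?_⟩
  refine (hasWeakDiv_fderiv h.isOpen_domain h.mem_domain
    (P := fun i z => stress G u i z c) (Q := fun z => stressDiv G u z c)
    (fun i => contDiffOn_pi.mp (h.contDiffOn_stress i) c)
    (contDiffOn_pi.mp h.contDiffOn_stressDiv c)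
    (fun z hz => h.sum_fderiv_stress_apply hz c) w).congr ?_ ?_
  · exact fun x hx i => (fderiv_pi_apply (h.differentiableAt_of_contDiffOn
      (h.contDiffOn_stress i) (h.mem_domain x hx)) w c).symm
  · exact fun x hx => (fderiv_pi_apply (h.differentiableAt_of_contDiffOn
      h.contDiffOn_stressDiv (h.mem_domain x hx)) w c).symm

/-- The covariant derivative of the unit normal in the direction `∂ᵢ`. -/
def normalDeriv (G : Euc 3 → Matrix (Fin 3) (Fin 3) ℝ) (u : ℝ × Euc 2 → Euc 3)
    (ν : Euc 2 → Fin 3 → ℝ) (i : Fin 2) (x : Euc 2) : Fin 3 → ℝ :=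
  covDeriv G (fun x => u (0, x)) ν x (EuclideanSpace.single i 1)

theorem differentiableAt_map_leaf (h : IsNormalVariation G Ω u D U ν f) (hx : x ∈ U) :
    DifferentiableAt ℝ (fun x => u (0, x)) x :=
  h.differentiableAt_leaf
    (h.contDiffOn_comp_leaf (h.contDiffOn_map.of_le (by norm_num : (1 : WithTop ℕ∞) ≤ 2))) hx

theorem differentiableAt_normal (h : IsNormalVariation G Ω u D U ν f) (hx : x ∈ U) :
    DifferentiableAt ℝ ν x :=
  h.differentiableAt_leaf h.contDiffOn_normal hx

theorem contDiffOn_speed_one (h : IsNormalVariation G Ω u D U ν f) : ContDiffOn ℝ 1 f U :=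
  h.contDiffOn_speed.of_le (by norm_num)

theorem fderiv_map_leaf (h : IsNormalVariation G Ω u D U ν f) (hx : x ∈ U) (i : Fin 2) :
    (fderiv ℝ (fun x => u (0, x)) x (EuclideanSpace.single i 1)).ofLp = leafField u i (0, x) :=
  h.partialDeriv_leaf (h.mem_domain x hx) i

theorem partialDeriv_normal_pairing (h : IsNormalVariation G Ω u D U ν f) (hx : x ∈ U)
    {X : Euc 2 → Fin 3 → ℝ} (hX : DifferentiableAt ℝ X x) (i : Fin 2) :
    partialDeriv i (fun y => metricForm (G (u (0, y))) (ν y) (X y)) x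
      = metricForm (G (u (0, x))) (normalDeriv G u ν i x) (X x)
        + metricForm (G (u (0, x))) (ν x) (partialDeriv i X x
          + christoffelMap G (u (0, x)) (leafField u i (0, x)) (X x)) := by
  have := h.toIsMetricOn.fderiv_metricForm (u := fun x => u (0, x))
    (h.mapsTo (h.mem_domain x hx)) (h.differentiableAt_map_leaf hx)
    (h.differentiableAt_normal hx) hX (EuclideanSpace.single i 1)
  simp only [partialDeriv] at this ⊢
  rw [this]
  simp only [normalDeriv, covDeriv]
  rw [h.fderiv_map_leaf hx]

theorem partialDeriv_normal_const (h : IsNormalVariation G Ω u D U ν f) (hx : x ∈ U)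
    (w : Fin 3 → ℝ) (i : Fin 2) :
    partialDeriv i (fun y => metricForm (G (u (0, y))) (ν y) w) x
      = metricForm (G (u (0, x))) (normalDeriv G u ν i x) w
        + metricForm (G (u (0, x))) (ν x)
          (christoffelMap G (u (0, x)) (leafField u i (0, x)) w) := by
  rw [h.partialDeriv_normal_pairing hx (X := fun _ => w) (differentiableAt_const _)]
  simp [partialDeriv]

theorem contDiffOn_normal_pairing (h : IsNormalVariation G Ω u D U ν f)
    {X : Euc 2 → Fin 3 → ℝ} (hX : ContDiffOn ℝ 1 X U) :
    ContDiffOn ℝ 1 (fun y => metricForm (G (u (0, y))) (ν y) (X y)) U :=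
  contDiffOn_metricForm (fun i j => h.contDiffOn_comp_leaf (h.contDiffOn_metric_comp i j))
    h.contDiffOn_normal hX

theorem contDiffOn_speed_smul (h : IsNormalVariation G Ω u D U ν f) :
    ContDiffOn ℝ 1 (fun x => f x • ν x) U :=
  h.contDiffOn_speed_one.smul h.contDiffOn_normal

theorem contDiffOn_christoffelMap_normal (h : IsNormalVariation G Ω u D U ν f) (w : Fin 3 → ℝ) :
    ContDiffOn ℝ 1 (fun y => christoffelMap G (u (0, y)) (f y • ν y) w) U :=
  contDiffOn_bilinMap (fun a b c => h.contDiffOn_comp_leaf (h.contDiffOn_christoffel_comp a b c))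
    h.contDiffOn_speed_smul contDiffOn_const

theorem partialDeriv_christoffelMap_normal (h : IsNormalVariation G Ω u D U ν f) (hx : x ∈ U)
    (w : Fin 3 → ℝ) (i : Fin 2) :
    partialDeriv i (fun y => christoffelMap G (u (0, y)) (f y • ν y) w) x
      = christoffelDeriv G (u (0, x)) (leafField u i (0, x)) (f x • ν x) w
        + christoffelMap G (u (0, x)) (partialDeriv i (fun y => f y • ν y) x) w := by
  have := fderiv_christoffelMap_comp (u := fun x => u (0, x)) (X := fun y => f y • ν y)
    (Y := fun _ => w) (h.differentiableAt_christoffel (h.mapsTo (h.mem_domain x hx)))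
    (h.differentiableAt_map_leaf hx) (h.differentiableAt_leaf h.contDiffOn_speed_smul hx)
    (differentiableAt_const _) (EuclideanSpace.single i 1)
  simp only [partialDeriv] at this ⊢
  rw [this, h.fderiv_map_leaf hx]
  simp

/-- Differentiating `f ν = du(w)` along `∂ᵢ` and exchanging the second derivatives of `u`. The
derivatives of the tangential components enter because `w` is not a constant direction. -/
theorem fderiv_leafField_normalDir (h : IsNormalVariation G Ω u D U ν f) (hx : x ∈ U)
    (i : Fin 2) :
    fderiv ℝ (leafField u i) (0, x) (normalDir G u x)
      = partialDeriv i (fun y => f y • ν y) x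
        + (partialDeriv i (tangential G u 0) x • leafField u 0 (0, x)
          + partialDeriv i (tangential G u 1) x • leafField u 1 (0, x)) := by
  have hz := h.mem_domain x hx
  have hw : ∀ w, DifferentiableAt ℝ (fun y : Euc 2 => (fderiv ℝ u (0, y) w).ofLp) x := fun w =>
    h.differentiableAt_leaf (h.contDiffOn_comp_leaf (contDiffOn_ofLp (h.contDiffOn_fderiv w))) hx
  have hpd : ∀ w, partialDeriv i (fun y : Euc 2 => (fderiv ℝ u (0, y) w).ofLp) x
      = fderiv ℝ (leafField u i) (0, x) w := fun w => by
    rw [h.fderiv_leafField_comm hz]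
    exact partialDeriv_slice (φ := fun z => (fderiv ℝ u z w).ofLp)
      (h.differentiableAt_of_contDiffOn (contDiffOn_ofLp (h.contDiffOn_fderiv w)) hz) i
  have ht : ∀ k, DifferentiableAt ℝ (tangential G u k) x := fun k =>
    h.differentiableAt_leaf (h.contDiffOn_tangential k) hx
  have hev : (fun y => f y • ν y) =ᶠ[𝓝 x] fun y => (fderiv ℝ u (0, y) timeDir).ofLp
      - tangential G u 0 y • (fderiv ℝ u (0, y) (spaceDir 0)).ofLp
      - tangential G u 1 y • (fderiv ℝ u (0, y) (spaceDir 1)).ofLp := by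
    filter_upwards [h.isOpen_leaf.mem_nhds hx] with y hy
    rw [← h.fderiv_normalDir hy]
    simp only [normalDir, map_sub, map_smul, WithLp.ofLp_sub, WithLp.ofLp_smul]
  have hd : partialDeriv i (fun y => f y • ν y) x
      = fderiv ℝ (leafField u i) (0, x) timeDir
        - (tangential G u 0 x • fderiv ℝ (leafField u i) (0, x) (spaceDir 0)
          + partialDeriv i (tangential G u 0) x • leafField u 0 (0, x))
        - (tangential G u 1 x • fderiv ℝ (leafField u i) (0, x) (spaceDir 1)
          + partialDeriv i (tangential G u 1) x • leafField u 1 (0, x)) := by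
    rw [← hpd, ← hpd, ← hpd]
    simp only [partialDeriv]
    rw [hev.fderiv_eq, fderiv_fun_sub ((hw _).fun_sub ((ht 0).fun_smul (hw _)))
      ((ht 1).fun_smul (hw _)), fderiv_fun_sub (hw _) ((ht 0).fun_smul (hw _)),
      fderiv_fun_smul (ht 0) (hw _), fderiv_fun_smul (ht 1) (hw _)]
    rfl
  rw [hd]
  simp only [normalDir, map_sub, map_smul]
  abel

end IsNormalVariation

end Family

/-! ### The second variation as a weak divergence identity -/

section Family

namespace IsNormalVariation

variable {G : Euc 3 → Matrix (Fin 3) (Fin 3) ℝ} {Ω : Set (Euc 3)}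
  {u : ℝ × Euc 2 → Euc 3} {D : Set (ℝ × Euc 2)} {U : Set (Euc 2)} {ν : Euc 2 → Fin 3 → ℝ}
  {f : Euc 2 → ℝ} {x : Euc 2}

theorem partialDeriv_neg_mul {φ ψ : Euc 2 → ℝ} (hφ : DifferentiableAt ℝ φ x)
    (hψ : DifferentiableAt ℝ ψ x) (i : Fin 2) :
    partialDeriv i (fun y => -φ y * ψ y) x
      = -(partialDeriv i φ x * ψ x) - φ x * partialDeriv i ψ x := by
  simp only [partialDeriv]
  rw [fderiv_fun_mul hφ.fun_neg hψ]
  simp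
  ring

/-- The second variation identity, in divergence form and in the sense of distributions. -/
theorem hasContWeakDiv_normal (h : IsNormalVariation G Ω u D U ν f) :
    HasContWeakDiv U
      (fun i x => metricForm (G (u (0, x))) (ν x)
        (covDeriv G u (stress G u i) (0, x) (normalDir G u x)))
      (fun x => ∑ i, (metricForm (G (u (0, x))) (normalDeriv G u ν i x)
          (covDeriv G u (stress G u i) (0, x) (normalDir G u x))
        + metricForm (G (u (0, x))) (ν x) (curvatureOp G (u (0, x)) (leafField u i (0, x))
          (f x • ν x) (stress G u i (0, x)))
        - ∑ k, partialDeriv i (tangential G u k) x * metricForm (G (u (0, x))) (ν x)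
          (covDeriv G u (stress G u i) (0, x) (spaceDir k)))) := by
  have hν : ∀ w, ContDiffOn ℝ 1 (fun x => metricForm (G (u (0, x))) (ν x) w) U := fun w =>
    h.contDiffOn_normal_pairing contDiffOn_const
  have ht := h.contDiffOn_tangential
  -- With tangential components `τ₀, τ₁`, the covectors `ν`, `-τ₀ ν`, `-τ₁ ν` assemble the
  -- derivative of the stress along `w = ∂ₜ - τ₀ ∂₀ - τ₁ ∂₁`. The fourth identity, for the stress
  -- itself paired with `⟨ν, Γ(f ν, ·)⟩`, adds the Christoffel term that makes this derivative
  -- covariant.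
  have hsum := (((HasContWeakDiv.pair h.isOpen_leaf (h.hasContWeakDiv_fderiv_stress timeDir)
      (θ := fun x => metricForm (G (u (0, x))) (ν x)) hν).add h.isOpen_leaf
    (HasContWeakDiv.pair h.isOpen_leaf (h.hasContWeakDiv_fderiv_stress (spaceDir 0))
      (θ := fun x => -tangential G u 0 x • metricForm (G (u (0, x))) (ν x))
      fun w => (ht 0).neg.mul (hν w))).add h.isOpen_leaf
    (HasContWeakDiv.pair h.isOpen_leaf (h.hasContWeakDiv_fderiv_stress (spaceDir 1))
      (θ := fun x => -tangential G u 1 x • metricForm (G (u (0, x))) (ν x))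
      fun w => (ht 1).neg.mul (hν w))).add h.isOpen_leaf
    (HasContWeakDiv.pair h.isOpen_leaf h.hasContWeakDiv_stress
      (θ := fun x => metricForm (G (u (0, x))) (ν x) ∘ₗ
        christoffelMap G (u (0, x)) (f x • ν x))
      fun w => h.contDiffOn_normal_pairing (h.contDiffOn_christoffelMap_normal w))
  refine hsum.congr (fun x hx i => ?_) (fun x hx => ?_)
  · simp only [covDeriv, h.fderiv_normalDir hx, map_add]
    simp only [normalDir, map_sub, map_smul, LinearMap.smul_apply, smul_eq_mul,
      LinearMap.comp_apply]
    ring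
  · have hz := h.mem_domain x hx
    have htd : ∀ k, DifferentiableAt ℝ (tangential G u k) x := fun k =>
      h.differentiableAt_leaf (ht k) hx
    have hνd : ∀ w, DifferentiableAt ℝ (fun x => metricForm (G (u (0, x))) (ν x) w) x := fun w =>
      h.differentiableAt_leaf (hν w) hx
    have e1 : ∀ k i w, partialDeriv i (fun y =>
        (-tangential G u k y • metricForm (G (u (0, y))) (ν y)) w) x
        = -(partialDeriv i (tangential G u k) x * metricForm (G (u (0, x))) (ν x) w)
          - tangential G u k x * (metricForm (G (u (0, x))) (normalDeriv G u ν i x) w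
            + metricForm (G (u (0, x))) (ν x)
              (christoffelMap G (u (0, x)) (leafField u i (0, x)) w)) := by
      intro k i w
      rw [← h.partialDeriv_normal_const hx]
      exact partialDeriv_neg_mul (htd k) (hνd w) i
    have e2 : ∀ i w, partialDeriv i (fun y => (metricForm (G (u (0, y))) (ν y) ∘ₗ
          christoffelMap G (u (0, y)) (f y • ν y)) w) x
        = metricForm (G (u (0, x))) (normalDeriv G u ν i x)
            (christoffelMap G (u (0, x)) (f x • ν x) w)
          + metricForm (G (u (0, x))) (ν x)
            (christoffelDeriv G (u (0, x)) (leafField u i (0, x)) (f x • ν x) w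
              + christoffelMap G (u (0, x)) (partialDeriv i (fun y => f y • ν y) x) w
              + christoffelMap G (u (0, x)) (leafField u i (0, x))
                (christoffelMap G (u (0, x)) (f x • ν x) w)) := by
      intro i w
      rw [← h.partialDeriv_christoffelMap_normal hx]
      exact h.partialDeriv_normal_pairing hx
        (h.differentiableAt_leaf (h.contDiffOn_christoffelMap_normal w) hx) i
    -- Expressing derivatives of `f ν` through the leaf fields, and below the time derivatives
    -- through `w`, makes all terms comparable; the commutator of the covariant derivatives then
    -- appears as `curvatureOp_eq`.
    have e3 : ∀ i, partialDeriv i (fun y => f y • ν y) x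
        = fderiv ℝ (leafField u i) (0, x) (normalDir G u x)
          - (partialDeriv i (tangential G u 0) x • leafField u 0 (0, x)
            + partialDeriv i (tangential G u 1) x • leafField u 1 (0, x)) := fun i => by
      rw [h.fderiv_leafField_normalDir hx]
      abel
    have e4 : fderiv ℝ (stressDiv G u) (0, x) timeDir
        = fderiv ℝ (stressDiv G u) (0, x) (normalDir G u x)
        + tangential G u 0 x • fderiv ℝ (stressDiv G u) (0, x) (spaceDir 0)
        + tangential G u 1 x • fderiv ℝ (stressDiv G u) (0, x) (spaceDir 1) := by
      simp only [normalDir, map_sub, map_smul]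
      abel
    have e5 : ∀ i, fderiv ℝ (stress G u i) (0, x) timeDir
        = fderiv ℝ (stress G u i) (0, x) (normalDir G u x)
        + tangential G u 0 x • fderiv ℝ (stress G u i) (0, x) (spaceDir 0)
        + tangential G u 1 x • fderiv ℝ (stress G u i) (0, x) (spaceDir 1) := fun i => by
      simp only [normalDir, map_sub, map_smul]
      abel
    have hl : ∀ k, (fderiv ℝ u (0, x) (spaceDir k)).ofLp = leafField u k (0, x) := fun k => rfl
    simp only [e1, e2, e3, h.partialDeriv_normal_const hx]
    rw [e4]
    simp only [e5]
    rw [h.fderiv_stressDiv hz (normalDir G u x), h.fderiv_normalDir hx]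
    simp only [stressDiv, curvatureOp_eq, covDeriv, h.fderiv_normalDir hx, Fin.sum_univ_two,
      map_add, map_sub, map_neg, map_smul, LinearMap.add_apply, LinearMap.sub_apply,
      LinearMap.smul_apply, smul_eq_mul, LinearMap.comp_apply, hl]
    ring

end IsNormalVariation

end Family

/-! ### Linearity and antisymmetry of the curvature operator -/

section Curvature

variable {n : ℕ} (G : Euc n → Matrix (Fin n) (Fin n) ℝ) (y : Euc n)

theorem curvatureOp_add_left (X X' Y Z : Fin n → ℝ) :
    curvatureOp G y (X + X') Y Z = curvatureOp G y X Y Z + curvatureOp G y X' Y Z := by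
  ext l
  simp only [curvatureOp, Pi.add_apply, mul_add, add_mul, Finset.sum_add_distrib]

theorem curvatureOp_smul_middle (c : ℝ) (X Y Z : Fin n → ℝ) :
    curvatureOp G y X (c • Y) Z = c • curvatureOp G y X Y Z := by
  ext l
  simp only [curvatureOp, Pi.smul_apply, smul_eq_mul, Finset.mul_sum]
  exact Finset.sum_congr rfl fun i _ => Finset.sum_congr rfl fun j _ =>
    Finset.sum_congr rfl fun k _ => by ring

theorem curvatureOp_add_right (X Y Z Z' : Fin n → ℝ) :
    curvatureOp G y X Y (Z + Z') = curvatureOp G y X Y Z + curvatureOp G y X Y Z' := by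
  simp only [curvatureOp_eq, map_add]
  abel

theorem curvatureOp_sub_right (X Y Z Z' : Fin n → ℝ) :
    curvatureOp G y X Y (Z - Z') = curvatureOp G y X Y Z - curvatureOp G y X Y Z' := by
  simp only [curvatureOp_eq, map_sub]
  abel

theorem curvatureOp_smul_right (c : ℝ) (X Y Z : Fin n → ℝ) :
    curvatureOp G y X Y (c • Z) = c • curvatureOp G y X Y Z := by
  simp only [curvatureOp_eq, map_smul, smul_add, smul_sub]

theorem curvatureOp_swap (X Y Z : Fin n → ℝ) :
    curvatureOp G y X Y Z = -curvatureOp G y Y X Z := by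
  simp only [curvatureOp_eq]
  abel

end Curvature

/-! ### The Jacobi equation in coordinates -/

section Family

/-- The traces in the second variation identity. `L` is the second fundamental form, `N` the
Gram matrix of the derivatives of the unit normal, `t` the matrix of derivatives of the
tangential components of the variation, and `W₁, E₁, F₁, K₁` are normal derivatives. -/
theorem second_variation_algebra {E F K W L₀₀ L₀₁ L₁₁ f t₀₀ t₀₁ t₁₀ t₁₁ E₁ F₁ K₁ W₁ N₀₀ N₀₁ N₁₁ : ℝ}
    (hE : 0 < E) (hW : 0 < W) (hW2 : W ^ 2 = E * K - F ^ 2)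
    (hW₁ : 2 * W * W₁ = E₁ * K + E * K₁ - 2 * F * F₁)
    (hE₁ : E₁ = 2 * (-f * L₀₀ + t₀₀ * E + t₀₁ * F))
    (hF₁ : F₁ = (-f * L₀₁ + t₀₀ * F + t₀₁ * K) + (-f * L₀₁ + t₁₀ * E + t₁₁ * F))
    (hK₁ : K₁ = 2 * (-f * L₁₁ + t₁₀ * F + t₁₁ * K))
    (hN₀₀ : N₀₀ = (K * L₀₀ - F * L₀₁) / W ^ 2 * L₀₀ + (E * L₀₁ - F * L₀₀) / W ^ 2 * L₀₁)
    (hN₀₁ : N₀₁ = (K * L₀₀ - F * L₀₁) / W ^ 2 * L₀₁ + (E * L₀₁ - F * L₀₀) / W ^ 2 * L₁₁)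
    (hN₁₁ : N₁₁ = (K * L₀₁ - F * L₁₁) / W ^ 2 * L₀₁ + (E * L₁₁ - F * L₀₁) / W ^ 2 * L₁₁)
    (hH : K * L₀₀ - 2 * F * L₀₁ + E * L₁₁ = 0) :
    (W⁻¹ * (K₁ * -L₀₀ + K * (f * N₀₀ - t₀₀ * L₀₀ - t₀₁ * L₀₁)
        - (F₁ * -L₀₁ + F * (f * N₀₁ - t₁₀ * L₀₀ - t₁₁ * L₀₁)))
        - W₁ / W * (W⁻¹ * (K * -L₀₀ - F * -L₀₁)))
      + (W⁻¹ * (E₁ * -L₁₁ + E * (f * N₁₁ - t₁₀ * L₀₁ - t₁₁ * L₁₁)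
        - (F₁ * -L₀₁ + F * (f * N₀₁ - t₀₀ * L₀₁ - t₀₁ * L₁₁)))
        - W₁ / W * (W⁻¹ * (E * -L₁₁ - F * -L₀₁)))
      - (t₀₀ * (W⁻¹ * (K * L₀₀ - F * L₀₁)) + t₀₁ * (W⁻¹ * (K * L₀₁ - F * L₁₁)))
      - (t₁₀ * (W⁻¹ * (E * L₀₁ - F * L₀₀)) + t₁₁ * (W⁻¹ * (E * L₁₁ - F * L₀₁)))
    = -(W * f * (K / W ^ 2 * N₀₀ - 2 * (F / W ^ 2) * N₀₁ + E / W ^ 2 * N₁₁)) := by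
  have hE0 := hE.ne'
  have hW0 := hW.ne'
  -- Minimality eliminates `L₁₁` and the area relation eliminates `K`; only `E` and `W`, both
  -- positive, remain as denominators of a rational identity.
  obtain rfl : L₁₁ = (2 * F * L₀₁ - K * L₀₀) / E := by
    field_simp
    linarith
  obtain rfl : K = (W ^ 2 + F ^ 2) / E := by
    field_simp
    linarith
  have hW₁' : W₁ = (E₁ * ((W ^ 2 + F ^ 2) / E) + E * K₁ - 2 * F * F₁) / (2 * W) := by
    rw [← hW₁]
    field_simp
  rw [hW₁', hN₀₀, hN₀₁, hN₁₁, hE₁, hF₁, hK₁]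
  field_simp
  ring

end Family

section Family

namespace IsNormalVariation

variable {G : Euc 3 → Matrix (Fin 3) (Fin 3) ℝ} {Ω : Set (Euc 3)}
  {u : ℝ × Euc 2 → Euc 3} {D : Set (ℝ × Euc 2)} {U : Set (Euc 2)} {ν : Euc 2 → Fin 3 → ℝ}
  {f : Euc 2 → ℝ} {x : Euc 2}

/-- The coefficients of the scalar second fundamental form of the leaf `t = 0`. -/
def shape (G : Euc 3 → Matrix (Fin 3) (Fin 3) ℝ) (u : ℝ × Euc 2 → Euc 3)
    (ν : Euc 2 → Fin 3 → ℝ) (i j : Fin 2) (x : Euc 2) : ℝ :=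
  metricForm (G (u (0, x))) (ν x) (covDeriv G u (leafField u j) (0, x) (spaceDir i))

theorem shape_comm (h : IsNormalVariation G Ω u D U ν f) (hx : x ∈ U) :
    shape G u ν 1 0 x = shape G u ν 0 1 x := by
  simp only [shape, h.covDeriv_leafField_comm (h.mem_domain x hx)]

/-- Differentiate the relation `⟨ν, ∂ⱼu⟩ = 0` along `∂ᵢ`. -/
theorem normalDeriv_leafField (h : IsNormalVariation G Ω u D U ν f) (hx : x ∈ U) (i j : Fin 2) :
    metricForm (G (u (0, x))) (normalDeriv G u ν i x) (leafField u j (0, x))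
      = -shape G u ν i j x := by
  have hz := h.mem_domain x hx
  have h1 := h.partialDeriv_normal_pairing hx (X := fun y => leafField u j (0, y))
    (h.differentiableAt_leaf (h.contDiffOn_comp_leaf (h.contDiffOn_leafField j)) hx) i
  have h2 : (fun y => metricForm (G (u (0, y))) (ν y) (leafField u j (0, y)))
      =ᶠ[𝓝 x] fun _ => 0 := by
    filter_upwards [h.isOpen_leaf.mem_nhds hx] with y hy using h.orthogonal y hy j
  have h3 : partialDeriv i (fun y => leafField u j (0, y)) x
      = fderiv ℝ (leafField u j) (0, x) (spaceDir i) :=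
    partialDeriv_slice (h.differentiableAt_of_contDiffOn (h.contDiffOn_leafField j) hz) i
  rw [h3] at h1
  have h4 : partialDeriv i (fun y => metricForm (G (u (0, y))) (ν y) (leafField u j (0, y))) x
      = 0 := by
    simp only [partialDeriv]
    rw [h2.fderiv_eq]
    simp
  rw [h4] at h1
  exact eq_neg_of_add_eq_zero_left h1.symm

theorem normalDeriv_normal (h : IsNormalVariation G Ω u D U ν f) (hx : x ∈ U) (i : Fin 2) :
    metricForm (G (u (0, x))) (normalDeriv G u ν i x) (ν x) = 0 := by
  have hz := h.mem_domain x hx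
  have h1 := h.toIsMetricOn.fderiv_metricForm (u := fun x => u (0, x)) (h.mapsTo hz)
    (h.differentiableAt_map_leaf hx) (h.differentiableAt_normal hx)
    (h.differentiableAt_normal hx) (EuclideanSpace.single i 1)
  have h2 : (fun y => metricForm (G (u (0, y))) (ν y) (ν y)) =ᶠ[𝓝 x] fun _ => 1 := by
    filter_upwards [h.isOpen_leaf.mem_nhds hx] with y hy using h.unit y hy
  rw [h2.fderiv_eq, h.comm (h.mapsTo hz) (ν x)] at h1
  simp only [fderiv_fun_const, Pi.zero_apply, zero_apply] at h1
  simp only [normalDeriv]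
  linarith

/-- The Weingarten equation: the derivative of a unit normal is tangential, with components given by
the second fundamental form. -/
theorem normalDeriv_eq (h : IsNormalVariation G Ω u D U ν f) (hx : x ∈ U) (i : Fin 2) :
    normalDeriv G u ν i x
      = (-((gram G u 1 1 (0, x) * shape G u ν i 0 x - gram G u 0 1 (0, x) * shape G u ν i 1 x)
          / areaDensity G u (0, x) ^ 2)) • leafField u 0 (0, x)
      + (-((gram G u 0 0 (0, x) * shape G u ν i 1 x - gram G u 0 1 (0, x) * shape G u ν i 0 x)
          / areaDensity G u (0, x) ^ 2)) • leafField u 1 (0, x) := by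
  conv_lhs => rw [h.decomposition hx (normalDeriv G u ν i x)]
  simp only [h.normalDeriv_normal hx, h.normalDeriv_leafField hx, zero_smul, zero_add]
  congr 2 <;> ring

theorem normalDeriv_normalDeriv (h : IsNormalVariation G Ω u D U ν f) (hx : x ∈ U)
    (i j : Fin 2) :
    metricForm (G (u (0, x))) (normalDeriv G u ν i x) (normalDeriv G u ν j x)
      = (gram G u 1 1 (0, x) * shape G u ν i 0 x - gram G u 0 1 (0, x) * shape G u ν i 1 x)
          / areaDensity G u (0, x) ^ 2 * shape G u ν j 0 x
      + (gram G u 0 0 (0, x) * shape G u ν i 1 x - gram G u 0 1 (0, x) * shape G u ν i 0 x)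
          / areaDensity G u (0, x) ^ 2 * shape G u ν j 1 x := by
  have hc := h.comm (h.mapsTo (h.mem_domain x hx))
  conv_lhs => rw [h.normalDeriv_eq hx i]
  simp only [map_add, map_smul, LinearMap.add_apply, LinearMap.smul_apply, smul_eq_mul,
    hc (leafField u _ _), h.normalDeriv_leafField hx]
  ring

/-- Since the connection is torsion-free, this is `∇ᵢ(f ν)` plus a tangential correction from the
variable direction `w`. In particular its normal component is `∂ᵢf`, the source of the gradient of
`f`. -/
theorem covDeriv_leafField_normalDir (h : IsNormalVariation G Ω u D U ν f) (hx : x ∈ U)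
    (i : Fin 2) :
    covDeriv G u (leafField u i) (0, x) (normalDir G u x)
      = partialDeriv i f x • ν x + f x • normalDeriv G u ν i x
        + (partialDeriv i (tangential G u 0) x • leafField u 0 (0, x)
          + partialDeriv i (tangential G u 1) x • leafField u 1 (0, x)) := by
  have hz := h.mem_domain x hx
  have h1 : partialDeriv i (fun y => f y • ν y) x
      = f x • fderiv ℝ ν x (EuclideanSpace.single i 1) + partialDeriv i f x • ν x := by
    simp only [partialDeriv]
    rw [fderiv_fun_smul (h.differentiableAt_leaf h.contDiffOn_speed_one hx)
      (h.differentiableAt_normal hx)]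
    rfl
  rw [covDeriv, h.fderiv_leafField_normalDir hx, h.fderiv_normalDir hx, h1,
    christoffelMap_comm (h.eventually_isSymm (h.mapsTo hz))]
  simp only [normalDeriv, covDeriv, h.fderiv_map_leaf hx, map_smul, smul_add]
  abel

/-- The normal component of the divergence identity for the stress; derivatives of the coefficients
multiply tangent vectors and drop out. -/
theorem trace_shape (h : IsNormalVariation G Ω u D U ν f) (hx : x ∈ U) :
    gram G u 1 1 (0, x) * shape G u ν 0 0 x - 2 * gram G u 0 1 (0, x) * shape G u ν 0 1 x
      + gram G u 0 0 (0, x) * shape G u ν 1 1 x = 0 := by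
  have hz := h.mem_domain x hx
  have h1 := congrArg (metricForm (G (u (0, x))) (ν x))
    (h.covDeriv_stress_sum hz (h.minimal 0 x hz))
  rw [h.covDeriv_stress_zero hz, h.covDeriv_stress_one hz] at h1
  simp only [stress, Matrix.cons_val_zero, Matrix.cons_val_one, map_add, map_sub, map_smul,
    smul_eq_mul, h.orthogonal x hx, map_zero] at h1
  have hs : ∀ i j, metricForm (G (u (0, x))) (ν x)
      (covDeriv G u (leafField u j) (0, x) (spaceDir i)) = shape G u ν i j x := fun _ _ => rfl
  simp only [hs, h.shape_comm hx] at h1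
  have hW := (h.areaDensity_pos hz).ne'
  field_simp at h1
  refine (mul_eq_zero.mp ?_).resolve_left hW
  linear_combination h1

/-- The squared norm of the second fundamental form as the squared norm of the derivative of the
unit normal. -/
theorem secondFormNormSq_eq (h : IsNormalVariation G Ω u D U ν f) (hx : x ∈ U) :
    secondFormNormSq G (fun x => u (0, x)) x
      = gram G u 1 1 (0, x) / areaDensity G u (0, x) ^ 2
          * metricForm (G (u (0, x))) (normalDeriv G u ν 0 x) (normalDeriv G u ν 0 x)
        - 2 * (gram G u 0 1 (0, x) / areaDensity G u (0, x) ^ 2)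
          * metricForm (G (u (0, x))) (normalDeriv G u ν 0 x) (normalDeriv G u ν 1 x)
        + gram G u 0 0 (0, x) / areaDensity G u (0, x) ^ 2
          * metricForm (G (u (0, x))) (normalDeriv G u ν 1 x) (normalDeriv G u ν 1 x) := by
  have hz := h.mem_domain x hx
  -- In codimension one, removing the tangential part of `∇ᵢ∂ⱼu` leaves its multiple of `ν`.
  have hs : ∀ i j, secondForm G (fun x => u (0, x)) i j x = shape G u ν i j x • ν x := by
    intro i j
    have hd := h.decomposition hx (covDeriv G u (leafField u j) (0, x) (spaceDir i))
    ext a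
    have ha := congrFun hd a
    rw [h.comm (h.mapsTo hz) _ (ν x)] at ha
    simp only [Pi.add_apply, Pi.smul_apply, smul_eq_mul] at ha
    simp only [secondForm, Fin.sum_univ_two, h.ambientDeriv_leaf hz,
      h.inv_inducedMatrix_leaf hz, h.partialDeriv_leaf hz, ← metricForm_apply,
      Matrix.of_apply, Matrix.cons_val', Matrix.cons_val_zero, Matrix.cons_val_one,
      Matrix.cons_val_fin_one, Pi.smul_apply, smul_eq_mul]
    rw [sub_eq_iff_eq_add]
    refine ha.trans ?_
    simp only [shape]
    ring
  simp only [secondFormNormSq, hs, ← metricForm_apply, map_smul, LinearMap.smul_apply,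
    smul_eq_mul, h.unit x hx, h.normalDeriv_normalDeriv hx, Fin.sum_univ_two,
    h.inv_inducedMatrix_leaf hz, Matrix.of_apply, Matrix.cons_val', Matrix.cons_val_zero,
    Matrix.cons_val_one, Matrix.cons_val_fin_one, h.shape_comm hx]
  ring

/-- The sum is `√(det γ) f` times the trace `γⁱʲ ⟨ν, R(∂ᵢu, ν) ∂ⱼu⟩ = -Ric(ν, ν)`, and both
sectional curvatures of an orthonormal pair of planes through `ν` are `-1`. -/
theorem sum_curvature (h : IsNormalVariation G Ω u D U ν f) (hx : x ∈ U)
    (hsec : ∀ y ∈ Ω, ∀ X Y : Fin 3 → ℝ,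
      LinearIndependent ℝ ![X, Y] → sectionalCurvature G y X Y = -1) :
    ∑ i, metricForm (G (u (0, x))) (ν x) (curvatureOp G (u (0, x)) (leafField u i (0, x))
      (f x • ν x) (stress G u i (0, x))) = 2 * areaDensity G u (0, x) * f x := by
  have hz := h.mem_domain x hx
  have hc := h.comm (h.mapsTo hz)
  set g := metricForm (G (u (0, x))) with hg
  set R := curvatureOp G (u (0, x)) with hR
  have hu : g (ν x) (ν x) = 1 := h.unit x hx
  have hr : ∀ w : Fin 3 → ℝ, w ≠ 0 → g (ν x) w = 0 → g (ν x) (R w (ν x) w) = g w w := by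
    intro w hw hνw
    have hww : 0 < g w w := h.pos _ (h.mapsTo hz) w hw
    have hli : LinearIndependent ℝ ![ν x, w] := by
      rw [LinearIndependent.pair_iff]
      intro s t hst
      have h1 := congrArg (g (ν x)) hst
      have h2 := congrArg (g w) hst
      simp only [map_add, map_smul, smul_eq_mul, hu, hνw, map_zero, hc w (ν x)] at h1 h2
      have hs : s = 0 := by linarith
      refine ⟨hs, ?_⟩
      rw [hs] at h2
      have : t * g w w = 0 := by linarith
      exact (mul_eq_zero.mp this).resolve_right hww.ne'
    have hsc := hsec _ (h.mapsTo hz) _ _ hli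
    simp only [sectionalCurvature, ← metricForm_apply, ← hg, ← hR] at hsc
    rw [hu, hνw, div_eq_iff (by simpa using hww.ne')] at hsc
    have hsw : R w (ν x) w = -R (ν x) w w := curvatureOp_swap _ _ _ _ _
    rw [hsw, map_neg, hc, hsc]
    ring
  set a := leafField u 0 (0, x) with ha
  set b := leafField u 1 (0, x) with hb
  have hνa : g (ν x) a = 0 := h.orthogonal x hx 0
  have hνb : g (ν x) b = 0 := h.orthogonal x hx 1
  have hraa := hr a (fun h0 => by
    simpa using h.immersed _ hz 1 0 (by simp [← ha, h0])) hνa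
  have hrbb := hr b (fun h0 => by
    simpa using h.immersed _ hz 0 1 (by simp [← hb, h0])) hνb
  -- Polarization determines only the symmetric sum of the two mixed terms. That suffices, because
  -- both carry the same coefficient `F`, and no pair symmetry of the curvature tensor is needed.
  have hrab := hr (a + b) (fun h0 => by
    simpa using h.immersed _ hz 1 1 (by simpa [← ha, ← hb] using h0)) (by simp [hνa, hνb])
  have hl : R (a + b) (ν x) (a + b) = R a (ν x) a + R a (ν x) b + (R b (ν x) a + R b (ν x) b) := by
    rw [hR, curvatureOp_add_left, curvatureOp_add_right, curvatureOp_add_right]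
  rw [hl] at hrab
  simp only [map_add, LinearMap.add_apply, hraa, hrbb] at hrab
  have hE : g a a = gram G u 0 0 (0, x) := rfl
  have hF : g a b = gram G u 0 1 (0, x) := rfl
  have hK : g b b = gram G u 1 1 (0, x) := rfl
  have hF' : g b a = gram G u 0 1 (0, x) := h.gram_comm hz
  rw [hF, hF'] at hrab
  rw [hE] at hraa
  rw [hK] at hrbb
  rw [Fin.sum_univ_two]
  change g (ν x) (R a (f x • ν x) ((areaDensity G u (0, x))⁻¹ • (gram G u 1 1 (0, x) • a
      - gram G u 0 1 (0, x) • b)))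
    + g (ν x) (R b (f x • ν x) ((areaDensity G u (0, x))⁻¹ • (gram G u 0 0 (0, x) • b
      - gram G u 0 1 (0, x) • a))) = _
  simp only [hR, curvatureOp_smul_middle, curvatureOp_smul_right, curvatureOp_sub_right]
  simp only [← hR, map_smul, map_sub, smul_eq_mul, hraa, hrbb]
  have hW := (h.areaDensity_pos hz).ne'
  have hW2 := h.areaDensity_sq hz
  field_simp
  linear_combination f x * (-2) * hW2 - f x * gram G u 0 1 (0, x) * hrab

/-- The divergence form of the Jacobi equation. -/
theorem hasContWeakDiv_gradient (h : IsNormalVariation G Ω u D U ν f)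
    (hsec : ∀ y ∈ Ω, ∀ X Y : Fin 3 → ℝ,
      LinearIndependent ℝ ![X, Y] → sectionalCurvature G y X Y = -1) :
    HasContWeakDiv U
      (fun i x => √(inducedMatrix G (fun x => u (0, x)) x).det
        * ∑ j, (inducedMatrix G (fun x => u (0, x)) x)⁻¹ i j * partialDeriv j f x)
      (fun x => √(inducedMatrix G (fun x => u (0, x)) x).det
        * ((2 - secondFormNormSq G (fun x => u (0, x)) x) * f x)) := by
  have hdet : ∀ x ∈ U, √(inducedMatrix G (fun x => u (0, x)) x).det
      = areaDensity G u (0, x) := fun x hx => by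
    rw [h.inducedMatrix_leaf (h.mem_domain x hx), Matrix.det_fin_two_of, areaDensity, sq]
  -- Field: in `⟨ν, ∇_w Pⁱ⟩` the tangential terms vanish and `⟨ν, ∇_w ∂ⱼu⟩ = ∂ⱼf`. Divergence:
  -- `sum_curvature` gives the constant `2`, and all other terms reduce to `-‖A‖²`.
  refine h.hasContWeakDiv_normal.congr (fun x hx i => ?_) (fun x hx => ?_)
  · have hz := h.mem_domain x hx
    have hW := (h.areaDensity_pos hz).ne'
    have hν := h.unit x hx
    have ho := h.orthogonal x hx
    have hn : ∀ i, metricForm (G (u (0, x))) (ν x) (normalDeriv G u ν i x) = 0 := fun i => by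
      rw [h.comm (h.mapsTo hz), h.normalDeriv_normal hx]
    rw [hdet x hx, h.inv_inducedMatrix_leaf hz]
    fin_cases i
    · simp only [Fin.zero_eta, h.covDeriv_stress_zero hz, h.covDeriv_leafField_normalDir hx]
      simp only [stress,
        Matrix.cons_val_zero, map_add, map_sub, map_smul, smul_eq_mul, hν, ho, hn,
        Fin.sum_univ_two, Matrix.of_apply, Matrix.cons_val', Matrix.cons_val_one,
        Matrix.cons_val_fin_one]
      field_simp
      ring
    · simp only [Fin.mk_one, h.covDeriv_stress_one hz, h.covDeriv_leafField_normalDir hx]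
      simp only [stress,
        Matrix.cons_val_zero, map_add, map_sub, map_smul, smul_eq_mul, hν, ho, hn,
        Fin.sum_univ_two, Matrix.of_apply, Matrix.cons_val', Matrix.cons_val_one,
        Matrix.cons_val_fin_one]
      field_simp
      ring
  · have hz := h.mem_domain x hx
    have hcomm := h.comm (h.mapsTo hz)
    have hν := h.unit x hx
    have ho := h.orthogonal x hx
    have hs : ∀ i j, metricForm (G (u (0, x))) (ν x)
        (covDeriv G u (leafField u j) (0, x) (spaceDir i)) = shape G u ν i j x := fun _ _ => rfl
    have hleaf : ∀ i j, metricForm (G (u (0, x)))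
        (covDeriv G u (leafField u i) (0, x) (normalDir G u x)) (leafField u j (0, x))
        = -f x * shape G u ν i j x + partialDeriv i (tangential G u 0) x * gram G u 0 j (0, x)
          + partialDeriv i (tangential G u 1) x * gram G u 1 j (0, x) := by
      intro i j
      rw [h.covDeriv_leafField_normalDir hx]
      simp only [map_add, map_smul, LinearMap.add_apply, LinearMap.smul_apply, smul_eq_mul, ho,
        h.normalDeriv_leafField hx, gram]
      ring
    have hleaf' : ∀ i j, metricForm (G (u (0, x))) (leafField u j (0, x))
        (covDeriv G u (leafField u i) (0, x) (normalDir G u x))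
        = -f x * shape G u ν i j x + partialDeriv i (tangential G u 0) x * gram G u 0 j (0, x)
          + partialDeriv i (tangential G u 1) x * gram G u 1 j (0, x) := fun i j => by
      rw [hcomm, hleaf i j]
    have hnd : ∀ i j, metricForm (G (u (0, x))) (normalDeriv G u ν i x)
        (covDeriv G u (leafField u j) (0, x) (normalDir G u x))
        = f x * metricForm (G (u (0, x))) (normalDeriv G u ν i x) (normalDeriv G u ν j x)
          - partialDeriv j (tangential G u 0) x * shape G u ν i 0 x
          - partialDeriv j (tangential G u 1) x * shape G u ν i 1 x := by
      intro i j
      rw [h.covDeriv_leafField_normalDir hx]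
      simp only [map_add, map_smul, smul_eq_mul, h.normalDeriv_leafField hx,
        h.normalDeriv_normal hx]
      ring
    rw [hdet x hx, h.secondFormNormSq_eq hx]
    have key := second_variation_algebra (f := f x)
      (E₁ := fderiv ℝ (gram G u 0 0) (0, x) (normalDir G u x))
      (F₁ := fderiv ℝ (gram G u 0 1) (0, x) (normalDir G u x))
      (K₁ := fderiv ℝ (gram G u 1 1) (0, x) (normalDir G u x)) (L₀₀ := shape G u ν 0 0 x)
      (L₀₁ := shape G u ν 0 1 x) (L₁₁ := shape G u ν 1 1 x)
      (t₀₀ := partialDeriv 0 (tangential G u 0) x) (t₀₁ := partialDeriv 0 (tangential G u 1) x)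
      (t₁₀ := partialDeriv 1 (tangential G u 0) x) (t₁₁ := partialDeriv 1 (tangential G u 1) x)
      (h.gram_pos hz).1 (h.areaDensity_pos hz) (h.areaDensity_sq hz)
      (h.fderiv_areaDensity hz (normalDir G u x))
      (by rw [h.fderiv_gram hz, hleaf 0 0, hleaf', h.gram_comm hz]; ring)
      (by rw [h.fderiv_gram hz, hleaf 0 1, hleaf', h.gram_comm hz, h.shape_comm hx])
      (by rw [h.fderiv_gram hz, hleaf 1 1, hleaf']; ring)
      (h.normalDeriv_normalDeriv hx 0 0) ((h.normalDeriv_normalDeriv hx 0 1).trans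
        (by rw [h.shape_comm hx])) ((h.normalDeriv_normalDeriv hx 1 1).trans
        (by rw [h.shape_comm hx])) (h.trace_shape hx)
    have hcurv := h.sum_curvature hx hsec
    rw [Finset.sum_sub_distrib, Finset.sum_add_distrib, hcurv]
    simp only [Fin.sum_univ_two, h.covDeriv_stress_zero hz, h.covDeriv_stress_one hz]
    simp only [stress, Matrix.cons_val_zero, Matrix.cons_val_one, map_add, map_sub, map_smul,
      smul_eq_mul, ho, hs, hnd, h.normalDeriv_leafField hx, h.shape_comm hx]
    rw [hcomm (normalDeriv G u ν 1 x) (normalDeriv G u ν 0 x)]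
    linear_combination -key

/-- The coefficients of the first fundamental form are `C¹` and `f` is `C²`, so the field `√(det γ)
γⁱʲ ∂ⱼf` is `C¹` and its weak divergence is classical. -/
theorem laplaceBeltrami_eq (h : IsNormalVariation G Ω u D U ν f)
    (hsec : ∀ y ∈ Ω, ∀ X Y : Fin 3 → ℝ,
      LinearIndependent ℝ ![X, Y] → sectionalCurvature G y X Y = -1) (hx : x ∈ U) :
    laplaceBeltrami (inducedMatrix G fun x => u (0, x)) f x
      = (2 - secondFormNormSq G (fun x => u (0, x)) x) * f x := by
  have hz := h.mem_domain x hx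
  have hdet : ∀ x ∈ U, 0 < (inducedMatrix G (fun x => u (0, x)) x).det := fun x hx => by
    rw [h.inducedMatrix_leaf (h.mem_domain x hx), Matrix.det_fin_two_of, ← sq]
    exact h.gram_det_pos (h.mem_domain x hx)
  have hγ : ∀ i j, ContDiffOn ℝ 1 (fun x => inducedMatrix G (fun x => u (0, x)) x i j) U := by
    intro i j
    refine (h.contDiffOn_comp_leaf (h.contDiffOn_gram i j)).congr fun y hy => ?_
    simp only [inducedMatrix, Matrix.of_apply, h.partialDeriv_leaf (h.mem_domain y hy)]
    rfl
  have hf : ∀ j, ContDiffOn ℝ 1 (partialDeriv j f) U := fun j =>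
    (h.contDiffOn_speed.fderiv_of_isOpen h.isOpen_leaf (by norm_num)).clm_apply contDiffOn_const
  have hw := h.hasContWeakDiv_gradient hsec
  have := hw.hasWeakDiv.eqOn h.isOpen_leaf (fun i =>
    ((contDiffOn_det hγ).sqrt fun x hx => (hdet x hx).ne').mul (ContDiffOn.sum fun j _ =>
      (contDiffOn_inv hγ (fun x hx => (hdet x hx).ne') i j).mul (hf j))) hw.continuousOn_div x hx
  rw [laplaceBeltrami, this, ← mul_assoc, inv_mul_cancel₀, one_mul]
  exact (Real.sqrt_pos.mpr (hdet x hx)).ne'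

end IsNormalVariation

end Family

/-! ### Regularity of the unit normal -/

section UnitNormal

variable {G : Euc 3 → Matrix (Fin 3) (Fin 3) ℝ} {Ω : Set (Euc 3)}
  {u : ℝ × Euc 2 → Euc 3} {D : Set (ℝ × Euc 2)}

/-- A continuous unit normal field of a `C²` surface is `C¹`. -/
theorem IsImmersedFamily.contDiffOn_of_unit_normal (h : IsImmersedFamily G Ω u D)
    {U : Set (Euc 2)} (hU : IsOpen U) (hUD : ∀ x ∈ U, ((0 : ℝ), x) ∈ D) {ν : Euc 2 → Fin 3 → ℝ}
    (hν : ContinuousOn ν U) (hunit : ∀ x ∈ U, metricForm (G (u (0, x))) (ν x) (ν x) = 1)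
    (horth : ∀ x ∈ U, ∀ i, metricForm (G (u (0, x))) (ν x) (leafField u i (0, x)) = 0) :
    ContDiffOn ℝ 1 ν U := by
  intro x₀ hx₀
  refine ContDiffAt.contDiffWithinAt ?_
  have hcomp : ∀ {V : Type} [NormedAddCommGroup V] [NormedSpace ℝ V] {φ : ℝ × Euc 2 → V},
      ContDiffOn ℝ 1 φ D → ContDiffOn ℝ 1 (fun x => φ (0, x)) U := fun hφ =>
    hφ.comp (by fun_prop : ContDiff ℝ 1 fun x : Euc 2 => ((0 : ℝ), x)).contDiffOn hUD
  set e := ν x₀ with he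
  have hA : ∀ i j, ContDiffOn ℝ 1 (fun x => G (u (0, x)) i j) U := fun i j =>
    hcomp (h.contDiffOn_metric_comp i j)
  have hL : ∀ i, ContDiffOn ℝ 1 (fun x => leafField u i (0, x)) U := fun i =>
    hcomp (h.contDiffOn_leafField i)
  have hg : ∀ i j, ContDiffOn ℝ 1 (fun x => gram G u i j (0, x)) U := fun i j =>
    hcomp (h.contDiffOn_gram i j)
  have hW : ContDiffOn ℝ 1 (fun x => areaDensity G u (0, x) ^ 2) U :=
    (hcomp h.contDiffOn_areaDensity).pow 2
  have hW0 : ∀ x ∈ U, areaDensity G u (0, x) ^ 2 ≠ 0 := fun x hx =>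
    (pow_pos (h.areaDensity_pos (hUD x hx)) 2).ne'
  have heL : ∀ i, ContDiffOn ℝ 1
      (fun x => metricForm (G (u (0, x))) e (leafField u i (0, x))) U := fun i =>
    contDiffOn_metricForm hA contDiffOn_const (hL i)
  -- The normal part of the constant coordinate vector `e = ν x₀`. It is built from `C¹` data
  -- without using `ν x`, yet equals `⟨e, ν⟩ ν`.
  set N : Euc 2 → Fin 3 → ℝ := fun x => e
    - ((gram G u 1 1 (0, x) * metricForm (G (u (0, x))) e (leafField u 0 (0, x))
        - gram G u 0 1 (0, x) * metricForm (G (u (0, x))) e (leafField u 1 (0, x)))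
        / areaDensity G u (0, x) ^ 2) • leafField u 0 (0, x)
    - ((gram G u 0 0 (0, x) * metricForm (G (u (0, x))) e (leafField u 1 (0, x))
        - gram G u 0 1 (0, x) * metricForm (G (u (0, x))) e (leafField u 0 (0, x)))
        / areaDensity G u (0, x) ^ 2) • leafField u 1 (0, x) with hN
  have hNsmooth : ContDiffOn ℝ 1 N U :=
    (contDiffOn_const.sub (((((hg 1 1).mul (heL 0)).sub ((hg 0 1).mul (heL 1))).div hW hW0).smul
      (hL 0))).sub (((((hg 0 0).mul (heL 1)).sub ((hg 0 1).mul (heL 0))).div hW hW0).smul (hL 1))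
  have hNν : ∀ x ∈ U, N x = metricForm (G (u (0, x))) e (ν x) • ν x := fun x hx => by
    have hd := h.eq_normal_add_tangential (h.mapsTo (hUD x hx)) (hunit x hx) (horth x hx 0)
      (horth x hx 1) (hW0 x hx) (h.areaDensity_sq (hUD x hx)) (h.immersed _ (hUD x hx)) e
    simp only [hN]
    rw [sub_sub, sub_eq_iff_eq_add, ← add_assoc]
    exact hd
  have hNN : ContDiffOn ℝ 1 (fun x => metricForm (G (u (0, x))) (N x) (N x)) U :=
    contDiffOn_metricForm hA hNsmooth hNsmooth
  have hNN' : ∀ x ∈ U, metricForm (G (u (0, x))) (N x) (N x)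
      = metricForm (G (u (0, x))) e (ν x) ^ 2 := fun x hx => by
    rw [hNν x hx]
    simp only [map_smul, LinearMap.smul_apply, smul_eq_mul, hunit x hx]
    ring
  have hcont : ContinuousAt (fun x => metricForm (G (u (0, x))) e (ν x)) x₀ := by
    have : ContinuousOn (fun x => metricForm (G (u (0, x))) e (ν x)) U := by
      simp only [metricForm_eq_sum]
      exact continuousOn_finsetSum _ fun i _ => continuousOn_finsetSum _ fun j _ =>
        ((hA i j).continuousOn.mul continuousOn_const).mul (continuousOn_pi.mp hν j)
    exact this.continuousAt (hU.mem_nhds hx₀)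
  have hone : metricForm (G (u (0, x₀))) e (ν x₀) = 1 := hunit x₀ hx₀
  -- Continuity of `ν` enters here: it fixes the sign, so that normalizing `N` gives `ν` and not
  -- `-ν` near `x₀`.
  have hev : ∀ᶠ x in 𝓝 x₀, 0 < metricForm (G (u (0, x))) e (ν x) :=
    hcont.eventually (lt_mem_nhds (by simp only [hone]; exact one_pos))
  have hform : ν =ᶠ[𝓝 x₀] fun x => (√(metricForm (G (u (0, x))) (N x) (N x)))⁻¹ • N x := by
    filter_upwards [hev, hU.mem_nhds hx₀] with x hx hxU
    rw [hNN' x hxU, Real.sqrt_sq hx.le, hNν x hxU, smul_smul, inv_mul_cancel₀ hx.ne', one_smul]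
  have hne : metricForm (G (u (0, x₀))) (N x₀) (N x₀) ≠ 0 := by
    rw [hNN' x₀ hx₀, hone]
    norm_num
  refine ContDiffAt.congr_of_eventuallyEq ?_ hform
  exact (((hNN.contDiffAt (hU.mem_nhds hx₀)).sqrt hne).inv
    (Real.sqrt_ne_zero'.mpr (lt_of_le_of_ne (by rw [hNN' x₀ hx₀]; positivity) hne.symm))).smul
    (hNsmooth.contDiffAt (hU.mem_nhds hx₀))

end UnitNormal

/-! ### The Riemannian metric in a chart -/

section Manifolds

variable {M : Type*} [TopologicalSpace M] [ChartedSpace (Euc 3) M]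
  [IsManifold 𝓘(ℝ, Euc 3) ∞ M]

theorem sum_single_eq_toLp {n : ℕ} (X : Fin n → ℝ) :
    ∑ i, X i • EuclideanSpace.single i (1 : ℝ) = WithLp.toLp 2 X := by
  ext j
  simp [Finset.sum_apply, Pi.single_apply]

/-- The metric in a chart is the pull-back of the metric by the inverse of the chart. -/
theorem metricForm_metricMatrix (g : Metric M) (q : M) (y : Euc 3) (X Y : Fin 3 → ℝ) :
    metricForm (metricMatrix g q y) X Y
      = g.inner ((extChartAt 𝓘(ℝ, Euc 3) q).symm y)
        (mfderiv 𝓘(ℝ, Euc 3) 𝓘(ℝ, Euc 3) (extChartAt 𝓘(ℝ, Euc 3) q).symm y (WithLp.toLp 2 X))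
        (mfderiv 𝓘(ℝ, Euc 3) 𝓘(ℝ, Euc 3) (extChartAt 𝓘(ℝ, Euc 3) q).symm y
          (WithLp.toLp 2 Y)) := by
  let L : Euc 3 →L[ℝ] TangentSpace 𝓘(ℝ, Euc 3) ((extChartAt 𝓘(ℝ, Euc 3) q).symm y) :=
    mfderiv 𝓘(ℝ, Euc 3) 𝓘(ℝ, Euc 3) (extChartAt 𝓘(ℝ, Euc 3) q).symm y
  change _ = g.inner _ (L (WithLp.toLp 2 X)) (L (WithLp.toLp 2 Y))
  rw [← sum_single_eq_toLp X, ← sum_single_eq_toLp Y, metricForm_eq_sum]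
  simp only [map_sum, map_smul, sum_apply, smul_apply, smul_eq_mul, Finset.mul_sum]
  rw [Finset.sum_comm]
  refine Finset.sum_congr rfl fun i _ => Finset.sum_congr rfl fun j _ => ?_
  change g.inner _ (L _) (L _) * X j * Y i = _
  ring

theorem mfderiv_extChartAt_symm_comp {n : ℕ} {N : Type*} [TopologicalSpace N]
    [ChartedSpace (Euc n) N] [IsManifold 𝓘(ℝ, Euc n) ∞ N] {q r : N}
    (hr : r ∈ (extChartAt 𝓘(ℝ, Euc n) q).source) (v : TangentSpace 𝓘(ℝ, Euc n) r) :
    mfderiv 𝓘(ℝ, Euc n) 𝓘(ℝ, Euc n) (extChartAt 𝓘(ℝ, Euc n) q).symm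
      (extChartAt 𝓘(ℝ, Euc n) q r)
      (mfderiv 𝓘(ℝ, Euc n) 𝓘(ℝ, Euc n) (extChartAt 𝓘(ℝ, Euc n) q) r v) = v := by
  have h := mfderivWithin_extChartAt_symm_comp_mfderiv_extChartAt' (I := 𝓘(ℝ, Euc n)) hr
  rw [modelWithCornersSelf_coe, range_id, mfderivWithin_univ] at h
  exact congrArg (fun L => L v) h

theorem injective_mfderiv_extChartAt_symm {n : ℕ} {N : Type*} [TopologicalSpace N]
    [ChartedSpace (Euc n) N] [IsManifold 𝓘(ℝ, Euc n) ∞ N] {q : N} {y : Euc n}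
    (hy : y ∈ (extChartAt 𝓘(ℝ, Euc n) q).target) :
    Function.Injective (mfderiv 𝓘(ℝ, Euc n) 𝓘(ℝ, Euc n) (extChartAt 𝓘(ℝ, Euc n) q).symm y) := by
  have h := mfderiv_extChartAt_comp_mfderivWithin_extChartAt_symm (I := 𝓘(ℝ, Euc n)) hy
  rw [modelWithCornersSelf_coe, range_id, mfderivWithin_univ] at h
  exact Function.LeftInverse.injective fun v => congrArg (fun L => L v) h

theorem injective_mfderiv_extChartAt {n : ℕ} {N : Type*} [TopologicalSpace N]
    [ChartedSpace (Euc n) N] [IsManifold 𝓘(ℝ, Euc n) ∞ N] {q r : N}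
    (hr : r ∈ (extChartAt 𝓘(ℝ, Euc n) q).source) :
    Function.Injective (mfderiv 𝓘(ℝ, Euc n) 𝓘(ℝ, Euc n) (extChartAt 𝓘(ℝ, Euc n) q) r) :=
  Function.LeftInverse.injective fun v => mfderiv_extChartAt_symm_comp hr v

/-- The metric at a point is computed from the coordinates of the vectors. -/
theorem inner_eq_metricForm (g : Metric M) {q r : M}
    (hr : r ∈ (extChartAt 𝓘(ℝ, Euc 3) q).source) (v w : TangentSpace 𝓘(ℝ, Euc 3) r) :
    g.inner r v w = metricForm (metricMatrix g q (extChartAt 𝓘(ℝ, Euc 3) q r))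
      (WithLp.ofLp (mfderiv 𝓘(ℝ, Euc 3) 𝓘(ℝ, Euc 3) (extChartAt 𝓘(ℝ, Euc 3) q) r v : Euc 3))
      (WithLp.ofLp (mfderiv 𝓘(ℝ, Euc 3) 𝓘(ℝ, Euc 3) (extChartAt 𝓘(ℝ, Euc 3) q) r w : Euc 3)) := by
  refine Eq.trans ?_ (metricForm_metricMatrix g q _ _ _).symm
  change g.inner r v w = g.inner ((extChartAt 𝓘(ℝ, Euc 3) q).symm (extChartAt 𝓘(ℝ, Euc 3) q r))
    (mfderiv 𝓘(ℝ, Euc 3) 𝓘(ℝ, Euc 3) (extChartAt 𝓘(ℝ, Euc 3) q).symm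
      (extChartAt 𝓘(ℝ, Euc 3) q r)
      (mfderiv 𝓘(ℝ, Euc 3) 𝓘(ℝ, Euc 3) (extChartAt 𝓘(ℝ, Euc 3) q) r v))
    (mfderiv 𝓘(ℝ, Euc 3) 𝓘(ℝ, Euc 3) (extChartAt 𝓘(ℝ, Euc 3) q).symm
      (extChartAt 𝓘(ℝ, Euc 3) q r)
      (mfderiv 𝓘(ℝ, Euc 3) 𝓘(ℝ, Euc 3) (extChartAt 𝓘(ℝ, Euc 3) q) r w))
  have hv := mfderiv_extChartAt_symm_comp hr v
  have hw := mfderiv_extChartAt_symm_comp hr w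
  -- Going to the chart and back returns `r` only up to a propositional equality, so the fibre of
  -- the metric has to be transported.
  have hi : ∀ r' : M, r' = r → ∀ v' w' : Euc 3, g.inner r' v' w' = g.inner r v' w' := by
    rintro _ rfl _ _
    rfl
  exact ((hi _ ((extChartAt 𝓘(ℝ, Euc 3) q).left_inv hr) _ _).trans
    (congrArg₂ (fun a b : TangentSpace 𝓘(ℝ, Euc 3) r => g.inner r a b) hv hw)).symm

/-- The coordinate fields are images of constant vectors under the tangent map of the inverse chart,
hence smooth into the tangent bundle; the smooth bundle metric is applied to them. -/
theorem contDiffOn_metricMatrix (g : Metric M) (q : M) (i j : Fin 3) :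
    ContDiffOn ℝ ∞ (fun y => metricMatrix g q y i j) (extChartAt 𝓘(ℝ, Euc 3) q).target := by
  set φ := extChartAt 𝓘(ℝ, Euc 3) q with hφ
  have hopen : IsOpen φ.target := isOpen_extChartAt_target q
  have hsymm : ContMDiffOn 𝓘(ℝ, Euc 3) 𝓘(ℝ, Euc 3) ∞ φ.symm φ.target :=
    contMDiffOn_extChartAt_symm q
  have hvec : ∀ i : Fin 3, ContMDiffOn 𝓘(ℝ, Euc 3) (𝓘(ℝ, Euc 3).prod 𝓘(ℝ, Euc 3)) ∞
      (fun y => (⟨φ.symm y, mfderiv 𝓘(ℝ, Euc 3) 𝓘(ℝ, Euc 3) φ.symm y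
        (EuclideanSpace.single i 1)⟩ : TangentBundle 𝓘(ℝ, Euc 3) M)) φ.target := by
    intro i
    have h1 := hsymm.contMDiffOn_tangentMapWithin (m := ∞) (by simp) hopen.uniqueMDiffOn
    have h2 : ContMDiffOn 𝓘(ℝ, Euc 3) (𝓘(ℝ, Euc 3).prod 𝓘(ℝ, Euc 3)) ∞
        (fun y : Euc 3 => (⟨y, EuclideanSpace.single i 1⟩ : TangentBundle 𝓘(ℝ, Euc 3) (Euc 3)))
        φ.target := contMDiffOn_vectorSpace_iff_contDiffOn.mpr contDiffOn_const
    refine (h1.comp h2 fun y hy => hy).congr fun y hy => ?_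
    simp only [Function.comp_apply, tangentMapWithin, mfderivWithin_of_isOpen hopen hy]
  have hg : ContMDiffOn 𝓘(ℝ, Euc 3) (𝓘(ℝ, Euc 3).prod 𝓘(ℝ, Euc 3 →L[ℝ] Euc 3 →L[ℝ] ℝ)) ∞
      (fun y => Bundle.TotalSpace.mk' (Euc 3 →L[ℝ] Euc 3 →L[ℝ] ℝ)
        (E := fun x : M => TangentSpace 𝓘(ℝ, Euc 3) x →L[ℝ] TangentSpace 𝓘(ℝ, Euc 3) x →L[ℝ] ℝ)
        (φ.symm y) (g.inner (φ.symm y))) φ.target :=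
    g.contMDiff.comp_contMDiffOn hsymm
  have := ContMDiffOn.clm_bundle_apply₂ (F₁ := Euc 3) (F₂ := Euc 3) (F₃ := ℝ)
    (E₃ := Bundle.Trivial M ℝ) hg (hvec i) (hvec j)
  intro y hy
  have h3 := this y hy
  rw [Bundle.contMDiffWithinAt_totalSpace] at h3
  exact h3.2.contDiffWithinAt

theorem isMetricOn_metricMatrix (g : Metric M) (q : M) :
    IsMetricOn (metricMatrix g q) (extChartAt 𝓘(ℝ, Euc 3) q).target where
  isOpen := isOpen_extChartAt_target q
  contDiffOn := contDiffOn_metricMatrix g q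
  isSymm y _ := Matrix.IsSymm.ext fun i j => g.symm _ _ _
  pos y hy X hX := by
    rw [metricForm_metricMatrix]
    refine g.pos _ _ fun h0 => hX ?_
    have := injective_mfderiv_extChartAt_symm hy (h0.trans (map_zero _).symm)
    exact congrArg WithLp.ofLp this

end Manifolds

/-! ### The minimal family in charts -/

section Charts

variable {M : Type*} [TopologicalSpace M] [ChartedSpace (Euc 3) M]
variable {S : Type*} [TopologicalSpace S] [ChartedSpace (Euc 2) S]

/-- The family `h` read in the chart of `S` around `c` and the chart of `M` around `q`. -/
def chartRep (h : ℝ × S → M) (c : S) (q : M) (z : ℝ × Euc 2) : Euc 3 :=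
  extChartAt 𝓘(ℝ, Euc 3) q (h (z.1, (extChartAt 𝓘(ℝ, Euc 2) c).symm z.2))

/-- The parameters `(t, x)` at which the family `h` can be read in charts. -/
def chartDomain (ε : ℝ) (h : ℝ × S → M) (c : S) (q : M) : Set (ℝ × Euc 2) :=
  (Ioo (-ε) ε ×ˢ (extChartAt 𝓘(ℝ, Euc 2) c).target) ∩
    (fun z => h (z.1, (extChartAt 𝓘(ℝ, Euc 2) c).symm z.2)) ⁻¹' (extChartAt 𝓘(ℝ, Euc 3) q).source

variable [IsManifold 𝓘(ℝ, Euc 3) ∞ M] {g : Metric M} {ε : ℝ} {h : ℝ × S → M}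

theorem IsMinimalFamily.mdifferentiableAt (hh : IsMinimalFamily g ε h) {t : ℝ}
    (ht : t ∈ Ioo (-ε) ε) (p : S) :
    MDifferentiableAt (𝓘(ℝ, ℝ).prod 𝓘(ℝ, Euc 2)) 𝓘(ℝ, Euc 3) h (t, p) :=
  (hh.contMDiffOn.contMDiffAt ((isOpen_Ioo.prod isOpen_univ).mem_nhds
    ⟨ht, mem_univ p⟩)).mdifferentiableAt (by simp)

theorem IsMinimalFamily.mdifferentiableAt_leaf (hh : IsMinimalFamily g ε h) {t : ℝ}
    (ht : t ∈ Ioo (-ε) ε) (p : S) :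
    MDifferentiableAt 𝓘(ℝ, Euc 2) 𝓘(ℝ, Euc 3) (fun p => h (t, p)) p :=
  (hh.mdifferentiableAt ht p).comp p (mdifferentiableAt_const.prodMk mdifferentiableAt_id)

theorem IsMinimalFamily.mdifferentiableAt_time (hh : IsMinimalFamily g ε h) {t : ℝ}
    (ht : t ∈ Ioo (-ε) ε) (p : S) :
    MDifferentiableAt 𝓘(ℝ, ℝ) 𝓘(ℝ, Euc 3) (fun t => h (t, p)) t :=
  (hh.mdifferentiableAt ht p).comp t (mdifferentiableAt_id.prodMk mdifferentiableAt_const)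

/-- The derivative of a leaf is the injective derivative of `h` composed with the inclusion `v ↦ (0,
v)`. -/
theorem IsMinimalFamily.injective_mfderiv_leaf (hh : IsMinimalFamily g ε h) {t : ℝ}
    (ht : t ∈ Ioo (-ε) ε) (p : S) :
    Function.Injective (mfderiv 𝓘(ℝ, Euc 2) 𝓘(ℝ, Euc 3) (fun p => h (t, p)) p) := by
  have h1 : mfderiv 𝓘(ℝ, Euc 2) 𝓘(ℝ, Euc 3) (fun p => h (t, p)) p
      = (mfderiv (𝓘(ℝ, ℝ).prod 𝓘(ℝ, Euc 2)) 𝓘(ℝ, Euc 3) h (t, p)).comp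
        (mfderiv 𝓘(ℝ, Euc 2) (𝓘(ℝ, ℝ).prod 𝓘(ℝ, Euc 2)) (fun p : S => (t, p)) p) :=
    mfderiv_comp p (hh.mdifferentiableAt ht p) (mdifferentiableAt_const.prodMk mdifferentiableAt_id)
  rw [h1, mfderiv_prod_right]
  exact (hh.injective_mfderiv (t, p) ⟨ht, mem_univ p⟩).comp fun v w hvw => congrArg Prod.snd hvw

theorem mdifferentiableAt_extChartAt_of_mem {n : ℕ} {N : Type*} [TopologicalSpace N]
    [ChartedSpace (Euc n) N] [IsManifold 𝓘(ℝ, Euc n) ∞ N] {q r : N}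
    (hr : r ∈ (extChartAt 𝓘(ℝ, Euc n) q).source) :
    MDifferentiableAt 𝓘(ℝ, Euc n) 𝓘(ℝ, Euc n) (extChartAt 𝓘(ℝ, Euc n) q) r := by
  rw [extChartAt_source] at hr
  exact mdifferentiableAt_extChartAt hr

theorem mdifferentiableAt_extChartAt_symm_of_mem {n : ℕ} {N : Type*} [TopologicalSpace N]
    [ChartedSpace (Euc n) N] [IsManifold 𝓘(ℝ, Euc n) ∞ N] {q : N} {y : Euc n}
    (hy : y ∈ (extChartAt 𝓘(ℝ, Euc n) q).target) :
    MDifferentiableAt 𝓘(ℝ, Euc n) 𝓘(ℝ, Euc n) (extChartAt 𝓘(ℝ, Euc n) q).symm y :=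
  ((contMDiffOn_extChartAt_symm (n := ∞) q).contMDiffAt
    ((isOpen_extChartAt_target q).mem_nhds hy)).mdifferentiableAt (by simp)

/-- The coordinates of a vector field along the leaf `t = 0`. -/
def normalRep (h : ℝ × S → M) (ν : ∀ p : S, TangentSpace 𝓘(ℝ, Euc 3) (h (0, p))) (c : S) (q : M)
    (x : Euc 2) : Fin 3 → ℝ :=
  WithLp.ofLp (mfderiv 𝓘(ℝ, Euc 3) 𝓘(ℝ, Euc 3) (extChartAt 𝓘(ℝ, Euc 3) q)
    (h (0, (extChartAt 𝓘(ℝ, Euc 2) c).symm x)) (ν ((extChartAt 𝓘(ℝ, Euc 2) c).symm x)) : Euc 3)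

/-- The tangent map of the chart carries the continuous section into the tangent bundle of `Euc 3`,
where the vector component is a continuous function. -/
theorem IsUnitNormal.continuousOn_normalRep
    {ν : ∀ p : S, TangentSpace 𝓘(ℝ, Euc 3) (h (0, p))} (hν : IsUnitNormal g (fun p => h (0, p)) ν)
    (c : S) (q : M) :
    ContinuousOn (normalRep h ν c q) {x | ((0 : ℝ), x) ∈ chartDomain ε h c q} := by
  have hopen : IsOpen (extChartAt 𝓘(ℝ, Euc 3) q).source := isOpen_extChartAt_source q
  have h1 : ContMDiffOn 𝓘(ℝ, Euc 3) 𝓘(ℝ, Euc 3) ∞ (extChartAt 𝓘(ℝ, Euc 3) q)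
      (extChartAt 𝓘(ℝ, Euc 3) q).source := by
    rw [extChartAt_source]
    exact contMDiffOn_extChartAt
  have h2 := h1.continuousOn_tangentMapWithin (by simp) hopen.uniqueMDiffOn
  have h3 : ContinuousOn (fun x => (⟨h (0, (extChartAt 𝓘(ℝ, Euc 2) c).symm x),
      ν ((extChartAt 𝓘(ℝ, Euc 2) c).symm x)⟩ : TangentBundle 𝓘(ℝ, Euc 3) M))
      {x | ((0 : ℝ), x) ∈ chartDomain ε h c q} :=
    hν.continuous.comp_continuousOn ((continuousOn_extChartAt_symm c).mono fun x hx => hx.1.2)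
  have h4 := contMDiff_snd_tangentBundle_modelSpace (Euc 3) 𝓘(ℝ, Euc 3) (n := 0)
  have h5 := h4.continuous.comp_continuousOn (h2.comp h3 fun x hx => hx.2)
  have h6 : Continuous fun v : Euc 3 => v.ofLp := PiLp.continuous_ofLp 2 _
  refine (h6.comp_continuousOn h5).congr fun x hx => ?_
  have h7 := mfderivWithin_of_isOpen (I := 𝓘(ℝ, Euc 3)) (I' := 𝓘(ℝ, Euc 3))
    (f := extChartAt 𝓘(ℝ, Euc 3) q) hopen hx.2
  exact congrArg (fun L => WithLp.ofLp (L (ν ((extChartAt 𝓘(ℝ, Euc 2) c).symm x)) : Euc 3)) h7.symm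

variable [IsManifold 𝓘(ℝ, Euc 2) ∞ S]

theorem IsMinimalFamily.contMDiffOn_comp_chart (hh : IsMinimalFamily g ε h) (c : S) :
    ContMDiffOn 𝓘(ℝ, ℝ × Euc 2) 𝓘(ℝ, Euc 3) 2
      (fun z : ℝ × Euc 2 => h (z.1, (extChartAt 𝓘(ℝ, Euc 2) c).symm z.2))
      (Ioo (-ε) ε ×ˢ (extChartAt 𝓘(ℝ, Euc 2) c).target) := by
  have h1 : ContMDiffOn 𝓘(ℝ, ℝ × Euc 2) 𝓘(ℝ, ℝ) 2 (fun z : ℝ × Euc 2 => z.1)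
      (Ioo (-ε) ε ×ˢ (extChartAt 𝓘(ℝ, Euc 2) c).target) := contDiff_fst.contMDiff.contMDiffOn
  have h2 : ContMDiffOn 𝓘(ℝ, ℝ × Euc 2) 𝓘(ℝ, Euc 2) 2
      (fun z : ℝ × Euc 2 => (extChartAt 𝓘(ℝ, Euc 2) c).symm z.2)
      (Ioo (-ε) ε ×ˢ (extChartAt 𝓘(ℝ, Euc 2) c).target) := by
    have h3 : ContMDiffOn 𝓘(ℝ, ℝ × Euc 2) 𝓘(ℝ, Euc 2) 2 (fun z : ℝ × Euc 2 => z.2)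
      (Ioo (-ε) ε ×ˢ (extChartAt 𝓘(ℝ, Euc 2) c).target) := contDiff_snd.contMDiff.contMDiffOn
    exact ((contMDiffOn_extChartAt_symm (n := ∞) c).of_le (WithTop.coe_le_coe.mpr (le_top (a := 2)))).comp h3 fun z hz => hz.2
  exact hh.contMDiffOn.comp (h1.prodMk h2) fun z hz => ⟨hz.1, mem_univ _⟩

theorem IsMinimalFamily.isOpen_chartDomain (hh : IsMinimalFamily g ε h) (c : S) (q : M) :
    IsOpen (chartDomain ε h c q) :=
  (hh.contMDiffOn_comp_chart c).continuousOn.isOpen_inter_preimage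
    (isOpen_Ioo.prod (isOpen_extChartAt_target c)) (isOpen_extChartAt_source q)

theorem IsMinimalFamily.contDiffOn_chartRep (hh : IsMinimalFamily g ε h) (c : S) (q : M) :
    ContDiffOn ℝ 2 (chartRep h c q) (chartDomain ε h c q) := by
  have h1 : ContMDiffOn 𝓘(ℝ, Euc 3) 𝓘(ℝ, Euc 3) 2 (extChartAt 𝓘(ℝ, Euc 3) q)
      (extChartAt 𝓘(ℝ, Euc 3) q).source := by
    rw [extChartAt_source]
    exact (contMDiffOn_extChartAt (n := ∞)).of_le (WithTop.coe_le_coe.mpr (le_top (a := 2)))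
  exact (h1.comp ((hh.contMDiffOn_comp_chart c).mono inter_subset_left)
    fun z hz => hz.2).contDiffOn

/-- The chain rule for the leaves read in charts. -/
theorem IsMinimalFamily.fderiv_chartRep_leaf (hh : IsMinimalFamily g ε h) {c : S} {q : M}
    {t : ℝ} {x : Euc 2} (hz : (t, x) ∈ chartDomain ε h c q) (w : Euc 2) :
    fderiv ℝ (chartRep h c q) (t, x) (0, w)
      = mfderiv 𝓘(ℝ, Euc 3) 𝓘(ℝ, Euc 3) (extChartAt 𝓘(ℝ, Euc 3) q)
        (h (t, (extChartAt 𝓘(ℝ, Euc 2) c).symm x))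
        (mfderiv 𝓘(ℝ, Euc 2) 𝓘(ℝ, Euc 3) (fun p => h (t, p))
          ((extChartAt 𝓘(ℝ, Euc 2) c).symm x)
          (mfderiv 𝓘(ℝ, Euc 2) 𝓘(ℝ, Euc 2) (extChartAt 𝓘(ℝ, Euc 2) c).symm x w)) := by
  have hd : DifferentiableAt ℝ (chartRep h c q) (t, x) :=
    ((hh.contDiffOn_chartRep c q).contDiffAt ((hh.isOpen_chartDomain c q).mem_nhds
      hz)).differentiableAt (by simp)
  have h1 : fderiv ℝ (chartRep h c q) (t, x) (0, w)
      = fderiv ℝ (fun x => chartRep h c q (t, x)) x w := by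
    have := hd.hasFDerivAt.comp x
      ((hasFDerivAt_const t x).prodMk (hasFDerivAt_id x))
    exact (congrArg (fun L => L w) this.fderiv).symm
  rw [h1, ← mfderiv_eq_fderiv]
  have h2 := (hh.mdifferentiableAt_leaf hz.1.1 ((extChartAt 𝓘(ℝ, Euc 2) c).symm x)).comp x
    (mdifferentiableAt_extChartAt_symm_of_mem hz.1.2)
  have h3 := mfderiv_comp x (mdifferentiableAt_extChartAt_of_mem hz.2) h2
  have h4 := mfderiv_comp x (hh.mdifferentiableAt_leaf hz.1.1 ((extChartAt 𝓘(ℝ, Euc 2) c).symm x))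
    (mdifferentiableAt_extChartAt_symm_of_mem hz.1.2)
  exact (congrArg (fun L => L w) h3).trans (congrArg (fun v => mfderiv 𝓘(ℝ, Euc 3) 𝓘(ℝ, Euc 3)
    (extChartAt 𝓘(ℝ, Euc 3) q) (h (t, (extChartAt 𝓘(ℝ, Euc 2) c).symm x)) v)
      (congrArg (fun L => L w) h4))

/-- The variation field read in charts. -/
theorem IsMinimalFamily.fderiv_chartRep_timeDir (hh : IsMinimalFamily g ε h) {c : S} {q : M}
    {x : Euc 2} (hz : ((0 : ℝ), x) ∈ chartDomain ε h c q) :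
    fderiv ℝ (chartRep h c q) (0, x) timeDir
      = mfderiv 𝓘(ℝ, Euc 3) 𝓘(ℝ, Euc 3) (extChartAt 𝓘(ℝ, Euc 3) q)
        (h (0, (extChartAt 𝓘(ℝ, Euc 2) c).symm x))
        (variationField h ((extChartAt 𝓘(ℝ, Euc 2) c).symm x)) := by
  have hd : DifferentiableAt ℝ (chartRep h c q) (0, x) :=
    ((hh.contDiffOn_chartRep c q).contDiffAt ((hh.isOpen_chartDomain c q).mem_nhds
      hz)).differentiableAt (by simp)
  have h1 : fderiv ℝ (chartRep h c q) (0, x) timeDir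
      = fderiv ℝ (fun t => chartRep h c q (t, x)) 0 1 := by
    have h2 : HasFDerivAt (fun t : ℝ => (t, x))
        ((ContinuousLinearMap.id ℝ ℝ).prod (0 : ℝ →L[ℝ] Euc 2)) 0 :=
      (hasFDerivAt_id 0).prodMk (hasFDerivAt_const x 0)
    have := hd.hasFDerivAt.comp (0 : ℝ) h2
    exact (congrArg (fun L => L 1) this.fderiv).symm
  rw [h1, ← mfderiv_eq_fderiv]
  exact congrArg (fun L => L (1 : ℝ)) (mfderiv_comp (0 : ℝ)
    (mdifferentiableAt_extChartAt_of_mem hz.2)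
    (hh.mdifferentiableAt_time hz.1.1 ((extChartAt 𝓘(ℝ, Euc 2) c).symm x)))

theorem IsMinimalFamily.isImmersedFamily (hh : IsMinimalFamily g ε h) (c : S) (q : M) :
    IsImmersedFamily (metricMatrix g q) (extChartAt 𝓘(ℝ, Euc 3) q).target (chartRep h c q)
      (chartDomain ε h c q) where
  toIsMetricOn := isMetricOn_metricMatrix g q
  isOpen_domain := hh.isOpen_chartDomain c q
  contDiffOn_map := hh.contDiffOn_chartRep c q
  mapsTo := fun z hz => (extChartAt 𝓘(ℝ, Euc 3) q).map_source hz.2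
  immersed := by
    rintro ⟨t, x⟩ hz a b hab
    have h1 : fderiv ℝ (chartRep h c q) (t, x)
        (0, a • EuclideanSpace.single 0 1 + b • EuclideanSpace.single 1 1) = 0 := by
      have h2 : ((0 : ℝ), a • EuclideanSpace.single (0 : Fin 2) (1 : ℝ)
          + b • EuclideanSpace.single 1 1) = a • spaceDir 0 + b • spaceDir 1 := by
        simp [spaceDir]
      rw [h2, map_add, map_smul, map_smul]
      exact congrArg (WithLp.toLp 2) hab
    rw [hh.fderiv_chartRep_leaf hz] at h1
    -- The vanishing is pulled back through the three injective factors of the chain rule: the chart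
    -- of `M`, the leaf, and the inverse chart of `S`.
    have h3 := injective_mfderiv_extChartAt hz.2 (h1.trans (map_zero _).symm)
    have h4 := hh.injective_mfderiv_leaf hz.1.1 _ (h3.trans (map_zero _).symm)
    have h5 : a • EuclideanSpace.single (0 : Fin 2) (1 : ℝ) + b • EuclideanSpace.single 1 1 = 0 :=
      injective_mfderiv_extChartAt_symm hz.1.2 (h4.trans (map_zero _).symm)
    constructor
    · simpa using congrArg (fun v : Euc 2 => v 0) h5
    · simpa using congrArg (fun v : Euc 2 => v 1) h5

theorem IsMinimalFamily.isNormalVariation (hh : IsMinimalFamily g ε h)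
    {ν : ∀ p : S, TangentSpace 𝓘(ℝ, Euc 3) (h (0, p))} (hν : IsUnitNormal g (fun p => h (0, p)) ν)
    {f : S → ℝ} (hf : ContMDiff 𝓘(ℝ, Euc 2) 𝓘(ℝ, ℝ) 2 f)
    (hfν : ∀ p, f p = g.inner (h (0, p)) (variationField h p) (ν p)) (c : S) (q : M) :
    IsNormalVariation (metricMatrix g q) (extChartAt 𝓘(ℝ, Euc 3) q).target (chartRep h c q)
      (chartDomain ε h c q) {x | ((0 : ℝ), x) ∈ chartDomain ε h c q} (normalRep h ν c q)
      (fun x => f ((extChartAt 𝓘(ℝ, Euc 2) c).symm x)) := by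
  have hU : IsOpen {x | ((0 : ℝ), x) ∈ chartDomain ε h c q} :=
    (hh.isOpen_chartDomain c q).preimage (by fun_prop : Continuous fun x : Euc 2 => ((0 : ℝ), x))
  have hunit : ∀ x ∈ {x | ((0 : ℝ), x) ∈ chartDomain ε h c q},
      metricForm (metricMatrix g q (chartRep h c q (0, x))) (normalRep h ν c q x)
        (normalRep h ν c q x) = 1 := fun x hx =>
    (inner_eq_metricForm g hx.2 _ _).symm.trans (hν.norm_eq_one _)
  have horth : ∀ x ∈ {x | ((0 : ℝ), x) ∈ chartDomain ε h c q}, ∀ i,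
      metricForm (metricMatrix g q (chartRep h c q (0, x))) (normalRep h ν c q x)
        (leafField (chartRep h c q) i (0, x)) = 0 := fun x hx i => by
    have h1 : leafField (chartRep h c q) i (0, x) = _ :=
      congrArg WithLp.ofLp (hh.fderiv_chartRep_leaf hx (EuclideanSpace.single i 1))
    rw [h1]
    exact (inner_eq_metricForm g hx.2 _ _).symm.trans (hν.orthogonal _ _)
  have hI := hh.isImmersedFamily c q
  refine
    { toIsImmersedFamily := hI
      minimal := fun t x hz => ?_
      isOpen_leaf := hU
      mem_domain := fun x hx => hx
      contDiffOn_normal :=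
        hI.contDiffOn_of_unit_normal hU (fun x hx => hx) (hν.continuousOn_normalRep c q) hunit horth
      unit := hunit
      orthogonal := horth
      contDiffOn_speed := ?_
      speed_eq := fun x hx => ?_ }
  · have h1 := hh.minimal t hz.1.1 c q ((extChartAt 𝓘(ℝ, Euc 2) c).symm x)
      (by simpa only [extChartAt_source] using (extChartAt 𝓘(ℝ, Euc 2) c).map_target hz.1.2)
      (extChartAt_source 𝓘(ℝ, Euc 3) q ▸ hz.2)
    rw [(extChartAt 𝓘(ℝ, Euc 2) c).right_inv hz.1.2] at h1
    exact h1
  · exact (hf.comp_contMDiffOn (((contMDiffOn_extChartAt_symm (n := ∞) c).of_le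
      (WithTop.coe_le_coe.mpr (le_top (a := 2)))).mono fun x hx => hx.1.2)).contDiffOn
  · rw [hh.fderiv_chartRep_timeDir hx]
    exact (hfν _).trans (inner_eq_metricForm g hx.2 _ _)

end Charts

end MinimalFamily

end

theorem proposition3p1
    {M : Type*} [TopologicalSpace M] [ChartedSpace (MinimalFamily.Euc 3) M]
    [IsManifold 𝓘(ℝ, MinimalFamily.Euc 3) ∞ M]
    {S : Type*} [TopologicalSpace S] [ChartedSpace (MinimalFamily.Euc 2) S]
    [IsManifold 𝓘(ℝ, MinimalFamily.Euc 2) ∞ S]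
    (g : MinimalFamily.Metric M) (hg : MinimalFamily.IsHyperbolic g)
    (ε : ℝ) (h : ℝ × S → M) (hh : MinimalFamily.IsMinimalFamily g ε h)
    (ν : ∀ p : S, TangentSpace 𝓘(ℝ, MinimalFamily.Euc 3) (h (0, p)))
    (hν : MinimalFamily.IsUnitNormal g (fun p => h (0, p)) ν)
    (f : S → ℝ) (hf : ContMDiff 𝓘(ℝ, MinimalFamily.Euc 2) 𝓘(ℝ, ℝ) 2 f)
    (hfν : ∀ p : S, f p = g.inner (h (0, p)) (MinimalFamily.variationField h p) (ν p)) :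
    ∀ p : S, MinimalFamily.laplacian g (fun q => h (0, q)) f p =
      (2 - MinimalFamily.normSqSecondForm g (fun q => h (0, q)) p) * f p := by
  intro p
  have hp : (extChartAt 𝓘(ℝ, MinimalFamily.Euc 2) p).symm
      (extChartAt 𝓘(ℝ, MinimalFamily.Euc 2) p p) = p := extChartAt_to_inv p
  have hmem : ((0 : ℝ), extChartAt 𝓘(ℝ, MinimalFamily.Euc 2) p p)
      ∈ MinimalFamily.chartDomain ε h p (h (0, p)) := by
    refine ⟨⟨⟨neg_lt_zero.mpr hh.pos, hh.pos⟩, mem_extChartAt_target p⟩, ?_⟩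
    simp only [mem_preimage, hp, mem_extChartAt_source]
  -- The charts centred at `p` and at `h (0, p)` are the ones in which `laplacian` and
  -- `normSqSecondForm` are defined at `p`, so no change of coordinates is needed.
  have key := (hh.isNormalVariation hν hf hfν p (h (0, p))).laplaceBeltrami_eq (hg (h (0, p)))
    hmem
  simp only [hp] at key
  exact key
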